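/- Let $k$ be a real number with $2k\in\{2,3,\dots\}$, put $k'=k-\tfrac14$, let $\mathcal D_1=\{w\in\mathbb C:|w|<1\}$ and $\mathcal D^J_1=\mathbb C\times\mathcal D_1$ with coordinates $(z,w)$. Jacobi group. $\mathrm{SU}(1,1)$ is the group of matrices $g=\begin{pmatrix}a&b\\ \bar b&\bar a\end{pmatrix}$, $|a|^2-|b|^2=1$; it acts on $\mathbb C$ by $g\cdot\alpha=a\alpha+b\bar\alpha$. The Jacobi group $G^J_1$ is the set of triples $(g,\alpha,t)\in \mathrm{SU}(1,1)\times\mathbb C\times\mathbb R$ with $(g_1,\alpha_1,t_1)(g_2,\alpha_2,t_2)=(g_1g_2,\ g_2^{-1}\cdot\alpha_1+\alpha_2,\ t_1+t_2+\operatorname{Im}((g_2^{-1}\cdot\alpha_1)\bar\alpha_2))$. It acts on $\mathcal D^J_1$ by $$(g,\alpha,t)\cdot(z,w)=\Big(\frac{\alpha-\bar\alpha w+z}{\bar b w+\bar a},\ \frac{aw+b}{\bar b w+\bar a}\Big).$$ Coherent states. Let $H$ be the Hilbert space with orthonormal basis $|n\rangle\otimes e_{k',k'+m}$ ($n,m\ge0$),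 $e_0=|0\rangle\otimes e_{k',k'}$, let $a^+|n\rangle=\sqrt{n+1}\,|n+1\rangle$, $K'_+e_{k',k'+m}=\sqrt{(m+1)(m+2k')}\,e_{k',k'+m+1}$, $K_+=\tfrac12(a^+)^2+K'_+$ (together with the adjoints $a$, $K_-$ and $K_0=\tfrac12(a^+a+\tfrac12)+K_0'$, where $K_0'e_{k',k'+m}=(k'+m)e_{k',k'+m}$, this is the representation of the Jacobi algebra with $ae_0=K_-e_0=0$, $K_0e_0=ke_0$), and $e_{z,w}=\exp(za^++wK_+)e_0$. Scalar products are antilinear in the first variable. Put $f_\psi(z,w)=(e_{\bar z,\bar w},\psi)$ for $\psi\in H$ and $K(z,w;\bar z',\bar w')=(e_{\bar z,\bar w},e_{\bar z',\bar w'})$. Let $\mathcal F_K$ be the reproducing kernel Hilbert space of functions on $\mathcal D^J_1$ with kernel $K$. Then: 1. The action is holomorphic and transitive, and the isotropy group of $(0,0)$ is $\{\alpha=0,\ b=0\}$, so that $\mathcal D^J_1= (H_1/\mathbb R)\times \mathrm{SU}(1,1)/\mathrm U(1)$, where $H_1$ is the Heisenberg–Weyl group. For $(z,w)\in\mathcal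 D^J_1$ the exponential series defining $e_{z,w}$ converges in $H$, and on $\mathcal D^J_1$ $$K(z,w;\bar z',\bar w')=(1-w\bar w')^{-2k}\exp\frac{2\bar z'z+z^2\bar w'+\bar z'^2w}{2(1-w\bar w')}.$$ 2. On the diagonal $K$ is positive, and $f=\log K$ is a smooth Kähler potential on $\mathcal D^J_1$: $$f=\frac{2z\bar z+z^2\bar w+\bar z^2w}{2(1-w\bar w)}-2k\log(1-w\bar w).$$ The form $\omega=i\sum_{\alpha,\beta}\mathcal G_{\alpha\beta}\,dz_\alpha\wedge d\bar z_\beta$, with $(z_1,z_2)=(z,w)$ and $\mathcal G_{\alpha\beta}=\partial^2f/\partial z_\alpha\partial\bar z_\beta$, is a Kähler form (the matrix $\mathcal G$ is positive definite and $d\omega=0$), it is $G^J_1$-invariant, and $$-i\omega=\frac{2k}{(1-w\bar w)^2}\,dw\wedge d\bar w+\frac{A\wedge\bar A}{1-w\bar w},\qquad A=dz+\bar\alpha_0\,dw,\quad \alpha_0=\frac{z+\bar zw}{1-w\bar w}.$$ 3. The functions attached to the basis vectors $|n\rangle\otimes e_{k',k'+m}=(n!)^{-1/2}(a^+)^n\big(\tfrac{\Gamma(2k')}{m!\,\Gamma(m+2k')}\big)^{1/2}(K'_+)^me_0$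 are the holomorphic polynomials $$f_{|n\rangle;e_{k',k'+m}}(z,w)=\sqrt{\frac{\Gamma(m+2k')}{m!\,\Gamma(2k')}}\;w^m\,\frac{P_n(z,w)}{\sqrt{n!}},\qquad P_n(z,w)=n!\sum_{j=0}^{[n/2]}\Big(\frac w2\Big)^j\frac{z^{n-2j}}{j!\,(n-2j)!};$$ they form an orthonormal basis of $\mathcal F_K$, and $\psi\mapsto f_\psi$ is a unitary map of $H$ onto $\mathcal F_K$. 4. The measure $d\nu=(1-w\bar w)^{-3}\,d\operatorname{Re}w\,d\operatorname{Im}w\,d\operatorname{Re}z\,d\operatorname{Im}z$ is $G^J_1$-invariant. With $$\rho(z,w)=(1-w\bar w)^{2k}\exp\Big(-\frac{|z|^2}{1-w\bar w}\Big)\exp\Big(-\frac{z^2\bar w+\bar z^2w}{2(1-w\bar w)}\Big),$$ $\mathcal F_K$ consists exactly of the holomorphic functions $\phi$ on $\mathcal D^J_1$ with $\int|\phi|^2\rho\,d\nu<\infty$, and its scalar product is $$(\phi,\psi)=\Lambda\int_{\mathcal D^J_1}\bar\phi\,\psi\,\rho\,d\nu,\qquad \Lambda=\frac{4k-3}{2\pi^2}$$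 (the integral converging absolutely). -/

import Mathlib

open MeasureTheory
open scoped ComplexConjugate InnerProductSpace ComplexOrder

noncomputable section

namespace Jacobi

/-! ### The manifold and the Jacobi group -/

/-- The manifold `ℂ × D₁`, where `D₁` is the open unit disk; points are pairs `(z, w)`. -/
def domain : Set (ℂ × ℂ) := {p | ‖p.2‖ < 1}

/-- The group `SU(1,1)` of matrices `!![a, b; conj b, conj a]` with `|a|² - |b|² = 1`, as a
subgroup of `SL(2, ℂ)`. -/
def su11 : Subgroup (Matrix.SpecialLinearGroup (Fin 2) ℂ) where
  carrier := {g | g 1 0 = conj (g 0 1) ∧ g 1 1 = conj (g 0 0)}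
  one_mem' := by simp
  mul_mem' := by
    rintro g h ⟨hg1, hg2⟩ ⟨hh1, hh2⟩
    simp only [Set.mem_ofPred_eq, Matrix.SpecialLinearGroup.coe_mul, Matrix.mul_apply,
      Fin.sum_univ_two, hg1, hg2, hh1, hh2, map_add, map_mul, Complex.conj_conj]
    constructor <;> ring
  inv_mem' := by
    rintro g ⟨hg1, hg2⟩
    simp [Matrix.SpecialLinearGroup.coe_inv, Matrix.adjugate_fin_two, hg1, hg2]

/-- The group `SU(1,1)`. -/
def SU11 : Type := su11

instance : Group SU11 := inferInstanceAs (Group su11)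

namespace SU11

/-- The entry `a` of `!![a, b; conj b, conj a]`. -/
def a (g : SU11) : ℂ := g.1 0 0

/-- The entry `b` of `!![a, b; conj b, conj a]`. -/
def b (g : SU11) : ℂ := g.1 0 1

lemma det_eq (g : SU11) : g.a * conj g.a - g.b * conj g.b = 1 := by
  have h := g.1.2
  rw [Matrix.det_fin_two] at h
  have h1 := g.2.1
  have h2 := g.2.2
  simp only [a, b]
  rw [← h1, ← h2]
  exact h

lemma a_one : (1 : SU11).a = 1 := by
  change (1 : Matrix.SpecialLinearGroup (Fin 2) ℂ) 0 0 = 1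
  simp

lemma b_one : (1 : SU11).b = 0 := by
  change (1 : Matrix.SpecialLinearGroup (Fin 2) ℂ) 0 1 = 0
  simp

lemma a_mul (g h : SU11) : (g * h).a = g.a * h.a + g.b * conj h.b := by
  have h1 := h.2.1
  simp only [a, b, ← h1]
  change (g.1 * h.1) 0 0 = _
  simp [Matrix.mul_apply, Fin.sum_univ_two]

lemma b_mul (g h : SU11) : (g * h).b = g.a * h.b + g.b * conj h.a := by
  have h1 := h.2.2
  simp only [a, b, ← h1]
  change (g.1 * h.1) 0 1 = _
  simp [Matrix.mul_apply, Fin.sum_univ_two]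

lemma a_inv (g : SU11) : g⁻¹.a = conj g.a := by
  have h2 := g.2.2
  change (g.1⁻¹) 0 0 = _
  simp [SU11.a, Matrix.SpecialLinearGroup.coe_inv, Matrix.adjugate_fin_two, h2]

lemma b_inv (g : SU11) : g⁻¹.b = -g.b := by
  change (g.1⁻¹) 0 1 = _
  simp [SU11.b, Matrix.SpecialLinearGroup.coe_inv, Matrix.adjugate_fin_two]

/-- The real-linear action of `SU(1,1)` on `ℂ`: `g · α = a α + b conj α`. -/
def act (g : SU11) (α : ℂ) : ℂ := g.a * α + g.b * conj α

lemma act_one (α : ℂ) : act 1 α = α := by simp [act, a_one, b_one]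

lemma act_mul (g h : SU11) (α : ℂ) : act (g * h) α = act g (act h α) := by
  simp only [act, a_mul, b_mul, map_add, map_mul, Complex.conj_conj]; ring

lemma act_add (g : SU11) (α β : ℂ) : act g (α + β) = act g α + act g β := by
  simp only [act, map_add]; ring

lemma act_neg (g : SU11) (α : ℂ) : act g (-α) = -act g α := by
  simp only [act, map_neg]; ring

lemma im_act (g : SU11) (α β : ℂ) :
    (act g α * conj (act g β)).im = (α * conj β).im := by
  have h := congrArg Complex.re g.det_eq
  simp only [act, Complex.sub_re, Complex.mul_re, Complex.mul_im, Complex.add_re, Complex.add_im,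
    Complex.conj_re, Complex.conj_im, Complex.one_re, map_add, map_mul] at h ⊢
  linear_combination (α.im * β.re - α.re * β.im) * h

end SU11

/-- The Jacobi group: the semidirect product of the Heisenberg-Weyl group (elements `(α, t)`,
`α ∈ ℂ`, `t ∈ ℝ`) and `SU(1,1)`. -/
@[ext]
structure JacobiGroup where
  g : SU11
  α : ℂ
  t : ℝ

namespace JacobiGroup

/-- The composition law
`(g₁, α₁, t₁) (g₂, α₂, t₂) = (g₁ g₂, g₂⁻¹·α₁ + α₂, t₁ + t₂ + Im ((g₂⁻¹·α₁) conj α₂))`. -/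
instance : Mul JacobiGroup where
  mul x y := ⟨x.g * y.g, SU11.act y.g⁻¹ x.α + y.α,
    x.t + y.t + (SU11.act y.g⁻¹ x.α * conj y.α).im⟩

instance : One JacobiGroup where
  one := ⟨1, 0, 0⟩

instance : Inv JacobiGroup where
  inv x := ⟨x.g⁻¹, -SU11.act x.g x.α, -x.t⟩

lemma mul_def (x y : JacobiGroup) : x * y = ⟨x.g * y.g, SU11.act y.g⁻¹ x.α + y.α,
    x.t + y.t + (SU11.act y.g⁻¹ x.α * conj y.α).im⟩ := rfl

lemma one_def : (1 : JacobiGroup) = ⟨1, 0, 0⟩ := rfl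

lemma inv_def (x : JacobiGroup) : x⁻¹ = ⟨x.g⁻¹, -SU11.act x.g x.α, -x.t⟩ := rfl

instance : Group JacobiGroup :=
  Group.ofLeftAxioms
    (by
      intro x y z
      simp only [mul_def, JacobiGroup.mk.injEq]
      refine ⟨mul_assoc _ _ _, ?_, ?_⟩
      · rw [mul_inv_rev, SU11.act_mul, SU11.act_add, add_assoc]
      · have h := SU11.im_act z.g⁻¹ (SU11.act y.g⁻¹ x.α) y.α
        rw [mul_inv_rev, SU11.act_mul, SU11.act_add, map_add, mul_add, add_mul, Complex.add_im,
          Complex.add_im, h]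
        ring)
    (by
      intro x
      simp only [mul_def, one_def]
      ext1 <;> simp [SU11.act])
    (by
      intro x
      simp only [mul_def, one_def, inv_def, JacobiGroup.mk.injEq]
      have h : SU11.act x.g⁻¹ (-SU11.act x.g x.α) = -x.α := by
        rw [SU11.act_neg, ← SU11.act_mul, inv_mul_cancel, SU11.act_one]
      rw [h]
      refine ⟨inv_mul_cancel _, by simp, ?_⟩
      simp [Complex.mul_im]
      ring)

/-- The map `(z, w) ↦ ((α - conj α w + z) / (conj b w + conj a), (a w + b) / (conj b w + conj a))`
given by an element of the Jacobi group. -/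
def map (h : JacobiGroup) (p : ℂ × ℂ) : ℂ × ℂ :=
  ((h.α - conj h.α * p.2 + p.1) / (conj h.g.b * p.2 + conj h.g.a),
    (h.g.a * p.2 + h.g.b) / (conj h.g.b * p.2 + conj h.g.a))

end JacobiGroup

lemma SU11.normSq_sub (g : SU11) : ‖g.a‖ ^ 2 - ‖g.b‖ ^ 2 = 1 := by
  have h := congrArg Complex.re g.det_eq
  rw [Complex.mul_conj, Complex.mul_conj, Complex.normSq_eq_norm_sq, Complex.normSq_eq_norm_sq,
    ← Complex.ofReal_sub, Complex.ofReal_re, Complex.one_re] at h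
  exact h

lemma SU11.denom_ne_zero (g : SU11) {w : ℂ} (hw : ‖w‖ < 1) :
    conj g.b * w + conj g.a ≠ 0 := by
  intro h
  have h1 : conj g.a = -(conj g.b * w) := by linear_combination h
  have h2 := congrArg norm h1
  rw [norm_neg, norm_mul, Complex.norm_conj, Complex.norm_conj] at h2
  have h3 := g.normSq_sub
  rw [h2] at h3
  have h4 : ‖w‖ ^ 2 ≤ 1 := by nlinarith [norm_nonneg w]
  nlinarith [mul_le_mul_of_nonneg_left h4 (sq_nonneg ‖g.b‖)]

lemma JacobiGroup.map_mem (h : JacobiGroup) {p : ℂ × ℂ} (hp : p ∈ domain) :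
    h.map p ∈ domain := by
  have hp' : ‖p.2‖ < 1 := hp
  have hd := h.g.denom_ne_zero hp'
  change ‖(h.g.a * p.2 + h.g.b) / (conj h.g.b * p.2 + conj h.g.a)‖ < 1
  rw [norm_div, div_lt_one (norm_pos_iff.2 hd)]
  refine lt_of_pow_lt_pow_left₀ 2 (norm_nonneg _) ?_
  have h1 := h.g.normSq_sub
  have h2 : ‖p.2‖ ^ 2 < 1 := by nlinarith [norm_nonneg p.2]
  simp only [← Complex.normSq_eq_norm_sq, Complex.normSq_apply, Complex.add_re, Complex.add_im,
    Complex.mul_re, Complex.mul_im, Complex.conj_re, Complex.conj_im] at h1 h2 ⊢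
  nlinarith

/-- The action of the Jacobi group on `ℂ × D₁`. -/
instance : MulAction JacobiGroup domain where
  smul h x := ⟨h.map x.1, h.map_mem x.2⟩
  one_smul x := by
    apply Subtype.ext
    change JacobiGroup.map 1 x.1 = x.1
    simp [JacobiGroup.map, JacobiGroup.one_def, SU11.a_one, SU11.b_one]
  mul_smul h₁ h₂ x := by
    apply Subtype.ext
    change JacobiGroup.map (h₁ * h₂) x.1 = JacobiGroup.map h₁ (JacobiGroup.map h₂ x.1)
    obtain ⟨⟨z, w⟩, hx⟩ := x
    have hw : ‖w‖ < 1 := hx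
    have hd := h₂.g.denom_ne_zero hw
    have hd1 := h₁.g.denom_ne_zero (h₂.map_mem hx)
    have hd2 := (h₁.g * h₂.g).denom_ne_zero hw
    simp only [JacobiGroup.map, JacobiGroup.mul_def, SU11.a_mul, SU11.b_mul, SU11.act,
      SU11.a_inv, SU11.b_inv, map_add, map_mul, map_neg, Complex.conj_conj] at hd hd1 hd2 ⊢
    have hd3 : conj h₁.g.b * ((h₂.g.a * w + h₂.g.b) / (conj h₂.g.b * w + conj h₂.g.a))
        + conj h₁.g.a = ((conj h₁.g.a * conj h₂.g.b + conj h₁.g.b * h₂.g.a) * w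
          + (conj h₁.g.a * conj h₂.g.a + conj h₁.g.b * h₂.g.b))
          / (conj h₂.g.b * w + conj h₂.g.a) := by
      rw [mul_div_assoc', div_add' _ _ _ hd]
      congr 1
      ring
    rw [hd3]
    ext1
    · dsimp only
      rw [mul_div_assoc', sub_div' hd, ← add_div, div_div_div_cancel_right₀ hd]
      congr 1
      ring
    · dsimp only
      rw [mul_div_assoc', div_add' _ _ _ hd, div_div_div_cancel_right₀ hd]
      congr 1
      ring

/-! ### The representation of the Jacobi algebra on Fock space -/

/-- The parameter `k'` with `2k = 2k' + 1/2`. -/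
def kPrime (k : ℝ) : ℝ := k - 1 / 4

/-- The dense domain of the derived representation: finite linear combinations of the basis
vectors `|n⟩ ⊗ e_{k',k'+m}`, indexed by `(n, m)`. -/
abbrev FockDomain : Type := (ℕ × ℕ) →₀ ℂ

/-- The Hilbert space of the representation: the tensor product of the Fock space of one boson and
of the positive discrete series representation `D⁺_{k'}`, in the basis `|n⟩ ⊗ e_{k',k'+m}`. -/
abbrev FockSpace : Type := lp (fun _ : ℕ × ℕ => ℂ) 2

/-- The inclusion of the dense domain into the Hilbert space. -/
def toFock : FockDomain →ₗ[ℂ] FockSpace :=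
  Finsupp.linearCombination ℂ fun p => lp.single 2 p (1 : ℂ)

/-- The annihilation operator, `a |n⟩ = √n |n-1⟩`. -/
def opA : Module.End ℂ FockDomain :=
  Finsupp.linearCombination ℂ fun p => Finsupp.single (p.1 - 1, p.2) ((√(p.1 : ℝ) : ℝ) : ℂ)

/-- The creation operator, `a⁺ |n⟩ = √(n+1) |n+1⟩`. -/
def opAdag : Module.End ℂ FockDomain :=
  Finsupp.linearCombination ℂ fun p => Finsupp.single (p.1 + 1, p.2) ((√((p.1 : ℝ) + 1) : ℝ) : ℂ)

/-- `K'_+ e_{k',k'+m} = √((m+1)(m+2k')) e_{k',k'+m+1}`. -/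
def opKPlus' (k : ℝ) : Module.End ℂ FockDomain :=
  Finsupp.linearCombination ℂ fun p =>
    Finsupp.single (p.1, p.2 + 1) ((√(((p.2 : ℝ) + 1) * (p.2 + 2 * kPrime k)) : ℝ) : ℂ)

/-- `K'_- e_{k',k'+m} = √(m(m-1+2k')) e_{k',k'+m-1}`. -/
def opKMinus' (k : ℝ) : Module.End ℂ FockDomain :=
  Finsupp.linearCombination ℂ fun p =>
    Finsupp.single (p.1, p.2 - 1) ((√((p.2 : ℝ) * (p.2 - 1 + 2 * kPrime k)) : ℝ) : ℂ)

/-- `K'_0 e_{k',k'+m} = (k'+m) e_{k',k'+m}`. -/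
def opKZero' (k : ℝ) : Module.End ℂ FockDomain :=
  Finsupp.linearCombination ℂ fun p => Finsupp.single p ((kPrime k + p.2 : ℝ) : ℂ)

/-- The generator `K_+ = (a⁺)²/2 + K'_+`. -/
def opKPlus (k : ℝ) : Module.End ℂ FockDomain := (1 / 2 : ℂ) • opAdag ^ 2 + opKPlus' k

/-- The generator `K_- = a²/2 + K'_-`. -/
def opKMinus (k : ℝ) : Module.End ℂ FockDomain := (1 / 2 : ℂ) • opA ^ 2 + opKMinus' k

/-- The generator `K_0 = (a⁺ a + 1/2)/2 + K'_0`. -/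
def opKZero (k : ℝ) : Module.End ℂ FockDomain :=
  (1 / 2 : ℂ) • (opAdag * opA + (1 / 2 : ℂ) • 1) + opKZero' k

/-- The cyclic vector `e₀ = |0⟩ ⊗ e_{k',k'}`. -/
def vac : FockDomain := Finsupp.single (0, 0) 1

lemma opA_single (n m : ℕ) (c : ℂ) :
    opA (Finsupp.single (n, m) c) = Finsupp.single (n - 1, m) (c * ((√(n : ℝ) : ℝ) : ℂ)) := by
  simp [opA, Finsupp.linearCombination_single]

lemma opAdag_single (n m : ℕ) (c : ℂ) :
    opAdag (Finsupp.single (n, m) c)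
      = Finsupp.single (n + 1, m) (c * ((√((n : ℝ) + 1) : ℝ) : ℂ)) := by
  simp [opAdag, Finsupp.linearCombination_single]

lemma opKPlus'_single (k : ℝ) (n m : ℕ) (c : ℂ) :
    opKPlus' k (Finsupp.single (n, m) c)
      = Finsupp.single (n, m + 1) (c * ((√(((m : ℝ) + 1) * (m + 2 * kPrime k)) : ℝ) : ℂ)) := by
  simp [opKPlus', Finsupp.linearCombination_single]

lemma opKMinus'_single (k : ℝ) (n m : ℕ) (c : ℂ) :
    opKMinus' k (Finsupp.single (n, m) c)
      = Finsupp.single (n, m - 1) (c * ((√((m : ℝ) * (m - 1 + 2 * kPrime k)) : ℝ) : ℂ)) := by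
  simp only [opKMinus', Finsupp.linearCombination_single, Finsupp.smul_single, smul_eq_mul]

lemma opKZero'_single (k : ℝ) (n m : ℕ) (c : ℂ) :
    opKZero' k (Finsupp.single (n, m) c)
      = Finsupp.single (n, m) (c * ((kPrime k + m : ℝ) : ℂ)) := by
  simp only [opKZero', Finsupp.linearCombination_single, Finsupp.smul_single, smul_eq_mul]

lemma end_ext {S T : Module.End ℂ FockDomain}
    (h : ∀ n m, S (Finsupp.single (n, m) 1) = T (Finsupp.single (n, m) 1)) : S = T :=
  Finsupp.lhom_ext' fun p => LinearMap.ext_ring (h p.1 p.2)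

lemma sqrt_mul_self_ofReal {x : ℝ} (hx : 0 ≤ x) : ((√x : ℝ) : ℂ) * ((√x : ℝ) : ℂ) = (x : ℂ) := by
  rw [← Complex.ofReal_mul, Real.mul_self_sqrt hx]

/-- `[a, a⁺] = 1`. -/
lemma comm_A_Adag : opA * opAdag = opAdag * opA + 1 := by
  refine end_ext fun n m => ?_
  simp only [Module.End.mul_apply, LinearMap.add_apply, Module.End.one_apply, opA_single,
    opAdag_single, one_mul, Nat.add_sub_cancel, Nat.cast_add, Nat.cast_one]
  rw [sqrt_mul_self_ofReal (by positivity)]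
  cases n with
  | zero => simp
  | succ n =>
    simp only [Nat.add_sub_cancel, Nat.cast_add, Nat.cast_one]
    rw [sqrt_mul_self_ofReal (by positivity), ← Finsupp.single_add]
    push_cast
    rfl

lemma comm_A_KPlus' (k : ℝ) : opA * opKPlus' k = opKPlus' k * opA := by
  refine end_ext fun n m => ?_
  simp only [Module.End.mul_apply, opA_single, opKPlus'_single, one_mul, mul_comm]

lemma comm_Adag_KPlus' (k : ℝ) : opAdag * opKPlus' k = opKPlus' k * opAdag := by
  refine end_ext fun n m => ?_
  simp only [Module.End.mul_apply, opAdag_single, opKPlus'_single, one_mul, mul_comm]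

lemma comm_A_KMinus' (k : ℝ) : opA * opKMinus' k = opKMinus' k * opA := by
  refine end_ext fun n m => ?_
  simp only [Module.End.mul_apply, opA_single, opKMinus'_single, one_mul, mul_comm]

lemma comm_Adag_KMinus' (k : ℝ) : opAdag * opKMinus' k = opKMinus' k * opAdag := by
  refine end_ext fun n m => ?_
  simp only [Module.End.mul_apply, opAdag_single, opKMinus'_single, one_mul, mul_comm]

lemma comm_A_KZero' (k : ℝ) : opA * opKZero' k = opKZero' k * opA := by
  refine end_ext fun n m => ?_
  simp only [Module.End.mul_apply, opA_single, opKZero'_single, one_mul]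
  rw [mul_comm]

lemma comm_Adag_KZero' (k : ℝ) : opAdag * opKZero' k = opKZero' k * opAdag := by
  refine end_ext fun n m => ?_
  simp only [Module.End.mul_apply, opAdag_single, opKZero'_single, one_mul]
  rw [mul_comm]

lemma comm_KZero'_KPlus' (k : ℝ) :
    opKZero' k * opKPlus' k = opKPlus' k * opKZero' k + opKPlus' k := by
  refine end_ext fun n m => ?_
  simp only [Module.End.mul_apply, LinearMap.add_apply, opKZero'_single, opKPlus'_single, one_mul,
    ← Finsupp.single_add]
  congr 1
  push_cast
  ring

lemma comm_KMinus'_KZero' (k : ℝ) :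
    opKMinus' k * opKZero' k = opKZero' k * opKMinus' k + opKMinus' k := by
  refine end_ext fun n m => ?_
  simp only [Module.End.mul_apply, LinearMap.add_apply, opKZero'_single, opKMinus'_single, one_mul,
    ← Finsupp.single_add]
  cases m with
  | zero => simp
  | succ m =>
    simp only [Nat.add_sub_cancel]
    congr 1
    push_cast
    ring

lemma comm_KMinus'_KPlus' {k : ℝ} (hk : 1 ≤ k) :
    opKMinus' k * opKPlus' k = opKPlus' k * opKMinus' k + (2 : ℂ) • opKZero' k := by
  have hk' : 0 ≤ 2 * kPrime k := by unfold kPrime; linarith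
  refine end_ext fun n m => ?_
  simp only [Module.End.mul_apply, LinearMap.add_apply, LinearMap.smul_apply, opKZero'_single,
    opKPlus'_single, opKMinus'_single, one_mul, Nat.add_sub_cancel, Nat.cast_add, Nat.cast_one,
    add_sub_cancel_right]
  rw [sqrt_mul_self_ofReal (by positivity)]
  cases m with
  | zero => simp
  | succ m =>
    simp only [Nat.add_sub_cancel, Nat.cast_add, Nat.cast_one, add_sub_cancel_right]
    rw [sqrt_mul_self_ofReal (by positivity), Finsupp.smul_single, ← Finsupp.single_add]
    congr 1
    push_cast
    simp only [smul_eq_mul]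
    ring

/-- `[a, K_+] = a⁺`. -/
lemma comm_A_KPlus (k : ℝ) : opA * opKPlus k = opKPlus k * opA + opAdag := by
  have h1 : opA * opAdag ^ 2 = opAdag ^ 2 * opA + (2 : ℂ) • opAdag := by
    rw [pow_two, ← mul_assoc, comm_A_Adag, add_mul, mul_assoc, comm_A_Adag, two_smul]
    noncomm_ring
  rw [opKPlus, mul_add, add_mul, mul_smul_comm, smul_mul_assoc, h1, comm_A_KPlus', smul_add,
    smul_smul]
  norm_num
  abel

/-- `[K_-, a⁺] = a`. -/
lemma comm_KMinus_Adag (k : ℝ) : opKMinus k * opAdag = opAdag * opKMinus k + opA := by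
  have h1 : opA ^ 2 * opAdag = opAdag * opA ^ 2 + (2 : ℂ) • opA := by
    rw [pow_two, mul_assoc, comm_A_Adag, mul_add, ← mul_assoc, comm_A_Adag, two_smul]
    noncomm_ring
  rw [opKMinus, mul_add, add_mul, mul_smul_comm, smul_mul_assoc, h1, comm_Adag_KMinus', smul_add,
    smul_smul]
  norm_num
  abel

/-- `[K_+, a⁺] = 0`. -/
lemma comm_KPlus_Adag (k : ℝ) : opKPlus k * opAdag = opAdag * opKPlus k := by
  rw [opKPlus, mul_add, add_mul, mul_smul_comm, smul_mul_assoc, comm_Adag_KPlus', ← pow_succ,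
    ← pow_succ']

/-- `[K_-, a] = 0`. -/
lemma comm_KMinus_A (k : ℝ) : opKMinus k * opA = opA * opKMinus k := by
  rw [opKMinus, mul_add, add_mul, mul_smul_comm, smul_mul_assoc, comm_A_KMinus', ← pow_succ,
    ← pow_succ']

/-- `[K_0, a⁺] = a⁺/2`. -/
lemma comm_KZero_Adag (k : ℝ) :
    opKZero k * opAdag = opAdag * opKZero k + (1 / 2 : ℂ) • opAdag := by
  have h1 : opAdag * opA * opAdag = opAdag * (opAdag * opA) + opAdag := by
    rw [mul_assoc, comm_A_Adag, mul_add, mul_one]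
  simp only [opKZero, mul_add, add_mul, mul_smul_comm, smul_mul_assoc, h1, comm_Adag_KZero',
    smul_add, one_mul, mul_one]
  abel

/-- `[K_0, a] = -a/2`. -/
lemma comm_A_KZero (k : ℝ) : opA * opKZero k = opKZero k * opA + (1 / 2 : ℂ) • opA := by
  have h1 : opA * (opAdag * opA) = opAdag * opA * opA + opA := by
    rw [← mul_assoc, comm_A_Adag, add_mul, one_mul]
  simp only [opKZero, mul_add, add_mul, mul_smul_comm, smul_mul_assoc, h1, comm_A_KZero',
    smul_add, one_mul, mul_one]
  abel

/-- `[K_0, K_+] = K_+`. -/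
lemma comm_KZero_KPlus (k : ℝ) : opKZero k * opKPlus k = opKPlus k * opKZero k + opKPlus k := by
  have e : opKZero k * opAdag ^ 2 = opAdag ^ 2 * opKZero k + opAdag ^ 2 := by
    have h2 : ∀ x : Module.End ℂ FockDomain, (1 / 2 : ℂ) • x + (1 / 2 : ℂ) • x = x := fun x => by
      rw [← add_smul]; norm_num
    rw [pow_two, ← mul_assoc, comm_KZero_Adag, add_mul, mul_assoc, comm_KZero_Adag, mul_add,
      smul_mul_assoc, mul_smul_comm, add_assoc, h2, mul_assoc]
  have f : opKZero k * opKPlus' k = opKPlus' k * opKZero k + opKPlus' k := by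
    have h3 : opAdag * opA * opKPlus' k = opKPlus' k * (opAdag * opA) := by
      rw [mul_assoc, comm_A_KPlus', ← mul_assoc, comm_Adag_KPlus', mul_assoc]
    simp only [opKZero, mul_add, add_mul, mul_smul_comm, smul_mul_assoc, h3, comm_KZero'_KPlus',
      one_mul, mul_one, add_assoc]
  rw [opKPlus, mul_add, add_mul, mul_smul_comm, smul_mul_assoc, e, f, smul_add]
  abel

/-- `[K_0, K_-] = -K_-`. -/
lemma comm_KMinus_KZero (k : ℝ) :
    opKMinus k * opKZero k = opKZero k * opKMinus k + opKMinus k := by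
  have e : opA ^ 2 * opKZero k = opKZero k * opA ^ 2 + opA ^ 2 := by
    have h2 : ∀ x : Module.End ℂ FockDomain, (1 / 2 : ℂ) • x + (1 / 2 : ℂ) • x = x := fun x => by
      rw [← add_smul]; norm_num
    rw [pow_two, mul_assoc, comm_A_KZero, mul_add, ← mul_assoc, comm_A_KZero, add_mul,
      smul_mul_assoc, mul_smul_comm, add_assoc, h2, mul_assoc]
  have f : opKMinus' k * opKZero k = opKZero k * opKMinus' k + opKMinus' k := by
    have h3 : opKMinus' k * (opAdag * opA) = opAdag * opA * opKMinus' k := by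
      rw [mul_assoc, comm_A_KMinus', ← mul_assoc, ← comm_Adag_KMinus', mul_assoc]
    simp only [opKZero, mul_add, add_mul, mul_smul_comm, smul_mul_assoc, h3, comm_KMinus'_KZero',
      one_mul, mul_one, add_assoc]
  rw [opKMinus, mul_add, add_mul, mul_smul_comm, smul_mul_assoc, e, f, smul_add]
  abel

/-- `[K_-, K_+] = 2 K_0`. -/
lemma comm_KMinus_KPlus {k : ℝ} (hk : 1 ≤ k) :
    opKMinus k * opKPlus k = opKPlus k * opKMinus k + (2 : ℂ) • opKZero k := by
  have h1 : opA * opAdag ^ 2 = opAdag ^ 2 * opA + (2 : ℂ) • opAdag := by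
    rw [pow_two, ← mul_assoc, comm_A_Adag, add_mul, mul_assoc, comm_A_Adag, two_smul]
    noncomm_ring
  have h2 : opA ^ 2 * opAdag ^ 2
      = opAdag ^ 2 * opA ^ 2 + (4 : ℂ) • (opAdag * opA) + (2 : ℂ) • 1 := by
    rw [pow_two opA, mul_assoc, h1, mul_add, ← mul_assoc, h1, mul_smul_comm, comm_A_Adag, add_mul,
      smul_mul_assoc, smul_add, mul_assoc]
    module
  have h3 : opA ^ 2 * opKPlus' k = opKPlus' k * opA ^ 2 := by
    rw [pow_two, mul_assoc, comm_A_KPlus', ← mul_assoc, comm_A_KPlus', mul_assoc]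
  have h4 : opKMinus' k * opAdag ^ 2 = opAdag ^ 2 * opKMinus' k := by
    rw [pow_two, ← mul_assoc, ← comm_Adag_KMinus', mul_assoc, ← comm_Adag_KMinus', mul_assoc]
  simp only [opKMinus, opKPlus, opKZero, mul_add, add_mul, mul_smul_comm, smul_mul_assoc, h2, h3,
    h4, comm_KMinus'_KPlus' hk, smul_add, smul_smul]
  norm_num
  module

/-- `a e₀ = 0`. -/
lemma opA_vac : opA vac = 0 := by simp [vac, opA_single]

/-- `K_- e₀ = 0`. -/
lemma opKMinus_vac (k : ℝ) : opKMinus k vac = 0 := by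
  simp [opKMinus, pow_two, Module.End.mul_apply, vac, opA_single, opKMinus'_single]

/-- `K_0 e₀ = k e₀`. -/
lemma opKZero_vac (k : ℝ) : opKZero k vac = (k : ℂ) • vac := by
  have h : opAdag (opA vac) = 0 := by rw [opA_vac, map_zero]
  simp only [opKZero, LinearMap.add_apply, LinearMap.smul_apply, Module.End.mul_apply, h,
    Module.End.one_apply, zero_add, smul_smul]
  rw [vac, opKZero'_single, Finsupp.smul_single, Finsupp.smul_single, ← Finsupp.single_add]
  congr 1
  rw [kPrime]
  push_cast
  simp only [smul_eq_mul]
  ring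

lemma inner_toFock_single (p q : ℕ × ℕ) (c d : ℂ) :
    ⟪toFock (Finsupp.single p c), toFock (Finsupp.single q d)⟫_ℂ
      = if p = q then conj c * d else 0 := by
  classical
  simp only [toFock, Finsupp.linearCombination_single, inner_smul_left, inner_smul_right,
    lp.inner_single_left, lp.single_apply]
  by_cases h : p = q
  · subst h
    simp
    ring
  · simp [h]

/-- Two operators which are formally adjoint on the basis are formally adjoint. -/
lemma adjoint_of_basis {S T : Module.End ℂ FockDomain}
    (h : ∀ n m n' m', ⟪toFock (S (Finsupp.single (n, m) 1)), toFock (Finsupp.single (n', m') 1)⟫_ℂ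
      = ⟪toFock (Finsupp.single (n, m) 1), toFock (T (Finsupp.single (n', m') 1))⟫_ℂ)
    (u v : FockDomain) : ⟪toFock (S u), toFock v⟫_ℂ = ⟪toFock u, toFock (T v)⟫_ℂ := by
  induction u using Finsupp.induction_linear with
  | zero => simp
  | add f g hf hg => simp only [map_add, inner_add_left, hf, hg]
  | single p c =>
    induction v using Finsupp.induction_linear with
    | zero => simp
    | add f g hf hg => simp only [map_add, inner_add_right, hf, hg]
    | single q d =>
      have hc : (Finsupp.single p c : FockDomain) = c • Finsupp.single p 1 := by simp
      have hd : (Finsupp.single q d : FockDomain) = d • Finsupp.single q 1 := by simp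
      rw [hc, hd]
      simp only [map_smul, inner_smul_left, inner_smul_right]
      rw [h p.1 p.2 q.1 q.2]

/-- `a` and `a⁺` are formally adjoint. -/
lemma adjoint_A (u v : FockDomain) :
    ⟪toFock (opA u), toFock v⟫_ℂ = ⟪toFock u, toFock (opAdag v)⟫_ℂ := by
  refine adjoint_of_basis (fun n m n' m' => ?_) u v
  rw [opA_single, opAdag_single, inner_toFock_single, inner_toFock_single]
  simp only [one_mul, Prod.mk.injEq, Complex.conj_ofReal, map_one, mul_one]
  cases n with
  | zero => simp
  | succ n =>
    by_cases h : n = n' ∧ m = m'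
    · obtain ⟨rfl, rfl⟩ := h
      simp
    · rw [if_neg (by simpa using h), if_neg (by simpa using h)]

lemma adjoint_KMinus' (k : ℝ) (u v : FockDomain) :
    ⟪toFock (opKMinus' k u), toFock v⟫_ℂ = ⟪toFock u, toFock (opKPlus' k v)⟫_ℂ := by
  refine adjoint_of_basis (fun n m n' m' => ?_) u v
  rw [opKMinus'_single, opKPlus'_single, inner_toFock_single, inner_toFock_single]
  simp only [one_mul, Prod.mk.injEq, Complex.conj_ofReal, map_one, mul_one]
  cases m with
  | zero => simp
  | succ m =>
    by_cases h : n = n' ∧ m = m'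
    · obtain ⟨rfl, rfl⟩ := h
      simp
    · rw [if_neg (by simpa using h), if_neg (by simpa using h)]

/-- `K_-` and `K_+` are formally adjoint. -/
lemma adjoint_KMinus (k : ℝ) (u v : FockDomain) :
    ⟪toFock (opKMinus k u), toFock v⟫_ℂ = ⟪toFock u, toFock (opKPlus k v)⟫_ℂ := by
  simp only [opKMinus, opKPlus, LinearMap.add_apply, LinearMap.smul_apply, pow_two,
    Module.End.mul_apply, map_add, map_smul, inner_add_left, inner_add_right, inner_smul_left,
    inner_smul_right, adjoint_A, adjoint_KMinus', map_div₀, map_one, map_ofNat]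

/-- `K_0` is formally self-adjoint. -/
lemma adjoint_KZero (k : ℝ) (u v : FockDomain) :
    ⟪toFock (opKZero k u), toFock v⟫_ℂ = ⟪toFock u, toFock (opKZero k v)⟫_ℂ := by
  have h : ∀ u v, ⟪toFock (opAdag u), toFock v⟫_ℂ = ⟪toFock u, toFock (opA v)⟫_ℂ := fun u v => by
    rw [← inner_conj_symm, ← adjoint_A, inner_conj_symm]
  have h' : ∀ u v, ⟪toFock (opKZero' k u), toFock v⟫_ℂ = ⟪toFock u, toFock (opKZero' k v)⟫_ℂ := by
    refine adjoint_of_basis fun n m n' m' => ?_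
    rw [opKZero'_single, opKZero'_single, inner_toFock_single, inner_toFock_single]
    by_cases e : (n, m) = (n', m')
    · obtain ⟨rfl, rfl⟩ := Prod.mk.inj e
      simp
    · rw [if_neg e, if_neg e]
  simp only [opKZero, LinearMap.add_apply, LinearMap.smul_apply, Module.End.mul_apply, map_add,
    map_smul, inner_add_left, inner_add_right, inner_smul_left, inner_smul_right, h, h', adjoint_A,
    Module.End.one_apply, map_div₀, map_one, map_ofNat]

/-- The orthonormal basis vectors `|n⟩ ⊗ e_{k',k'+m}`, where `|n⟩ = (n!)^{-1/2} (a⁺)ⁿ |0⟩` and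
`e_{k',k'+m} = a_{k'm} (K'_+)^m e_{k',k'}` with `a_{k'm}² = Γ(2k') / (m! Γ(m+2k'))`. -/
def basisVector (k : ℝ) (n m : ℕ) : FockSpace :=
  toFock ((((√(n.factorial : ℝ))⁻¹ * √(Real.Gamma (2 * kPrime k)
      / (m.factorial * Real.Gamma (m + 2 * kPrime k))) : ℝ) : ℂ) •
    (opAdag ^ n * opKPlus' k ^ m) vac)

/-! ### Coherent state vectors, the kernel and the spaces of functions -/

/-- The `j`-th term of the exponential series `exp(z a⁺ + w K_+) e₀`. -/
def coherentTerm (k : ℝ) (p : ℂ × ℂ) (j : ℕ) : FockSpace :=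
  ((j.factorial : ℂ)⁻¹) • toFock (((p.1 • opAdag + p.2 • opKPlus k) ^ j) vac)

/-- The coherent state vector `e_{z,w} = exp(z a⁺ + w K_+) e₀`. -/
def coherent (k : ℝ) (p : ℂ × ℂ) : FockSpace := ∑' j, coherentTerm k p j

/-- The holomorphic function `f_ψ(z,w) = (e_{conj z, conj w}, ψ)` attached to a vector `ψ`. -/
def symbol (k : ℝ) (ψ : FockSpace) (p : ℂ × ℂ) : ℂ :=
  ⟪coherent k (conj p.1, conj p.2), ψ⟫_ℂ

/-- The kernel `K(z,w; conj z', conj w') = (e_{conj z, conj w}, e_{conj z', conj w'})`. -/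
def kernel (k : ℝ) (p q : ℂ × ℂ) : ℂ :=
  ⟪coherent k (conj p.1, conj p.2), coherent k (conj q.1, conj q.2)⟫_ℂ

/-- The kernel on `(ℂ × D₁) × (ℂ × D₁)`, as a matrix of operators on `ℂ`. -/
def kernelMatrix (k : ℝ) : Matrix domain domain (ℂ →L[ℂ] ℂ) :=
  Matrix.of fun x y => kernel k x y • (1 : ℂ →L[ℂ] ℂ)

instance kernelMatrix_posSemidef (k : ℝ) : Fact (kernelMatrix k).PosSemidef := by
  refine ⟨((RKHS.posSemidef_tfae (K := kernelMatrix k)).out 0 2).2 (And.intro ?_ ?_)⟩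
  · ext x y
    simp [kernelMatrix, kernel, Matrix.conjTranspose_apply]
  · intro vv
    have h : ∀ (x x' : domain) (w w' : ℂ), ⟪kernelMatrix k x' x w, w'⟫_ℂ
        = ⟪w • coherent k (conj x.1.1, conj x.1.2), w' • coherent k (conj x'.1.1, conj x'.1.2)⟫_ℂ := by
      intro x x' w w'
      simp [kernelMatrix, kernel, inner_smul_left, inner_smul_right]
    simp only [h, Finsupp.sum]
    simp only [← inner_sum, ← sum_inner]
    exact inner_self_nonneg

/-- The reproducing kernel Hilbert space of functions on `ℂ × D₁` with kernel `K`. -/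
abbrev FK (k : ℝ) : Type := RKHS.OfKernel (kernelMatrix k)

/-- A function on `ℂ × D₁` is holomorphic. -/
def IsHolomorphic (f : domain → ℂ) : Prop :=
  ∃ F : ℂ × ℂ → ℂ, DifferentiableOn ℂ F domain ∧ ∀ x : domain, F x = f x

/-- The polynomial `P_n(z,w) = n! ∑_{j ≤ n/2} (w/2)^j z^{n-2j} / (j! (n-2j)!)`. -/
def P (n : ℕ) (p : ℂ × ℂ) : ℂ :=
  n.factorial * ∑ j ∈ Finset.range (n / 2 + 1),
    (p.2 / 2) ^ j * (p.1 ^ (n - 2 * j) / (j.factorial * (n - 2 * j).factorial))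

/-- The disk monomial `f_{e_{k',k'+m}}(w) = √(Γ(m+2k') / (m! Γ(2k'))) w^m`. -/
def diskMonomial (k : ℝ) (m : ℕ) (w : ℂ) : ℂ :=
  ((√(Real.Gamma (m + 2 * kPrime k) / (m.factorial * Real.Gamma (2 * kPrime k))) : ℝ) : ℂ) * w ^ m

/-- The measure `(1 - |w|²)⁻³ d Re w d Im w d Re z d Im z` on `ℂ × D₁`. -/
def invariantMeasure : Measure domain :=
  ((volume : Measure (ℂ × ℂ)).comap Subtype.val).withDensity fun x => ENNReal.ofReal (((1 - ‖x.1.2‖ ^ 2) ^ 3)⁻¹)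

/-- The density
`(1-|w|²)^{2k} exp(-|z|²/(1-|w|²)) exp(-(z² conj w + (conj z)² w)/(2(1-|w|²)))`. -/
def weight (k : ℝ) (p : ℂ × ℂ) : ℝ :=
  (1 - ‖p.2‖ ^ 2) ^ (2 * k) * Real.exp (-(‖p.1‖ ^ 2 / (1 - ‖p.2‖ ^ 2)))
    * Real.exp (-((p.1 ^ 2 * conj p.2 + conj p.1 ^ 2 * p.2).re / (2 * (1 - ‖p.2‖ ^ 2))))

/-- The constant `Λ = (4k - 3)/(2π²)`. -/
def normalization (k : ℝ) : ℝ := (4 * k - 3) / (2 * Real.pi ^ 2)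

/-! ### Kähler geometry -/

/-- The Kähler potential `f = log K`, with `K` restricted to the diagonal. -/
def potential (k : ℝ) (p : ℂ × ℂ) : ℝ := Real.log (kernel k p p).re

/-- The coordinate vectors of `ℂ × ℂ`; index `0` stands for `z` and index `1` for `w`. -/
def coordVec : Fin 2 → ℂ × ℂ := ![(1, 0), (0, 1)]

/-- The Wirtinger derivative `∂/∂z_i = (∂/∂x_i - i ∂/∂y_i)/2`. -/
def dHol (i : Fin 2) (F : ℂ × ℂ → ℂ) (p : ℂ × ℂ) : ℂ :=
  (1 / 2) * (fderiv ℝ F p (coordVec i) - Complex.I * fderiv ℝ F p (Complex.I • coordVec i))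

/-- The Wirtinger derivative `∂/∂(conj z_i) = (∂/∂x_i + i ∂/∂y_i)/2`. -/
def dAntiHol (i : Fin 2) (F : ℂ × ℂ → ℂ) (p : ℂ × ℂ) : ℂ :=
  (1 / 2) * (fderiv ℝ F p (coordVec i) + Complex.I * fderiv ℝ F p (Complex.I • coordVec i))

/-- The matrix `G_{ij} = ∂² f / ∂z_i ∂(conj z_j)` of the Kähler metric. -/
def metric (k : ℝ) (p : ℂ × ℂ) : Matrix (Fin 2) (Fin 2) ℂ :=
  Matrix.of fun i j => dHol i (dAntiHol j fun q => (potential k q : ℂ)) p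

/-- The one-forms `dz` and `dw`. -/
def dcoord : Fin 2 → (ℂ × ℂ →L[ℝ] ℂ) :=
  ![ContinuousLinearMap.fst ℝ ℂ ℂ, ContinuousLinearMap.snd ℝ ℂ ℂ]

/-- The complex conjugate of a complex-valued one-form. -/
def conjForm (η : ℂ × ℂ →L[ℝ] ℂ) : ℂ × ℂ →L[ℝ] ℂ := Complex.conjCLE.toContinuousLinearMap.comp η

/-- The wedge product `(η ∧ ζ)(u, v) = η(u) ζ(v) - η(v) ζ(u)` of one-forms. -/
def wedge (η ζ : ℂ × ℂ →L[ℝ] ℂ) : (ℂ × ℂ) [⋀^Fin 2]→L[ℝ] ℂ where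
  toFun v := η (v 0) * ζ (v 1) - η (v 1) * ζ (v 0)
  map_update_add' := by
    intro _ v i x y
    fin_cases i <;> simp [Function.update] <;> ring
  map_update_smul' := by
    intro _ v i c x
    fin_cases i <;> simp [Function.update] <;> ring
  cont := by fun_prop
  map_eq_zero_of_eq' := by
    intro v i j h hij
    fin_cases i <;> fin_cases j <;> simp_all

/-- The two-form `ω = i ∑ G_{ij} dz_i ∧ d(conj z_j)`. -/
def kahlerForm (k : ℝ) (p : ℂ × ℂ) : (ℂ × ℂ) [⋀^Fin 2]→L[ℝ] ℂ :=
  Complex.I • ∑ i, ∑ j, metric k p i j • wedge (dcoord i) (conjForm (dcoord j))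

/-- The function `α₀ = (z + conj z w)/(1 - |w|²)`. -/
def α₀ (p : ℂ × ℂ) : ℂ := (p.1 + conj p.1 * p.2) / (1 - p.2 * conj p.2)

/-- The one-form `A = dz + conj α₀ dw`. -/
def formA (p : ℂ × ℂ) : ℂ × ℂ →L[ℝ] ℂ := dcoord 0 + conj (α₀ p) • dcoord 1

end Jacobi

end

open Jacobi

/-!
The representation is treated in its orthonormal basis `|n⟩ ⊗ e_{k',k'+m}`. As `a⁺` and `K'_+`
commute, the exponential series `exp(z a⁺ + w K_+) e₀` can be expanded by the binomial theorem
(`coherentTerm_eq`); a bound for its coefficients (`expCoeff_le`) gives convergence in norm, locally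
uniformly on the domain, and the components of `e_{z,w}` are the functions `basisFun k n m`
(`coherent_apply`). Hence the functions `f_ψ` are holomorphic, and the kernel is the sum of
`basisFun k n m p * basisFun k n m q` at `q = (conj z', conj w')`. This double series is a product:
the sum over `m` is a binomial series (`tsum_binomial`), the sum over `n` is Mehler's formula
(`tsum_mehlerCoeff`). Both are proved by a linear differential equation of the first order.

The Kähler potential and its derivatives are computed in the Wirtinger calculus
(`hasFDerivAt_potential`, `metric_eq`). Invariance of the Kähler form holds because `dw` and the form
`A` are multiplied by powers of the automorphy factor (`formA_map`).

The description of the reproducing kernel Hilbert space as a space of square integrable functions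
does not pass through an orthogonality computation. It rests on the following facts.
* The weight `ρ` is the inverse of the kernel on the diagonal, and under the group it is multiplied
  by the squared modulus of the holomorphic function `q ↦ K(h · q, h · 0)`, up to a constant
  (`weight_map`). With the invariance of `ν` this gives a unitary action of the group on square
  integrable holomorphic functions.
* The measure `Λ ρ dν` has total mass one (`lintegral_weight`), by a Gaussian integral in `z` and a
  radial integral in `w`.
* This measure is invariant under `(z, w) ↦ (c z, c² w)` with `|c| = 1`, so the mean value property
  on the disks `s ↦ (s z, s² w)` gives `∫ F Λ ρ dν = F 0` for integrable holomorphic `F`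
  (`integral_eq_apply_zero`).

Transport to an arbitrary point yields the reproducing property with the kernel `K` for all square
integrable holomorphic functions (`integral_conj_kernel_mul`). So `K` is the reproducing kernel of
both spaces. The map which fixes the kernel functions is an isometric embedding of `FK k` into `L²`
(`toLp`) which does not change functions, and its adjoint shows that every square integrable
holomorphic function occurs (`exists_FK_iff`).

Finally, `ψ ↦ f_ψ` maps the coherent state vectors to the kernel functions and preserves their scalar
products. It is unitary because the coherent state vectors span a dense subspace, which means that
`f_ψ` determines `ψ` (`eq_zero_of_symbol_eq_zero`). The polynomials attached to the basis vectors are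
then an orthonormal basis of `FK k`.
-/


noncomputable section

namespace Jacobi

/-! ### The action of the Jacobi group -/

lemma isOpen_domain : IsOpen domain :=
  isOpen_lt (by fun_prop) continuous_const

lemma measurableSet_domain : MeasurableSet domain := isOpen_domain.measurableSet

lemma normSq_lt_one {p : ℂ × ℂ} (hp : p ∈ domain) : ‖p.2‖ ^ 2 < 1 := by
  have h : ‖p.2‖ < 1 := hp
  nlinarith [norm_nonneg p.2]

/-- The automorphy factor `conj b w + conj a` of an element of the Jacobi group. -/
def JacobiGroup.den (h : JacobiGroup) (p : ℂ × ℂ) : ℂ := conj h.g.b * p.2 + conj h.g.a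

lemma JacobiGroup.den_ne_zero (h : JacobiGroup) {p : ℂ × ℂ} (hp : p ∈ domain) : h.den p ≠ 0 :=
  h.g.denom_ne_zero hp

lemma SU11.one_sub_norm_sq (g : SU11) {w : ℂ} (hw : ‖w‖ < 1) :
    1 - ‖(g.a * w + g.b) / (conj g.b * w + conj g.a)‖ ^ 2
      = (1 - ‖w‖ ^ 2) / ‖conj g.b * w + conj g.a‖ ^ 2 := by
  have hd := g.denom_ne_zero hw
  have hd' : ‖conj g.b * w + conj g.a‖ ^ 2 ≠ 0 := by simpa using hd
  rw [norm_div, div_pow, eq_div_iff hd', sub_mul, div_mul_cancel₀ _ hd']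
  have h1 := g.normSq_sub
  simp only [← Complex.normSq_eq_norm_sq, Complex.normSq_apply, Complex.add_re, Complex.add_im,
    Complex.mul_re, Complex.mul_im, Complex.conj_re, Complex.conj_im] at h1 ⊢
  linear_combination (1 - (w.re * w.re + w.im * w.im)) * h1

lemma JacobiGroup.one_sub_norm_map (h : JacobiGroup) {p : ℂ × ℂ} (hp : p ∈ domain) :
    1 - ‖(h.map p).2‖ ^ 2 = (1 - ‖p.2‖ ^ 2) / ‖h.den p‖ ^ 2 :=
  h.g.one_sub_norm_sq hp

/-- The complex derivative of the action of an element of the Jacobi group. -/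
def JacobiGroup.mapDeriv (h : JacobiGroup) (p : ℂ × ℂ) : ℂ × ℂ →L[ℂ] ℂ × ℂ :=
  ((h.den p)⁻¹ • ContinuousLinearMap.fst ℂ ℂ ℂ
      - (conj h.α / h.den p + (h.α - conj h.α * p.2 + p.1) * conj h.g.b / h.den p ^ 2) •
        ContinuousLinearMap.snd ℂ ℂ ℂ).prod
    ((h.den p ^ 2)⁻¹ • ContinuousLinearMap.snd ℂ ℂ ℂ)

lemma JacobiGroup.hasFDerivAt_map (h : JacobiGroup) {p : ℂ × ℂ} (hp : p ∈ domain) :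
    HasFDerivAt h.map (h.mapDeriv p) p := by
  have hd := h.den_ne_zero hp
  have hz : HasFDerivAt (fun q : ℂ × ℂ => q.1) (ContinuousLinearMap.fst ℂ ℂ ℂ) p := hasFDerivAt_fst
  have hw : HasFDerivAt (fun q : ℂ × ℂ => q.2) (ContinuousLinearMap.snd ℂ ℂ ℂ) p := hasFDerivAt_snd
  have hD : HasFDerivAt h.den (conj h.g.b • ContinuousLinearMap.snd ℂ ℂ ℂ) p :=
    (hw.const_mul (conj h.g.b)).add_const _
  have hDi := (hasDerivAt_inv hd).comp_hasFDerivAt p hD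
  have h1 := (((hw.const_mul (conj h.α)).const_sub h.α).add hz).mul (hDi)
  have h2 := ((hw.const_mul h.g.a).add_const h.g.b).mul (hDi)
  have e1 := h.g.det_eq
  refine ((h1.prodMk h2).congr_fderiv ?_).congr_of_eventuallyEq ?_
  · ext <;> simp [JacobiGroup.mapDeriv]
    · field_simp
    · field_simp
      simp only [JacobiGroup.den]
      linear_combination e1
  · exact Filter.Eventually.of_forall fun q => by simp [JacobiGroup.map, JacobiGroup.den, div_eq_mul_inv]

lemma JacobiGroup.differentiableOn_map (h : JacobiGroup) : DifferentiableOn ℂ h.map domain :=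
  fun _ hp => (h.hasFDerivAt_map hp).differentiableAt.differentiableWithinAt

lemma smul_coe (h : JacobiGroup) (x : domain) : ((h • x : domain) : ℂ × ℂ) = h.map x := rfl

/-- The boost of `SU(1,1)` which maps `0` to `w`. -/
def SU11.boost (w : ℂ) (hw : ‖w‖ < 1) : SU11 :=
  ⟨⟨!![((√(1 - ‖w‖ ^ 2))⁻¹ : ℝ), w * ((√(1 - ‖w‖ ^ 2))⁻¹ : ℝ);
      conj w * ((√(1 - ‖w‖ ^ 2))⁻¹ : ℝ), ((√(1 - ‖w‖ ^ 2))⁻¹ : ℝ)], by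
    have h1 : 0 < 1 - ‖w‖ ^ 2 := by nlinarith [norm_nonneg w]
    have h2 : (√(1 - ‖w‖ ^ 2))⁻¹ * (√(1 - ‖w‖ ^ 2))⁻¹ * (1 - ‖w‖ ^ 2) = 1 := by
      rw [← mul_inv, Real.mul_self_sqrt h1.le, inv_mul_cancel₀ h1.ne']
    have h3 : w * conj w = ((‖w‖ ^ 2 : ℝ) : ℂ) := by
      rw [Complex.mul_conj, Complex.normSq_eq_norm_sq]
    rw [Matrix.det_fin_two_of]
    have h2' := congrArg (fun x : ℝ => (x : ℂ)) h2
    push_cast at h2' h3 ⊢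
    linear_combination h2' - ((√(1 - ‖w‖ ^ 2) : ℝ) : ℂ)⁻¹ * ((√(1 - ‖w‖ ^ 2) : ℝ) : ℂ)⁻¹ * h3⟩,
    by simp, by simp⟩

/-- The origin is mapped to `(z, w)` by the boost to `w` together with a translation. -/
lemma isPretransitive : MulAction.IsPretransitive JacobiGroup domain := by
  have h0 : ((0, 0) : ℂ × ℂ) ∈ domain := by simp [domain]
  refine MulAction.IsPretransitive.of_orbit (x₀ := (⟨(0, 0), h0⟩ : domain)) fun x => ?_
  obtain ⟨⟨z, w⟩, hx⟩ := x
  have hw : ‖w‖ < 1 := hx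
  have h1 : 0 < √(1 - ‖w‖ ^ 2) := Real.sqrt_pos.2 (by nlinarith [norm_nonneg w])
  have h1' : ((√(1 - ‖w‖ ^ 2) : ℝ) : ℂ) ≠ 0 := by exact_mod_cast h1.ne'
  refine ⟨⟨SU11.boost w hw, z * ((√(1 - ‖w‖ ^ 2))⁻¹ : ℝ), 0⟩, Subtype.ext ?_⟩
  have ha : (SU11.boost w hw).a = ((√(1 - ‖w‖ ^ 2))⁻¹ : ℝ) := by simp [SU11.boost, SU11.a]
  have hb : (SU11.boost w hw).b = w * ((√(1 - ‖w‖ ^ 2))⁻¹ : ℝ) := by simp [SU11.boost, SU11.b]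
  rw [smul_coe]
  simp only [JacobiGroup.map, ha, hb, Complex.conj_ofReal, mul_zero, zero_add, add_zero, sub_zero]
  push_cast
  rw [mul_div_assoc, mul_div_assoc, div_self (inv_ne_zero h1'), mul_one, mul_one]

lemma mem_stabilizer_iff (h : JacobiGroup) (o : domain) (ho : (o : ℂ × ℂ) = (0, 0)) :
    h ∈ MulAction.stabilizer JacobiGroup o ↔ h.α = 0 ∧ h.g.b = 0 := by
  have hd := h.den_ne_zero o.2
  rw [MulAction.mem_stabilizer_iff, Subtype.ext_iff, smul_coe]
  rw [ho] at hd ⊢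
  simp only [JacobiGroup.den, mul_zero, zero_add, ne_eq, map_eq_zero] at hd
  simp [JacobiGroup.map, hd]

/-! ### Invariance of the measure -/

/-- The real Jacobian determinant is the squared modulus of the complex one. -/
lemma JacobiGroup.abs_det_mapDeriv (h : JacobiGroup) (p : ℂ × ℂ) :
    |((h.mapDeriv p).restrictScalars ℝ).det| = (‖h.den p‖ ^ 2)⁻¹ ^ 3 := by
  have h1 : (h.mapDeriv p : ℂ × ℂ →ₗ[ℂ] ℂ × ℂ).det = (h.den p)⁻¹ ^ 3 := by
    rw [← LinearMap.det_toMatrix (Module.Basis.finTwoProd ℂ), Matrix.det_fin_two]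
    simp [LinearMap.toMatrix_apply, JacobiGroup.mapDeriv]
    ring
  have h2 : ((h.mapDeriv p).restrictScalars ℝ).det
      = ((h.mapDeriv p : ℂ × ℂ →ₗ[ℂ] ℂ × ℂ).restrictScalars ℝ).det := rfl
  rw [h2, LinearMap.det_restrictScalars, h1, Algebra.norm_complex_eq]
  change |Complex.normSq ((h.den p)⁻¹ ^ 3)| = _
  rw [Complex.normSq_eq_norm_sq, norm_pow, norm_inv, abs_of_nonneg (by positivity)]
  ring

instance : (volume : Measure (ℂ × ℂ)).IsAddHaarMeasure :=
  inferInstanceAs ((volume : Measure ℂ).prod (volume : Measure ℂ)).IsAddHaarMeasure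

lemma invariantMeasure_apply {s : Set domain} (hs : MeasurableSet s) :
    invariantMeasure s
      = ∫⁻ p in Subtype.val '' s, ENNReal.ofReal (((1 - ‖p.2‖ ^ 2) ^ 3)⁻¹) := by
  rw [invariantMeasure, withDensity_apply _ hs,
    setLIntegral_subtype measurableSet_domain s
      (fun p : ℂ × ℂ => ENNReal.ofReal (((1 - ‖p.2‖ ^ 2) ^ 3)⁻¹))]

lemma JacobiGroup.injOn_map (h : JacobiGroup) : Set.InjOn h.map domain := by
  intro p hp q hq hpq
  have : h • (⟨p, hp⟩ : domain) = h • (⟨q, hq⟩ : domain) := Subtype.ext hpq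
  exact congrArg Subtype.val (smul_left_cancel h this)

lemma JacobiGroup.measurable_smul (h : JacobiGroup) : Measurable fun x : domain => h • x := by
  refine Continuous.measurable (Continuous.subtype_mk ?_ _)
  exact (h.differentiableOn_map.continuousOn).comp_continuous continuous_subtype_val fun x => x.2

lemma invariantMeasure_smul_image (h : JacobiGroup) {s : Set domain} (hs : MeasurableSet s)
    (hs' : MeasurableSet ((fun x : domain => h • x) '' s)) :
    invariantMeasure ((fun x : domain => h • x) '' s) = invariantMeasure s := by
  have hsd : Subtype.val '' s ⊆ domain := by rintro _ ⟨x, _, rfl⟩; exact x.2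
  have hsm : MeasurableSet (Subtype.val '' s) := measurableSet_domain.subtype_image hs
  have e : Subtype.val '' ((fun x : domain => h • x) '' s) = h.map '' (Subtype.val '' s) := by
    simp only [Set.image_image, smul_coe]
  rw [invariantMeasure_apply hs', invariantMeasure_apply hs, e,
    lintegral_image_eq_lintegral_abs_det_fderiv_mul volume hsm
      (fun p hp => ((h.hasFDerivAt_map (hsd hp)).restrictScalars ℝ).hasFDerivWithinAt)
      (h.injOn_map.mono hsd)]
  refine setLIntegral_congr_fun hsm fun p hp => ?_
  have hd : ‖h.den p‖ ^ 2 ≠ 0 := by simpa using h.den_ne_zero (hsd hp)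
  have hP : 0 < 1 - ‖p.2‖ ^ 2 := by linarith [normSq_lt_one (hsd hp)]
  rw [h.abs_det_mapDeriv, h.one_sub_norm_map (hsd hp), ← ENNReal.ofReal_mul (by positivity)]
  congr 1
  generalize ‖h.den p‖ ^ 2 = d at hd ⊢
  field_simp

lemma measurePreserving_smul (h : JacobiGroup) :
    MeasurePreserving (fun x : domain => h • x) invariantMeasure invariantMeasure := by
  refine ⟨h.measurable_smul, Measure.ext fun s hs => ?_⟩
  rw [Measure.map_apply h.measurable_smul hs]
  have e : (fun x : domain => h • x) ⁻¹' s = (fun x : domain => h⁻¹ • x) '' s := by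
    ext x
    constructor
    · intro hx
      exact ⟨h • x, hx, inv_smul_smul h x⟩
    · rintro ⟨y, hy, rfl⟩
      simpa using hy
  have hm : MeasurableSet ((fun x : domain => h⁻¹ • x) '' s) := by
    rw [← e]
    exact h.measurable_smul hs
  rw [e, invariantMeasure_smul_image h⁻¹ hs hm]

/-! ### Coherent state vectors in the orthonormal basis -/

/-- The norm `√(m! Γ(m+2k') / Γ(2k'))` of the vector `(K'_+)^m e_{k',k'}`. -/
def raisedNorm (k : ℝ) (m : ℕ) : ℝ :=
  √(m.factorial * (Real.Gamma (m + 2 * kPrime k) / Real.Gamma (2 * kPrime k)))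

/-- The function `f_{|n⟩;e_{k',k'+m}}`. -/
def basisFun (k : ℝ) (n m : ℕ) (p : ℂ × ℂ) : ℂ :=
  diskMonomial k m p.2 * (P n p / (√(n.factorial : ℝ) : ℝ))

lemma two_kPrime_pos {k : ℝ} (hk : 1 ≤ k) : 0 < 2 * kPrime k := by
  unfold kPrime; linarith

lemma Gamma_succ_add (s : ℝ) (hs : 0 < s) (m : ℕ) :
    Real.Gamma ((m + 1 : ℕ) + s) = (m + s) * Real.Gamma (m + s) := by
  rw [← Real.Gamma_add_one (by positivity)]
  congr 1
  push_cast
  ring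

lemma raisedNorm_zero {k : ℝ} (hk : 1 ≤ k) : raisedNorm k 0 = 1 := by
  have h := Real.Gamma_pos_of_pos (two_kPrime_pos hk)
  simp [raisedNorm, h.ne']

lemma raisedNorm_pos {k : ℝ} (hk : 1 ≤ k) (m : ℕ) : 0 < raisedNorm k m := by
  have hs := two_kPrime_pos hk
  have h := Real.Gamma_pos_of_pos hs
  have h' : 0 < Real.Gamma (m + 2 * kPrime k) := Real.Gamma_pos_of_pos (by positivity)
  exact Real.sqrt_pos.2 (by positivity)

lemma raisedNorm_succ {k : ℝ} (hk : 1 ≤ k) (m : ℕ) :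
    raisedNorm k (m + 1) = raisedNorm k m * √(((m : ℝ) + 1) * (m + 2 * kPrime k)) := by
  have hs := two_kPrime_pos hk
  have h := Real.Gamma_pos_of_pos hs
  have h' : 0 < Real.Gamma (m + 2 * kPrime k) := Real.Gamma_pos_of_pos (by positivity)
  rw [raisedNorm, raisedNorm, ← Real.sqrt_mul (by positivity), Gamma_succ_add _ hs,
    Nat.factorial_succ]
  congr 1
  push_cast
  ring

lemma diskMonomial_eq {k : ℝ} (m : ℕ) (w : ℂ) :
    diskMonomial k m w = ((raisedNorm k m / m.factorial : ℝ) : ℂ) * w ^ m := by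
  rw [diskMonomial]
  congr 2
  have hf : (0 : ℝ) < m.factorial := by exact_mod_cast m.factorial_pos
  rw [raisedNorm, eq_div_iff hf.ne']
  nth_rw 2 [← Real.sqrt_sq hf.le]
  rw [← Real.sqrt_mul' _ (by positivity)]
  congr 1
  field_simp

lemma opAdag_pow_single (n m l : ℕ) (c : ℂ) :
    (opAdag ^ l) (Finsupp.single (n, m) c)
      = Finsupp.single (n + l, m) (c * ((√((n + l).factorial / n.factorial : ℝ) : ℝ) : ℂ)) := by
  have hn : (0 : ℝ) < n.factorial := by exact_mod_cast n.factorial_pos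
  induction l with
  | zero => simp [div_self hn.ne']
  | succ l ih =>
    rw [pow_succ', Module.End.mul_apply, ih, opAdag_single, mul_assoc, ← Complex.ofReal_mul,
      ← Real.sqrt_mul (by positivity), ← Nat.add_assoc, Nat.factorial_succ]
    congr 4
    push_cast
    ring

lemma opKPlus'_pow_vac {k : ℝ} (hk : 1 ≤ k) (m : ℕ) :
    (opKPlus' k ^ m) vac = Finsupp.single (0, m) ((raisedNorm k m : ℝ) : ℂ) := by
  induction m with
  | zero => simp [vac, raisedNorm_zero hk]
  | succ m ih =>
    rw [pow_succ', Module.End.mul_apply, ih, opKPlus'_single, raisedNorm_succ hk,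
      Complex.ofReal_mul]

lemma raised_vac {k : ℝ} (hk : 1 ≤ k) (n m : ℕ) :
    (opAdag ^ n * opKPlus' k ^ m) vac
      = Finsupp.single (n, m) ((√(n.factorial : ℝ) * raisedNorm k m : ℝ) : ℂ) := by
  rw [Module.End.mul_apply, opKPlus'_pow_vac hk, opAdag_pow_single]
  simp [mul_comm]

lemma toFock_single (p : ℕ × ℕ) (c : ℂ) :
    toFock (Finsupp.single p c) = c • lp.single 2 p (1 : ℂ) := by
  simp [toFock, Finsupp.linearCombination_single]

lemma norm_toFock_single (p : ℕ × ℕ) (c : ℂ) : ‖toFock (Finsupp.single p c)‖ = ‖c‖ := by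
  rw [toFock_single, norm_smul, lp.norm_single (by norm_num), norm_one, mul_one]

lemma basisVector_eq {k : ℝ} (hk : 1 ≤ k) (n m : ℕ) :
    basisVector k n m = lp.single 2 (n, m) (1 : ℂ) := by
  have hs := two_kPrime_pos hk
  have h := Real.Gamma_pos_of_pos hs
  have h' : 0 < Real.Gamma (m + 2 * kPrime k) := Real.Gamma_pos_of_pos (by positivity)
  have hn : (0 : ℝ) < √(n.factorial : ℝ) := Real.sqrt_pos.2 (by exact_mod_cast n.factorial_pos)
  have e : √(Real.Gamma (2 * kPrime k) / (m.factorial * Real.Gamma (m + 2 * kPrime k)))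
      * raisedNorm k m = 1 := by
    rw [raisedNorm, ← Real.sqrt_mul (by positivity), Real.sqrt_eq_one]
    field_simp
  rw [basisVector, raised_vac hk, Finsupp.smul_single, toFock_single, smul_eq_mul,
    ← Complex.ofReal_mul]
  have e' : (√(n.factorial : ℝ))⁻¹ * √(Real.Gamma (2 * kPrime k)
      / (m.factorial * Real.Gamma (m + 2 * kPrime k))) * (√(n.factorial : ℝ) * raisedNorm k m) = 1 := by
    calc _ = ((√(n.factorial : ℝ))⁻¹ * √(n.factorial : ℝ)) * (√(Real.Gamma (2 * kPrime k)
      / (m.factorial * Real.Gamma (m + 2 * kPrime k))) * raisedNorm k m) := by ring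
      _ = 1 := by rw [e, inv_mul_cancel₀ hn.ne', mul_one]
  rw [e', Complex.ofReal_one, one_smul]

/-- The coefficient of `z^a w^{b+c}` in the component of `exp(z a⁺ + w K_+) e₀` along
`|a+2b⟩ ⊗ e_{k',k'+c}`. -/
def expCoeff (k : ℝ) (a b c : ℕ) : ℝ :=
  √((a + 2 * b).factorial : ℝ) * raisedNorm k c / (a.factorial * b.factorial * c.factorial * 2 ^ b)

/-- The binomial theorem for the commuting operators `z a⁺`, `(w/2) (a⁺)²` and `w K'_+`, whose sum is
`z a⁺ + w K_+`. -/
lemma coherentTerm_eq {k : ℝ} (hk : 1 ≤ k) (p : ℂ × ℂ) (j : ℕ) :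
    coherentTerm k p j = ∑ x ∈ Finset.HasAntidiagonal.antidiagonal j, ∑ y ∈ Finset.HasAntidiagonal.antidiagonal x.1,
      toFock (Finsupp.single (y.1 + 2 * y.2, x.2)
        (p.1 ^ y.1 * p.2 ^ (y.2 + x.2) * (expCoeff k y.1 y.2 x.2 : ℂ))) := by
  obtain ⟨z, w⟩ := p
  have hAB : Commute opAdag (opKPlus' k) := comm_Adag_KPlus' k
  have e : z • opAdag + w • opKPlus k
      = (z • opAdag + (w / 2) • opAdag ^ 2) + w • opKPlus' k := by
    rw [opKPlus, smul_add, smul_smul, add_assoc]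
    congr 3
    ring
  have h1 : Commute (z • opAdag + (w / 2) • opAdag ^ 2) (w • opKPlus' k) :=
    ((hAB.smul_left z).add_left ((hAB.pow_left 2).smul_left _)).smul_right w
  have h2 : Commute (z • opAdag) ((w / 2) • opAdag ^ 2) :=
    (((Commute.refl opAdag).pow_right 2).smul_right _).smul_left _
  have hfac : ∀ {N : ℕ} {x : ℕ × ℕ}, x ∈ Finset.HasAntidiagonal.antidiagonal N →
      ((N.choose x.1 : ℕ) : ℂ) = N.factorial / (x.1.factorial * x.2.factorial) := by
    intro N x hx
    rw [Finset.HasAntidiagonal.mem_antidiagonal] at hx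
    subst hx
    rw [Nat.choose_symm_add, Nat.add_choose, Nat.cast_div (Nat.factorial_mul_factorial_dvd_factorial_add _ _)
      (by positivity)]
    push_cast
    rfl
  rw [coherentTerm, ← map_smul]
  simp only [← map_sum]
  congr 1
  rw [e, h1.add_pow', LinearMap.sum_apply, Finset.smul_sum]
  refine Finset.sum_congr rfl fun x hx => ?_
  rw [h2.add_pow', Finset.sum_mul, Finset.smul_sum, LinearMap.sum_apply, Finset.smul_sum]
  refine Finset.sum_congr rfl fun y hy => ?_
  rw [smul_pow, smul_pow, smul_pow, ← pow_mul, smul_mul_smul_comm, ← pow_add, smul_mul_assoc,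
    smul_mul_smul_comm, ← Nat.cast_smul_eq_nsmul ℂ, ← Nat.cast_smul_eq_nsmul ℂ,
    LinearMap.smul_apply, LinearMap.smul_apply, LinearMap.smul_apply, raised_vac hk,
    Finsupp.smul_single, Finsupp.smul_single, Finsupp.smul_single, Finsupp.smul_single,
    hfac hx, hfac hy]
  congr 1
  have hj : (j.factorial : ℂ) ≠ 0 := by exact_mod_cast j.factorial_ne_zero
  have hx1 : (x.1.factorial : ℂ) ≠ 0 := by exact_mod_cast x.1.factorial_ne_zero
  simp only [smul_eq_mul, expCoeff, div_pow, pow_add]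
  push_cast
  field_simp

lemma toFock_single_apply (p q : ℕ × ℕ) (c : ℂ) :
    (toFock (Finsupp.single p c) : ∀ _ : ℕ × ℕ, ℂ) q = if p = q then c else 0 := by
  classical
  rw [toFock_single, lp.coeFn_smul, Pi.smul_apply, lp.single_apply]
  by_cases h : p = q
  · subst h; simp
  · simp [h, Ne.symm h]

/-- The binomial coefficient `(a+2b choose a)` is bounded by means of the expansion of
`1 = ((δ-1)/δ + 1/δ)^(a+2b)`, in which it occurs. -/
lemma factorial_add_two_mul_le {δ : ℝ} (hδ : 1 < δ) (a b : ℕ) :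
    ((a + 2 * b).factorial : ℝ)
      ≤ (δ / (δ - 1)) ^ a * δ ^ (2 * b) * (a.factorial * (2 ^ b * b.factorial) ^ 2) := by
  have h0 : 0 < δ - 1 := by linarith
  have h1 : ((a + 2 * b).choose a : ℝ) ≤ (δ / (δ - 1)) ^ a * δ ^ (2 * b) := by
    have h2 : ((δ - 1) / δ) ^ a * (1 / δ) ^ (2 * b) * ((a + 2 * b).choose a : ℝ) ≤ 1 := by
      have h3 := add_pow ((δ - 1) / δ) (1 / δ) (a + 2 * b)
      have h4 : (δ - 1) / δ + 1 / δ = 1 := by field_simp; ring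
      rw [h4, one_pow] at h3
      refine le_of_le_of_eq ?_ h3.symm
      have h5 := Finset.single_le_sum (s := Finset.range (a + 2 * b + 1))
        (f := fun m => ((δ - 1) / δ) ^ m * (1 / δ) ^ (a + 2 * b - m) * ((a + 2 * b).choose m : ℝ))
        (fun m _ => by positivity) (Finset.mem_range.2 (by omega : a < a + 2 * b + 1))
      simpa using h5
    have h6 : ((δ - 1) / δ) ^ a * (1 / δ) ^ (2 * b) = ((δ / (δ - 1)) ^ a * δ ^ (2 * b))⁻¹ := by
      rw [mul_inv, ← inv_pow, ← inv_pow, inv_div, one_div]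
    rw [h6, inv_mul_le_iff₀ (by positivity), mul_one] at h2
    exact h2
  have h7 : ((2 * b).factorial : ℝ) ≤ (2 ^ b * b.factorial) ^ 2 := by
    have h8 : (2 * b).factorial ≤ (2 ^ b * b.factorial) ^ 2 := by
      have h9 := Nat.centralBinom_eq_two_mul_choose b
      have h10 := Nat.choose_mul_factorial_mul_factorial (by omega : b ≤ 2 * b)
      have h11 : (2 * b).choose b ≤ 4 ^ b := by
        have := Nat.choose_le_two_pow (2 * b) b
        rwa [pow_mul] at this
      have h12 : 2 * b - b = b := by omega
      rw [h12] at h10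
      calc (2 * b).factorial = (2 * b).choose b * b.factorial * b.factorial := h10.symm
        _ ≤ 4 ^ b * b.factorial * b.factorial := by gcongr
        _ = (2 ^ b * b.factorial) ^ 2 := by
          rw [show 4 = 2 ^ 2 by norm_num, ← pow_mul]; ring
    exact_mod_cast h8
  have h13 : ((a + 2 * b).factorial : ℝ)
      = (a + 2 * b).choose a * (a.factorial * (2 * b).factorial) := by
    have := Nat.choose_mul_factorial_mul_factorial (by omega : a ≤ a + 2 * b)
    rw [show a + 2 * b - a = 2 * b by omega] at this
    rw [← this]
    push_cast
    ring
  rw [h13]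
  gcongr

lemma expCoeff_nonneg (k : ℝ) (a b c : ℕ) : 0 ≤ expCoeff k a b c := by
  unfold expCoeff raisedNorm
  positivity

/-- The factor `√((a+2b)!)` is compensated by `a! b! 2^b` up to exponential factors. For `δ` close
to `1` the factor `δ^b` spoils the convergence of the series in `w` arbitrarily little. -/
lemma expCoeff_le {k : ℝ} {δ : ℝ} (hδ : 1 < δ) (a b c : ℕ) :
    expCoeff k a b c
      ≤ ((δ / (δ - 1)) ^ a / √(a.factorial : ℝ)) * δ ^ b * (raisedNorm k c / c.factorial) := by
  have h0 : 0 < δ - 1 := by linarith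
  have ha : (0 : ℝ) < a.factorial := by exact_mod_cast a.factorial_pos
  have hb : (0 : ℝ) < b.factorial := by exact_mod_cast b.factorial_pos
  have hc : (0 : ℝ) < c.factorial := by exact_mod_cast c.factorial_pos
  have hr : 0 ≤ raisedNorm k c := Real.sqrt_nonneg _
  have hM : 1 ≤ (δ / (δ - 1)) ^ a := one_le_pow₀ (by rw [le_div_iff₀ h0]; linarith)
  have h1 : √((a + 2 * b).factorial : ℝ)
      ≤ (δ / (δ - 1)) ^ a * δ ^ b * (√(a.factorial : ℝ) * (2 ^ b * b.factorial)) := by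
    refine Real.sqrt_le_iff.2 ⟨by positivity, (factorial_add_two_mul_le hδ a b).trans ?_⟩
    have e : ((δ / (δ - 1)) ^ a * δ ^ b * (√(a.factorial : ℝ) * (2 ^ b * b.factorial))) ^ 2
        = (δ / (δ - 1)) ^ a * ((δ / (δ - 1)) ^ a * δ ^ (2 * b)
          * (a.factorial * (2 ^ b * b.factorial) ^ 2)) := by
      linear_combination ((δ / (δ - 1)) ^ a * δ ^ b * (2 ^ b * b.factorial)) ^ 2
        * Real.sq_sqrt ha.le
    rw [e]
    exact le_mul_of_one_le_left (by positivity) hM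
  have h2 : √(a.factorial : ℝ) * √(a.factorial : ℝ) = a.factorial := Real.mul_self_sqrt ha.le
  have h3 : 0 < √(a.factorial : ℝ) := Real.sqrt_pos.2 ha
  rw [expCoeff, div_le_iff₀ (by positivity)]
  calc _ ≤ (δ / (δ - 1)) ^ a * δ ^ b * (√(a.factorial : ℝ) * (2 ^ b * b.factorial))
        * raisedNorm k c := by gcongr
    _ = _ := by
      generalize √(a.factorial : ℝ) = s at h2 h3 ⊢
      rw [← h2]
      field_simp

/-! ### Convergence of the exponential series -/

/-- The dominating series in the variable `z`. -/
def domZ (δ R : ℝ) (a : ℕ) : ℝ := (R * (δ / (δ - 1))) ^ a / √(a.factorial : ℝ)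

/-- The dominating series in the variable `w` of the disk. -/
def domW (k r : ℝ) (c : ℕ) : ℝ := r ^ c * (raisedNorm k c / c.factorial)

lemma summable_domZ {δ R : ℝ} (hδ : 1 < δ) (hR : 0 ≤ R) : Summable (domZ δ R) := by
  have h0 : 0 < δ - 1 := by linarith
  set M := R * (δ / (δ - 1)) with hM
  have hM0 : 0 ≤ M := by positivity
  refine summable_of_ratio_norm_eventually_le (r := 1 / 2) (by norm_num) ?_
  filter_upwards [Filter.eventually_ge_atTop ⌈(2 * M) ^ 2⌉₊] with a ha
  have ha' : (2 * M) ^ 2 ≤ (a + 1 : ℝ) := (Nat.ceil_le.1 ha).trans (by linarith)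
  have h1 : 2 * M ≤ √(a + 1 : ℝ) := Real.le_sqrt_of_sq_le ha'
  have hf : (0 : ℝ) < √(a.factorial : ℝ) := Real.sqrt_pos.2 (by exact_mod_cast a.factorial_pos)
  have hs : 0 < √(a + 1 : ℝ) := Real.sqrt_pos.2 (by positivity)
  have e : domZ δ R (a + 1) = domZ δ R a * (M / √(a + 1 : ℝ)) := by
    rw [domZ, domZ, Nat.factorial_succ, Nat.cast_mul, Real.sqrt_mul (by positivity), pow_succ]
    push_cast
    rw [← hM]
    field_simp
  have hn : 0 ≤ domZ δ R a := by unfold domZ; positivity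
  rw [e, norm_mul, mul_comm]
  refine mul_le_mul_of_nonneg_right ?_ (norm_nonneg _)
  rw [Real.norm_of_nonneg (by positivity), div_le_iff₀ hs]
  linarith

lemma summable_domW {k r : ℝ} (hk : 1 ≤ k) (hr : 0 ≤ r) (hr1 : r < 1) : Summable (domW k r) := by
  have hs := two_kPrime_pos hk
  set s := 2 * kPrime k with hsdef
  refine summable_of_ratio_norm_eventually_le (r := (1 + r) / 2) (by linarith) ?_
  filter_upwards [Filter.eventually_ge_atTop ⌈2 * r * s / (1 - r)⌉₊] with c hc
  have hc' : 2 * r * s ≤ c * (1 - r) := by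
    rw [← div_le_iff₀ (by linarith)]
    exact Nat.ceil_le.1 hc
  have h1 : √(((c : ℝ) + 1) * (c + s)) ≤ c + 1 + s := by
    refine Real.sqrt_le_iff.2 ⟨by positivity, ?_⟩
    nlinarith [Nat.cast_nonneg (α := ℝ) c]
  have e : domW k r (c + 1) = r * √(((c : ℝ) + 1) * (c + s)) / (c + 1) * domW k r c := by
    rw [domW, domW, raisedNorm_succ hk, Nat.factorial_succ, pow_succ]
    push_cast
    rw [← hsdef]
    field_simp
  rw [e, norm_mul]
  refine mul_le_mul_of_nonneg_right ?_ (norm_nonneg _)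
  rw [Real.norm_of_nonneg (by positivity), div_le_iff₀ (by positivity)]
  calc r * √(((c : ℝ) + 1) * (c + s)) ≤ r * (c + 1 + s) := by gcongr
    _ ≤ (1 + r) / 2 * (c + 1) := by nlinarith

/-- A summable bound for the terms of the exponential series, uniform on `|z| ≤ R`, `|w| ≤ r`. -/
def domTerm (k δ R r : ℝ) (j : ℕ) : ℝ :=
  ∑ x ∈ Finset.HasAntidiagonal.antidiagonal j,
    (∑ y ∈ Finset.HasAntidiagonal.antidiagonal x.1, domZ δ R y.1 * (r * δ) ^ y.2) * domW k r x.2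

lemma summable_domTerm {k δ R r : ℝ} (hk : 1 ≤ k) (hδ : 1 < δ) (hR : 0 ≤ R) (hr : 0 ≤ r)
    (hrδ : r * δ < 1) : Summable (domTerm k δ R r) := by
  have h1 := summable_domZ hδ hR
  have h2 : Summable fun b : ℕ => (r * δ) ^ b := summable_geometric_of_lt_one (by positivity) hrδ
  have h3 := summable_domW hk hr (by nlinarith : r < 1)
  have h4 := summable_norm_sum_mul_antidiagonal_of_summable_norm h1.norm h2.norm
  exact (summable_norm_sum_mul_antidiagonal_of_summable_norm h4 h3.norm).of_norm

lemma norm_coherentTerm_le {k δ R r : ℝ} (hk : 1 ≤ k) (hδ : 1 < δ) {p : ℂ × ℂ} (hR : ‖p.1‖ ≤ R)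
    (hr : ‖p.2‖ ≤ r) (j : ℕ) : ‖coherentTerm k p j‖ ≤ domTerm k δ R r j := by
  have h0 : 0 < δ - 1 := by linarith
  rw [coherentTerm_eq hk, domTerm]
  refine (norm_sum_le _ _).trans (Finset.sum_le_sum fun x _ => ?_)
  rw [Finset.sum_mul]
  refine (norm_sum_le _ _).trans (Finset.sum_le_sum fun y _ => ?_)
  rw [norm_toFock_single, norm_mul, norm_mul, norm_pow, norm_pow, Complex.norm_real,
    Real.norm_of_nonneg (expCoeff_nonneg _ _ _ _)]
  have hR0 : 0 ≤ R := (norm_nonneg _).trans hR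
  have hr0 : 0 ≤ r := (norm_nonneg _).trans hr
  have h1 : ‖p.1‖ ^ y.1 ≤ R ^ y.1 := by gcongr
  have h2 : ‖p.2‖ ^ (y.2 + x.2) ≤ r ^ (y.2 + x.2) := by gcongr
  calc _ ≤ R ^ y.1 * r ^ (y.2 + x.2) * (((δ / (δ - 1)) ^ y.1 / √(y.1.factorial : ℝ)) * δ ^ y.2
        * (raisedNorm k x.2 / x.2.factorial)) := by
        have := expCoeff_le (k := k) hδ y.1 y.2 x.2
        have := expCoeff_nonneg k y.1 y.2 x.2
        gcongr
    _ = _ := by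
      rw [domZ, domW, mul_pow, mul_pow, pow_add]
      ring

/-- A factor `δ > 1` with `r δ < 1`. -/
lemma exists_one_lt_mul_lt {r : ℝ} (hr : r < 1) (hr0 : 0 ≤ r) : ∃ δ : ℝ, 1 < δ ∧ r * δ < 1 := by
  refine ⟨2 / (1 + r), ?_, ?_⟩
  · rw [lt_div_iff₀ (by linarith)]; linarith
  · rw [← mul_div_assoc, div_lt_one (by linarith)]; linarith

lemma summable_coherentTerm {k : ℝ} (hk : 1 ≤ k) {p : ℂ × ℂ} (hp : p ∈ domain) :
    Summable (coherentTerm k p) := by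
  obtain ⟨δ, h1, h2⟩ := exists_one_lt_mul_lt (r := ‖p.2‖) hp (norm_nonneg _)
  exact Summable.of_norm_bounded
    (summable_domTerm hk h1 (norm_nonneg p.1) (norm_nonneg p.2) h2)
    fun j => norm_coherentTerm_le hk h1 le_rfl le_rfl j

lemma basisFun_eq {k : ℝ} (n m : ℕ) (p : ℂ × ℂ) :
    basisFun k n m p = ∑ b ∈ Finset.range (n / 2 + 1),
      p.1 ^ (n - 2 * b) * p.2 ^ (b + m) * (expCoeff k (n - 2 * b) b m : ℂ) := by
  have hn : (0 : ℝ) < n.factorial := by exact_mod_cast n.factorial_pos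
  have hn' : ((√(n.factorial : ℝ) : ℝ) : ℂ) ≠ 0 := by
    exact_mod_cast (Real.sqrt_pos.2 hn).ne'
  have hsq : ((√(n.factorial : ℝ) : ℝ) : ℂ) * ((√(n.factorial : ℝ) : ℝ) : ℂ) = n.factorial := by
    exact_mod_cast Real.mul_self_sqrt hn.le
  have hn2 : (n.factorial : ℂ) / ((√(n.factorial : ℝ) : ℝ) : ℂ) = ((√(n.factorial : ℝ) : ℝ) : ℂ) := by
    rw [div_eq_iff hn', hsq]
  rw [basisFun, diskMonomial_eq, P, mul_div_right_comm, hn2, Finset.mul_sum, Finset.mul_sum]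
  refine Finset.sum_congr rfl fun b hb => ?_
  have hb' : n - 2 * b + 2 * b = n := by
    have := Finset.mem_range.1 hb
    omega
  rw [expCoeff, hb', div_pow, pow_add]
  push_cast
  field_simp

/-- The monomial `z^(n-2b) w^(b+m)` in `basisFun k n m` has degree `n-b+m`, so it occurs in the term
of the exponential series with this index only. -/
lemma coherentTerm_apply {k : ℝ} (hk : 1 ≤ k) (p : ℂ × ℂ) (j n m : ℕ) :
    (coherentTerm k p j : ∀ _ : ℕ × ℕ, ℂ) (n, m) = ∑ b ∈ Finset.range (n / 2 + 1),
      if j = n - b + m then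
        p.1 ^ (n - 2 * b) * p.2 ^ (b + m) * (expCoeff k (n - 2 * b) b m : ℂ) else 0 := by
  rw [coherentTerm_eq hk]
  simp only [lp.coeFn_sum, Finset.sum_apply, toFock_single_apply]
  rw [Finset.sum_sigma', ← Finset.sum_filter, ← Finset.sum_filter]
  refine Finset.sum_bij' (fun x _ => x.2.2) (fun b _ => ⟨(j - m, m), (n - 2 * b, b)⟩) ?_ ?_ ?_ ?_ ?_
  · rintro ⟨⟨i, c⟩, ⟨a, b⟩⟩ h
    simp only [Finset.mem_filter, Finset.mem_sigma, Finset.HasAntidiagonal.mem_antidiagonal,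
      Prod.mk.injEq, Finset.mem_range] at h ⊢
    omega
  · intro b h
    simp only [Finset.mem_filter, Finset.mem_sigma, Finset.HasAntidiagonal.mem_antidiagonal,
      Prod.mk.injEq, Finset.mem_range] at h ⊢
    exact ⟨⟨by omega, by omega⟩, by omega, trivial⟩
  · rintro ⟨⟨i, c⟩, ⟨a, b⟩⟩ h
    simp only [Finset.mem_filter, Finset.mem_sigma, Finset.HasAntidiagonal.mem_antidiagonal,
      Prod.mk.injEq] at h ⊢
    obtain ⟨⟨h1, h2⟩, h3, h4⟩ := h
    have e1 : j - m = i := by omega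
    have e2 : n - 2 * b = a := by omega
    subst e1 e2 h4
    rfl
  · intro b h
    rfl
  · rintro ⟨⟨i, c⟩, ⟨a, b⟩⟩ h
    simp only [Finset.mem_filter, Finset.mem_sigma, Finset.HasAntidiagonal.mem_antidiagonal,
      Prod.mk.injEq] at h ⊢
    obtain ⟨⟨h1, h2⟩, h3, h4⟩ := h
    have e2 : n - 2 * b = a := by omega
    subst e2 h4
    rfl

lemma coherent_apply {k : ℝ} (hk : 1 ≤ k) {p : ℂ × ℂ} (hp : p ∈ domain) (n m : ℕ) :
    (coherent k p : ∀ _ : ℕ × ℕ, ℂ) (n, m) = basisFun k n m p := by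
  have h1 := (lp.evalCLM ℂ (fun _ : ℕ × ℕ => ℂ) 2 (n, m)).map_tsum (summable_coherentTerm hk hp)
  have h2 : (coherent k p : ∀ _ : ℕ × ℕ, ℂ) (n, m)
      = ∑' j, (coherentTerm k p j : ∀ _ : ℕ × ℕ, ℂ) (n, m) := h1
  rw [h2, basisFun_eq]
  simp only [coherentTerm_apply hk]
  rw [Summable.tsum_finsetSum fun b _ => (hasSum_ite_eq _ _).summable]
  exact Finset.sum_congr rfl fun b _ => tsum_ite_eq _ _

/-! ### The functions attached to vectors -/

lemma conj_mem_domain {p : ℂ × ℂ} (hp : p ∈ domain) : (conj p.1, conj p.2) ∈ domain := by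
  simpa [domain] using hp

lemma conj_basisFun (k : ℝ) (n m : ℕ) (p : ℂ × ℂ) :
    conj (basisFun k n m (conj p.1, conj p.2)) = basisFun k n m p := by
  simp only [basisFun_eq, map_sum, map_mul, map_pow, Complex.conj_conj, Complex.conj_ofReal]

lemma hasSum_symbol {k : ℝ} (hk : 1 ≤ k) (ψ : FockSpace) {p : ℂ × ℂ} (hp : p ∈ domain) :
    HasSum (fun i : ℕ × ℕ => basisFun k i.1 i.2 p * ψ i) (symbol k ψ p) := by
  have h := lp.hasSum_inner (𝕜 := ℂ) (coherent k (conj p.1, conj p.2)) ψ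
  refine h.congr_fun fun i => ?_
  rw [coherent_apply hk (conj_mem_domain hp), RCLike.inner_apply, conj_basisFun, mul_comm]

lemma symbol_basisVector {k : ℝ} (hk : 1 ≤ k) (n m : ℕ) {p : ℂ × ℂ} (hp : p ∈ domain) :
    symbol k (basisVector k n m) p = basisFun k n m p := by
  rw [symbol, basisVector_eq hk, lp.inner_single_right, coherent_apply hk (conj_mem_domain hp),
    RCLike.inner_apply, conj_basisFun, one_mul]

/-- A locally normally convergent series of holomorphic functions on an open subset of a normed
space is holomorphic. The derivatives are bounded by Cauchy's estimate on complex lines. -/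
lemma differentiableOn_tsum_of_locally_bounded {ι E : Type*} [NormedAddCommGroup E]
    [NormedSpace ℂ E] {g : ι → E → ℂ} {s : Set E} (hs : IsOpen s)
    (hg : ∀ i, DifferentiableOn ℂ (g i) s)
    (hb : ∀ p ∈ s, ∃ t ∈ nhds p, ∃ u : ι → ℝ, Summable u ∧ ∀ i, ∀ q ∈ t, ‖g i q‖ ≤ u i) :
    DifferentiableOn ℂ (fun q => ∑' i, g i q) s := by
  intro p hp
  obtain ⟨t, ht, u, hu, hub⟩ := hb p hp
  obtain ⟨ε, hε, hball⟩ := Metric.mem_nhds_iff.1 (Filter.inter_mem ht (hs.mem_nhds hp))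
  have hsub : Metric.ball p (ε / 2) ⊆ Metric.ball p ε := Metric.ball_subset_ball (by linarith)
  have hd : ∀ i, ∀ q ∈ Metric.ball p ε, DifferentiableAt ℂ (g i) q := fun i q hq =>
    (hg i).differentiableAt (hs.mem_nhds (hball hq).2)
  have hpm : p ∈ Metric.ball p (ε / 2) := Metric.mem_ball_self (by linarith)
  refine (hasFDerivAt_tsum_of_isPreconnected (u := fun i => u i * (2 / ε))
    (f' := fun i q => fderiv ℂ (g i) q) (hu.mul_right _) Metric.isOpen_ball
    (convex_ball p (ε / 2)).isPreconnected (fun i q hq => (hd i q (hsub hq)).hasFDerivAt) ?_ hpm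
    (Summable.of_norm_bounded hu fun i => hub i p (hball (hsub hpm)).1)
    hpm).differentiableAt.differentiableWithinAt
  intro i q hq
  have hu0 : 0 ≤ u i := (norm_nonneg _).trans (hub i p (hball (hsub hpm)).1)
  refine ContinuousLinearMap.opNorm_le_bound _ (by positivity) fun v => ?_
  by_cases hv : v = 0
  · simp [hv]
  have hv' : 0 < ‖v‖ := norm_pos_iff.2 hv
  have hline : ∀ τ ∈ Metric.closedBall (0 : ℂ) (ε / 2 / ‖v‖), q + τ • v ∈ Metric.ball p ε := by
    intro τ hτ
    rw [mem_closedBall_zero_iff, le_div_iff₀ hv', ← norm_smul] at hτ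
    rw [Metric.mem_ball, dist_eq_norm] at hq ⊢
    calc ‖q + τ • v - p‖ = ‖(q - p) + τ • v‖ := by congr 1; abel
      _ ≤ ‖q - p‖ + ‖τ • v‖ := norm_add_le _ _
      _ < ε := by linarith
  have hγ : ∀ τ : ℂ, HasDerivAt (fun τ : ℂ => q + τ • v) v τ := fun τ => by
    simpa using ((hasDerivAt_id τ).smul_const v).const_add q
  have h1 : HasDerivAt (fun τ : ℂ => g i (q + τ • v)) (fderiv ℂ (g i) q v) 0 := by
    have h2 : HasFDerivAt (g i) (fderiv ℂ (g i) q) (q + (0 : ℂ) • v) := by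
      simpa using (hd i q (hsub hq)).hasFDerivAt
    exact h2.comp_hasDerivAt 0 (hγ 0)
  have h3 : DiffContOnCl ℂ (fun τ : ℂ => g i (q + τ • v)) (Metric.ball 0 (ε / 2 / ‖v‖)) := by
    refine DifferentiableOn.diffContOnCl fun τ hτ => ?_
    rw [closure_ball _ (by positivity)] at hτ
    exact ((hd i _ (hline τ hτ)).comp τ (hγ τ).differentiableAt).differentiableWithinAt
  have h4 := Complex.norm_deriv_le_of_forall_mem_sphere_norm_le (by positivity) h3
    fun τ hτ => hub i _ (hball (hline τ (Metric.sphere_subset_closedBall hτ))).1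
  rw [h1.deriv] at h4
  calc _ ≤ _ := h4
    _ = _ := by field_simp

lemma differentiableOn_symbol {k : ℝ} (hk : 1 ≤ k) (ψ : FockSpace) :
    DifferentiableOn ℂ (symbol k ψ) domain := by
  have h1 : ∀ p ∈ domain, symbol k ψ p
      = ∑' j, ⟪coherentTerm k (conj p.1, conj p.2) j, ψ⟫_ℂ := by
    intro p hp
    have hs := (summable_coherentTerm hk (conj_mem_domain hp)).hasSum
    have h2 := ((innerSL ℂ ψ).hasSum hs).mapL (Complex.conjCLE : ℂ →L[ℝ] ℂ)
    have h3 : HasSum (fun j => ⟪coherentTerm k (conj p.1, conj p.2) j, ψ⟫_ℂ) (symbol k ψ p) := by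
      simpa [symbol, coherent] using h2
    exact h3.tsum_eq.symm
  refine DifferentiableOn.congr (differentiableOn_tsum_of_locally_bounded isOpen_domain ?_ ?_) h1
  · intro j
    simp only [coherentTerm_eq hk, toFock_single, sum_inner, inner_smul_left, map_mul, map_pow,
      Complex.conj_conj]
    fun_prop
  · intro p hp
    have hp' : ‖p.2‖ < 1 := hp
    obtain ⟨r, hr, hr1⟩ := exists_between hp'
    obtain ⟨δ, h2, h3⟩ := exists_one_lt_mul_lt hr1 ((norm_nonneg _).trans hr.le)
    refine ⟨{q | ‖q.1‖ < ‖p.1‖ + 1 ∧ ‖q.2‖ < r}, ?_,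
      fun j => domTerm k δ (‖p.1‖ + 1) r j * ‖ψ‖, ?_, ?_⟩
    · have o1 : IsOpen {q : ℂ × ℂ | ‖q.1‖ < ‖p.1‖ + 1} := isOpen_lt (by fun_prop) continuous_const
      have o2 : IsOpen {q : ℂ × ℂ | ‖q.2‖ < r} := isOpen_lt (by fun_prop) continuous_const
      exact (o1.inter o2).mem_nhds ⟨by simp, hr⟩
    · exact (summable_domTerm hk h2 (by positivity) ((norm_nonneg _).trans hr.le) h3).mul_right _
    · rintro j q ⟨hq1, hq2⟩
      refine (norm_inner_le_norm _ _).trans ?_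
      exact mul_le_mul_of_nonneg_right
        (norm_coherentTerm_le hk h2 (by simpa using hq1.le) (by simpa using hq2.le) j)
        (norm_nonneg _)

/-! ### Sums of power series -/

/-- The sum of the power series with coefficients `c`. -/
def psum (c : ℕ → ℂ) (t : ℂ) : ℂ := ∑' n, c n * t ^ n

/-- The coefficients of `t ↦ t * f t`. -/
def shiftCoeff (c : ℕ → ℂ) : ℕ → ℂ
  | 0 => 0
  | n + 1 => c n

/-- The coefficients of the derivative. -/
def derivCoeff (c : ℕ → ℂ) (n : ℕ) : ℂ := (n + 1) * c (n + 1)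

/-- The series converges absolutely on the closed disk of radius `r`. -/
def SummableAt (c : ℕ → ℂ) (r : ℝ) : Prop := Summable fun n => ‖c n‖ * r ^ n

lemma SummableAt.summable {c : ℕ → ℂ} {r : ℝ} (h : SummableAt c r) {t : ℂ} (ht : ‖t‖ ≤ r) :
    Summable fun n => c n * t ^ n := by
  refine Summable.of_norm_bounded h fun n => ?_
  rw [norm_mul, norm_pow]
  gcongr

lemma SummableAt.add {c d : ℕ → ℂ} {r : ℝ} (hr : 0 ≤ r) (h : SummableAt c r)
    (h' : SummableAt d r) : SummableAt (fun n => c n + d n) r := by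
  refine Summable.of_nonneg_of_le (fun n => by positivity) (fun n => ?_) (Summable.add h h')
  rw [← add_mul]
  gcongr
  exact norm_add_le _ _

lemma SummableAt.const_mul {c : ℕ → ℂ} {r : ℝ} (h : SummableAt c r) (a : ℂ) :
    SummableAt (fun n => a * c n) r := by
  simpa only [SummableAt, norm_mul, mul_assoc] using Summable.mul_left ‖a‖ h

lemma SummableAt.shift {c : ℕ → ℂ} {r : ℝ} (h : SummableAt c r) :
    SummableAt (shiftCoeff c) r := by
  refine (summable_nat_add_iff 1).1 ?_
  refine (Summable.mul_left r h).congr fun n => ?_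
  simp only [shiftCoeff, pow_succ]
  ring

lemma psum_add {c d : ℕ → ℂ} {r : ℝ} (h : SummableAt c r) (h' : SummableAt d r) {t : ℂ}
    (ht : ‖t‖ ≤ r) : psum (fun n => c n + d n) t = psum c t + psum d t := by
  simp only [psum, add_mul]
  exact (h.summable ht).tsum_add (h'.summable ht)

lemma psum_const_mul (c : ℕ → ℂ) (a t : ℂ) : psum (fun n => a * c n) t = a * psum c t := by
  simp only [psum, mul_assoc]
  exact tsum_mul_left

lemma psum_shift {c : ℕ → ℂ} {r : ℝ} (h : SummableAt c r) {t : ℂ} (ht : ‖t‖ ≤ r) :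
    psum (shiftCoeff c) t = t * psum c t := by
  rw [psum, (h.shift.summable ht).tsum_eq_zero_add, psum, ← tsum_mul_left]
  simp only [shiftCoeff, zero_mul, zero_add, pow_succ]
  exact tsum_congr fun n => by ring

/-- The factor `n + 1` does not change the radius of convergence. -/
lemma SummableAt.succ_mul {c : ℕ → ℂ} {r r' : ℝ} (hr : 0 < r) (hrr : r < r')
    (h : SummableAt c r') : SummableAt (fun n => (n + 1) * c n) r := by
  set x := r' / r - 1 with hx
  have hx0 : 0 < x := by rw [hx, sub_pos, lt_div_iff₀ hr]; linarith
  have hr' : r' = r * (1 + x) := by rw [hx]; field_simp; ring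
  refine Summable.of_nonneg_of_le (fun n => by positivity) (fun n => ?_)
    (Summable.mul_left (1 + 1 / x) h)
  have h1 : (n + 1 : ℝ) ≤ (1 + 1 / x) * (1 + x) ^ n := by
    have h2 : 1 + n * x ≤ (1 + x) ^ n := one_add_mul_le_pow (by linarith) n
    calc (n + 1 : ℝ) ≤ (1 + 1 / x) * (1 + n * x) := by
          have : (1 + 1 / x) * (1 + n * x) = 1 + n * x + 1 / x + n := by field_simp; ring
          rw [this]
          have : 0 ≤ n * x + 1 / x := by positivity
          linarith
      _ ≤ _ := by gcongr
  have h3 : ‖((n : ℂ) + 1) * c n‖ = (n + 1) * ‖c n‖ := by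
    rw [norm_mul]
    congr 1
    exact_mod_cast Complex.norm_natCast (n + 1)
  rw [h3, hr', mul_pow]
  calc (n + 1) * ‖c n‖ * r ^ n ≤ (1 + 1 / x) * (1 + x) ^ n * ‖c n‖ * r ^ n := by gcongr
    _ = _ := by ring

lemma SummableAt.deriv {c : ℕ → ℂ} {r r' : ℝ} (hr : 0 < r) (hrr : r < r')
    (h : SummableAt c r') : SummableAt (derivCoeff c) r := by
  have h1 := (summable_nat_add_iff 1).2 (h.succ_mul hr hrr)
  refine Summable.of_nonneg_of_le (fun n => by positivity) (fun n => ?_)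
    (Summable.mul_left r⁻¹ h1)
  have e : r⁻¹ * (‖(((n + 1 : ℕ) : ℂ) + 1) * c (n + 1)‖ * r ^ (n + 1))
      = ‖(((n + 1 : ℕ) : ℂ) + 1)‖ * ‖c (n + 1)‖ * r ^ n := by
    rw [norm_mul, pow_succ]
    field_simp
  have e1 : ‖(((n + 1 : ℕ) : ℂ) + 1)‖ = n + 1 + 1 := by
    exact_mod_cast Complex.norm_natCast (n + 1 + 1)
  have e2 : ‖((n : ℂ) + 1)‖ = n + 1 := by exact_mod_cast Complex.norm_natCast (n + 1)
  rw [e, derivCoeff, norm_mul, e1, e2]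
  gcongr
  linarith

lemma hasDerivAt_psum {c : ℕ → ℂ} {r r' : ℝ} (hr : 0 < r) (hrr : r < r')
    (h : SummableAt c r') {t : ℂ} (ht : ‖t‖ < r) :
    HasDerivAt (psum c) (psum (derivCoeff c) t) t := by
  have h0 : SummableAt c r := Summable.of_nonneg_of_le (fun n => by positivity)
    (fun n => by gcongr) h
  have hu : Summable fun n : ℕ => ‖c n‖ * (n * r ^ (n - 1)) := by
    refine (summable_nat_add_iff 1).1 ((h.deriv hr hrr).congr fun n => ?_)
    have e2 : ‖((n : ℂ) + 1)‖ = n + 1 := by exact_mod_cast Complex.norm_natCast (n + 1)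
    rw [derivCoeff, norm_mul, e2]
    rw [Nat.add_sub_cancel]
    push_cast
    ring
  have h1 := hasDerivAt_tsum_of_isPreconnected (g := fun n t => c n * t ^ n)
    (g' := fun n t => c n * (n * t ^ (n - 1))) (t := Metric.ball (0 : ℂ) r) (y₀ := t) (y := t)
    hu Metric.isOpen_ball (convex_ball (0 : ℂ) r).isPreconnected
    (fun n y _ => (hasDerivAt_pow n y).const_mul (c n)) (fun n y hy => ?_)
    (by simpa using ht) (h0.summable ht.le) (by simpa using ht)
  · convert! h1 using 1
    have hs : Summable fun n : ℕ => c n * (n * t ^ (n - 1)) := by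
      refine Summable.of_norm_bounded hu fun n => ?_
      rw [norm_mul, norm_mul, norm_pow, Complex.norm_natCast]
      gcongr
    rw [psum, hs.tsum_eq_zero_add]
    simp only [derivCoeff, Nat.cast_zero, zero_mul, mul_zero, zero_add, Nat.add_sub_cancel]
    refine tsum_congr fun n => ?_
    push_cast
    ring
  · rw [mem_ball_zero_iff] at hy
    rw [norm_mul, norm_mul, norm_pow, Complex.norm_natCast]
    gcongr

lemma psum_zero (c : ℕ → ℂ) : psum c 0 = c 0 := by
  rw [psum, tsum_eq_single 0 (fun n hn => by simp [hn])]
  simp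

/-! ### The recurrence for the polynomials `P n` -/

lemma P_zero (p : ℂ × ℂ) : P 0 p = 1 := by simp [P]

lemma P_one (p : ℂ × ℂ) : P 1 p = p.1 := by simp [P]

/-- The recurrence of the Hermite polynomials. The sums defining the three polynomials are extended
by zero to ranges of comparable length and then agree term by term. -/
lemma P_succ_succ (n : ℕ) (p : ℂ × ℂ) :
    P (n + 2) p = p.1 * P (n + 1) p + (n + 1) * p.2 * P n p := by
  -- `T N a b` is the monomial of `P N` with `N = a + 2 b`
  set T : ℕ → ℕ → ℕ → ℂ := fun N a b =>
    (N.factorial : ℂ) * ((p.2 / 2) ^ b * (p.1 ^ a / (b.factorial * a.factorial))) with hT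
  have hP : ∀ N M, N < 2 * M → P N p
      = ∑ b ∈ Finset.range M, if 2 * b ≤ N then T N (N - 2 * b) b else 0 := by
    intro N M hM
    rw [P, Finset.mul_sum, ← Finset.sum_filter]
    refine Finset.sum_congr ?_ fun b _ => rfl
    ext b
    simp only [Finset.mem_range, Finset.mem_filter]
    omega
  rw [hP (n + 2) (n + 3) (by omega), hP (n + 1) (n + 3) (by omega), hP n (n + 2) (by omega),
    Finset.sum_range_succ' _ (n + 2), Finset.sum_range_succ' _ (n + 2), mul_add, Finset.mul_sum,
    Finset.mul_sum, add_right_comm, ← Finset.sum_add_distrib]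
  congr 1
  · refine Finset.sum_congr rfl fun b _ => ?_
    have hb1 : (b.factorial : ℂ) ≠ 0 := by exact_mod_cast b.factorial_ne_zero
    by_cases h1 : 2 * (b + 1) ≤ n + 1
    · obtain ⟨a, ha⟩ := Nat.exists_eq_add_of_le h1
      have e1 : n + 2 - 2 * (b + 1) = a + 1 := by omega
      have e2 : n + 1 - 2 * (b + 1) = a := by omega
      have e3 : n - 2 * b = a + 1 := by omega
      have hn : (n : ℂ) = a + 2 * b + 1 := by
        have : n = a + 2 * b + 1 := by omega
        rw [this]; push_cast; ring
      have ha1 : (a.factorial : ℂ) ≠ 0 := by exact_mod_cast a.factorial_ne_zero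
      have hb2 : ((b : ℂ) + 1) ≠ 0 := by exact_mod_cast b.succ_ne_zero
      have ha2 : ((a : ℂ) + 1) ≠ 0 := by exact_mod_cast a.succ_ne_zero
      rw [if_pos (by omega), if_pos h1, if_pos (by omega), e1, e2, e3]
      simp only [hT, Nat.factorial_succ, pow_succ]
      push_cast
      rw [hn]
      field_simp
      ring
    · by_cases h2 : 2 * (b + 1) ≤ n + 2
      · have e1 : n + 2 - 2 * (b + 1) = 0 := by omega
        have e3 : n - 2 * b = 0 := by omega
        have hn : (n : ℂ) = 2 * b := by
          have : n = 2 * b := by omega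
          rw [this]; push_cast; ring
        have hb2 : ((b : ℂ) + 1) ≠ 0 := by exact_mod_cast b.succ_ne_zero
        rw [if_pos h2, if_neg h1, if_pos (by omega), e1, e3]
        simp only [hT, Nat.factorial_succ, pow_succ]
        push_cast
        rw [hn]
        field_simp
        ring
      · rw [if_neg h2, if_neg h1, if_neg (by omega)]
        ring
  · have hn1 : (n.factorial : ℂ) ≠ 0 := by exact_mod_cast n.factorial_ne_zero
    have hn2 : ((n : ℂ) + 1) ≠ 0 := by exact_mod_cast n.succ_ne_zero
    have hn3 : ((n : ℂ) + 1 + 1) ≠ 0 := by exact_mod_cast (n + 1).succ_ne_zero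
    simp only [hT, Nat.factorial_succ, mul_zero, Nat.zero_le, if_true, Nat.sub_zero, pow_succ]
    push_cast
    field_simp

lemma P_scale (n : ℕ) (s : ℂ) (p : ℂ × ℂ) : P n (s * p.1, s ^ 2 * p.2) = s ^ n * P n p := by
  rw [P, P, mul_left_comm, Finset.mul_sum (a := s ^ n)]
  congr 1
  refine Finset.sum_congr rfl fun b hb => ?_
  have e : s ^ n = s ^ (n - 2 * b) * (s ^ 2) ^ b := by
    rw [← pow_mul, ← pow_add]
    congr 1
    have := Finset.mem_range.1 hb
    omega
  rw [e, mul_div_assoc, mul_pow, mul_pow]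
  ring

/-! ### The reproducing kernel -/

lemma hasSum_kernel {k : ℝ} (hk : 1 ≤ k) {p q : ℂ × ℂ} (hp : p ∈ domain) (hq : q ∈ domain) :
    HasSum (fun i : ℕ × ℕ => basisFun k i.1 i.2 p * basisFun k i.1 i.2 q)
      (kernel k p (conj q.1, conj q.2)) := by
  have h := hasSum_symbol hk (coherent k q) hp
  have e : symbol k (coherent k q) p = kernel k p (conj q.1, conj q.2) := by
    simp [symbol, kernel]
  rw [e] at h
  exact h.congr_fun fun i => by rw [coherent_apply hk hq]

/-- The coefficients `P_n(p) P_n(q) / n!` of Mehler's series. -/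
def mehlerCoeff (p q : ℂ × ℂ) (n : ℕ) : ℂ := P n p * P n q / n.factorial

lemma basisFun_zero_right {k : ℝ} (hk : 1 ≤ k) (n : ℕ) (p : ℂ × ℂ) :
    basisFun k n 0 p = P n p / (√(n.factorial : ℝ) : ℝ) := by
  simp [basisFun, diskMonomial_eq, raisedNorm_zero hk]

lemma sqrt_factorial_mul_self (n : ℕ) :
    ((√(n.factorial : ℝ) : ℝ) : ℂ) * ((√(n.factorial : ℝ) : ℝ) : ℂ) = n.factorial := by
  exact_mod_cast Real.mul_self_sqrt (Nat.cast_nonneg n.factorial)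

lemma summable_mehlerCoeff {p q : ℂ × ℂ} (hp : p ∈ domain) (hq : q ∈ domain) :
    Summable (mehlerCoeff p q) := by
  -- The series does not depend on `k`; it is a part of the series of the kernel for `k = 1`.
  have h := (hasSum_kernel (le_refl (1 : ℝ)) hp hq).summable.comp_injective
    (i := fun n : ℕ => (n, 0)) (fun a b hab => by simpa using hab)
  refine h.congr fun n => ?_
  simp only [Function.comp, basisFun_zero_right le_rfl, mehlerCoeff]
  rw [div_mul_div_comm, sqrt_factorial_mul_self]

/-- The homogeneity of `P n` turns convergence at points of the domain into a radius of convergence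
larger than `1`. -/
lemma summableAt_mehlerCoeff {p q : ℂ × ℂ} {r : ℝ} (hr : 0 ≤ r) (hp : r * ‖p.2‖ < 1)
    (hq : r * ‖q.2‖ < 1) : SummableAt (mehlerCoeff p q) r := by
  have hs : ((√r : ℝ) : ℂ) ^ 2 = r := by exact_mod_cast Real.sq_sqrt hr
  have hd : ∀ x : ℂ × ℂ, r * ‖x.2‖ < 1 →
      (((√r : ℝ) : ℂ) * x.1, ((√r : ℝ) : ℂ) ^ 2 * x.2) ∈ domain := by
    intro x hx
    simpa [domain, hs, abs_of_nonneg hr] using hx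
  refine (summable_mehlerCoeff (hd p hp) (hd q hq)).norm.congr fun n => ?_
  have hs' : ((√r : ℝ) : ℂ) ^ n * ((√r : ℝ) : ℂ) ^ n = (r : ℂ) ^ n := by
    rw [← mul_pow, ← pow_two, hs]
  rw [mehlerCoeff, mehlerCoeff, P_scale, P_scale, mul_mul_mul_comm, hs', mul_div_assoc, norm_mul,
    norm_pow, Complex.norm_real, Real.norm_of_nonneg hr, mul_comm]

/-- The coefficients `P_{n+1}(p) P_n(q) / n!`. -/
def mehlerShift (p q : ℂ × ℂ) (n : ℕ) : ℂ := P (n + 1) p * P n q / n.factorial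

lemma conj_P (n : ℕ) (p : ℂ × ℂ) : conj (P n p) = P n (conj p.1, conj p.2) := by
  simp only [P, map_mul, map_natCast, map_sum, map_pow, map_div₀, map_ofNat]

lemma norm_mehlerCoeff_conj (p : ℂ × ℂ) (n : ℕ) :
    ‖mehlerCoeff p (conj p.1, conj p.2) n‖ = ‖P n p‖ ^ 2 / n.factorial := by
  rw [mehlerCoeff, ← conj_P, norm_div, norm_mul, Complex.norm_conj, Complex.norm_natCast, pow_two]

/-- By the inequality of arithmetic and geometric means this reduces to the diagonal series. -/
lemma summableAt_mehlerShift {p q : ℂ × ℂ} {r r' : ℝ} (hr : 0 < r) (hrr : r < r')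
    (hp : r' * ‖p.2‖ < 1) (hq : r' * ‖q.2‖ < 1) : SummableAt (mehlerShift p q) r := by
  have hr' : 0 < r' := hr.trans hrr
  have h1 := (summableAt_mehlerCoeff (p := p) (q := (conj p.1, conj p.2)) hr'.le hp
    (by simpa using hp)).deriv hr hrr
  have h2 : SummableAt (mehlerCoeff q (conj q.1, conj q.2)) r :=
    summableAt_mehlerCoeff hr.le (by nlinarith [norm_nonneg q.2])
      (by simpa using (by nlinarith [norm_nonneg q.2] : r * ‖q.2‖ < 1))
  refine Summable.of_nonneg_of_le (fun n => by positivity) (fun n => ?_) (Summable.add h1 h2)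
  have hn : (0 : ℝ) < n.factorial := by exact_mod_cast n.factorial_pos
  have e1 : ‖((n : ℂ) + 1)‖ = n + 1 := by exact_mod_cast Complex.norm_natCast (n + 1)
  have e2 : ‖derivCoeff (mehlerCoeff p (conj p.1, conj p.2)) n‖ = ‖P (n + 1) p‖ ^ 2 / n.factorial := by
    rw [derivCoeff, norm_mul, norm_mehlerCoeff_conj, e1, Nat.factorial_succ]
    push_cast
    field_simp
  rw [e2, norm_mehlerCoeff_conj, ← add_mul, mehlerShift, norm_div, norm_mul, Complex.norm_natCast,
    ← add_div]
  gcongr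
  nlinarith [sq_nonneg (‖P (n + 1) p‖ - ‖P n q‖), sq_nonneg ‖P (n + 1) p‖, sq_nonneg ‖P n q‖]

/-- In terms of the power series `S`, `U`, `V` with coefficients `mehlerCoeff p q`,
`mehlerShift p q`, `mehlerShift q p` this is the relation `U = p.1 S + p.2 t V`. -/
lemma mehlerShift_eq (p q : ℂ × ℂ) (n : ℕ) : mehlerShift p q n
    = p.1 * mehlerCoeff p q n + p.2 * shiftCoeff (mehlerShift q p) n := by
  cases n with
  | zero => simp [mehlerShift, mehlerCoeff, shiftCoeff, P_zero, P_one]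
  | succ n =>
    have hn : (n.factorial : ℂ) ≠ 0 := by exact_mod_cast n.factorial_ne_zero
    have hn2 : ((n : ℂ) + 1) ≠ 0 := by exact_mod_cast n.succ_ne_zero
    simp only [mehlerShift, mehlerCoeff, shiftCoeff, P_succ_succ, Nat.factorial_succ]
    push_cast
    field_simp

/-- In terms of the power series `S`, `U`, `V` with coefficients `mehlerCoeff p q`,
`mehlerShift p q`, `mehlerShift q p` this is the relation
`S' = p.1 V + p.2 t (q.1 V + q.2 (S + t S'))`. Together with the relations for `U` and `V` it expresses
`S'` as a multiple of `S`. -/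
lemma derivCoeff_mehlerCoeff (p q : ℂ × ℂ) (n : ℕ) : derivCoeff (mehlerCoeff p q) n
    = p.1 * mehlerShift q p n + p.2 * shiftCoeff (fun n => q.1 * mehlerShift q p n
      + q.2 * (mehlerCoeff p q n + shiftCoeff (derivCoeff (mehlerCoeff p q)) n)) n := by
  cases n with
  | zero => simp [derivCoeff, mehlerShift, mehlerCoeff, shiftCoeff, P_zero, P_one]
  | succ n =>
    have hn : (n.factorial : ℂ) ≠ 0 := by exact_mod_cast n.factorial_ne_zero
    have hn2 : ((n : ℂ) + 1) ≠ 0 := by exact_mod_cast n.succ_ne_zero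
    have hn3 : ((n : ℂ) + 1 + 1) ≠ 0 := by exact_mod_cast (n + 1).succ_ne_zero
    have e : mehlerCoeff p q n + shiftCoeff (derivCoeff (mehlerCoeff p q)) n
        = (n + 1) * mehlerCoeff p q n := by
      cases n with
      | zero => simp [shiftCoeff]
      | succ n =>
        simp only [shiftCoeff, derivCoeff]
        push_cast
        ring
    change derivCoeff (mehlerCoeff p q) (n + 1) = p.1 * mehlerShift q p (n + 1)
      + p.2 * (q.1 * mehlerShift q p n
        + q.2 * (mehlerCoeff p q n + shiftCoeff (derivCoeff (mehlerCoeff p q)) n))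
    rw [e]
    simp only [derivCoeff, mehlerShift, mehlerCoeff, P_succ_succ n,
      Nat.factorial_succ]
    push_cast
    field_simp

lemma one_sub_mem_slitPlane {x : ℂ} (hx : ‖x‖ < 1) : 1 - x ∈ Complex.slitPlane := by
  have h := Complex.mem_slitPlane_of_norm_lt_one (z := -x) (by simpa using hx)
  rwa [← sub_eq_add_neg] at h

lemma exists_radius {p q : ℂ × ℂ} (hp : p ∈ domain) (hq : q ∈ domain) :
    ∃ r : ℝ, 1 < r ∧ r * ‖p.2‖ < 1 ∧ r * ‖q.2‖ < 1 := by
  obtain ⟨δ, h1, h2⟩ := exists_one_lt_mul_lt (r := max ‖p.2‖ ‖q.2‖) (max_lt hp hq)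
    (le_max_of_le_left (norm_nonneg _))
  refine ⟨δ, h1, ?_, ?_⟩
  · nlinarith [le_max_left ‖p.2‖ ‖q.2‖]
  · nlinarith [le_max_right ‖p.2‖ ‖q.2‖]

/-- A function whose logarithmic derivative on a disk is `-L'` is a multiple of `exp (-L)`. -/
lemma eq_exp_neg_of_hasDerivAt {S S' L L' : ℂ → ℂ} {r : ℝ}
    (hS : ∀ t, ‖t‖ < r → HasDerivAt S (S' t) t) (hL : ∀ t, ‖t‖ < r → HasDerivAt L (L' t) t)
    (h : ∀ t, ‖t‖ < r → S' t + S t * L' t = 0) (h0 : S 0 * Complex.exp (L 0) = 1) {t : ℂ}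
    (ht : ‖t‖ < r) : S t = Complex.exp (-L t) := by
  have hG : ∀ t ∈ Metric.ball (0 : ℂ) r,
      HasDerivAt (fun t => S t * Complex.exp (L t)) 0 t := by
    intro t ht
    rw [mem_ball_zero_iff] at ht
    refine ((hS t ht).mul (hL t ht).cexp).congr_deriv ?_
    linear_combination Complex.exp (L t) * h t ht
  have hr : 0 < r := (norm_nonneg t).trans_lt ht
  have hc := Metric.isOpen_ball.is_const_of_deriv_eq_zero (convex_ball (0 : ℂ) r).isPreconnected
    (fun x hx => (hG x hx).differentiableAt.differentiableWithinAt)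
    (fun x hx => (hG x hx).deriv) (mem_ball_zero_iff.2 ht) (Metric.mem_ball_self hr)
  rw [h0] at hc
  rw [Complex.exp_neg]
  exact eq_inv_of_mul_eq_one_left hc

/-- **Mehler's formula** for the polynomials `P n`: the series satisfies a linear differential
equation of the first order in the dilation parameter `t`. -/
lemma tsum_mehlerCoeff {p q : ℂ × ℂ} (hp : p ∈ domain) (hq : q ∈ domain) :
    ∑' n, mehlerCoeff p q n = (1 - p.2 * q.2) ^ (-(1 / 2) : ℂ) *
      Complex.exp ((2 * q.1 * p.1 + p.1 ^ 2 * q.2 + q.1 ^ 2 * p.2) / (2 * (1 - p.2 * q.2))) := by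
  obtain ⟨r', h1, h2, h3⟩ := exists_radius hp hq
  obtain ⟨r, hr, hrr⟩ := exists_between h1
  have hr0 : 0 < r := by linarith
  set c := mehlerCoeff p q with hc
  set x := p.2 * q.2 with hx
  have hp2 : ‖p.2‖ < 1 := hp
  have hq2 : ‖q.2‖ < 1 := hq
  have hcs : SummableAt c r := summableAt_mehlerCoeff hr0.le (by nlinarith [norm_nonneg p.2])
    (by nlinarith [norm_nonneg q.2])
  have hcs' : SummableAt c r' := summableAt_mehlerCoeff (by linarith) h2 h3
  have hds : SummableAt (derivCoeff c) r := hcs'.deriv hr0 hrr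
  have hus : SummableAt (mehlerShift p q) r := summableAt_mehlerShift hr0 hrr h2 h3
  have hvs : SummableAt (mehlerShift q p) r := summableAt_mehlerShift hr0 hrr h3 h2
  have hsymm : mehlerCoeff q p = c := by
    funext n
    rw [hc, mehlerCoeff, mehlerCoeff, mul_comm (P n p)]
  have hU : ∀ t : ℂ, ‖t‖ ≤ r → psum (mehlerShift p q) t
      = p.1 * psum c t + p.2 * (t * psum (mehlerShift q p) t) := by
    intro t ht
    rw [← psum_shift hvs ht, ← psum_const_mul, ← psum_const_mul,
      ← psum_add (hcs.const_mul _) (hvs.shift.const_mul _) ht]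
    exact congrArg (psum · t) (funext (mehlerShift_eq p q))
  have hV : ∀ t : ℂ, ‖t‖ ≤ r → psum (mehlerShift q p) t
      = q.1 * psum c t + q.2 * (t * psum (mehlerShift p q) t) := by
    intro t ht
    rw [← psum_shift hus ht, ← psum_const_mul, ← psum_const_mul,
      ← psum_add (hcs.const_mul _) (hus.shift.const_mul _) ht, ← hsymm]
    exact congrArg (psum · t) (funext (mehlerShift_eq q p))
  have hD : ∀ t : ℂ, ‖t‖ ≤ r → psum (derivCoeff c) t
      = p.1 * psum (mehlerShift q p) t + p.2 * (t * (q.1 * psum (mehlerShift q p) t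
        + q.2 * (psum c t + t * psum (derivCoeff c) t))) := by
    intro t ht
    rw [← psum_shift hds ht, ← psum_add hcs hds.shift ht, ← psum_const_mul, ← psum_const_mul,
      ← psum_const_mul, ← psum_add (hvs.const_mul _) ((hcs.add hr0.le hds.shift).const_mul _) ht,
      ← psum_shift ((hvs.const_mul _).add hr0.le ((hcs.add hr0.le hds.shift).const_mul _)) ht,
      ← psum_const_mul, ← psum_add (hvs.const_mul _) (SummableAt.const_mul (SummableAt.shift
        ((hvs.const_mul _).add hr0.le ((hcs.add hr0.le hds.shift).const_mul _))) _) ht]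
    exact congrArg (psum · t) (funext (derivCoeff_mehlerCoeff p q))
  -- `1 - x t²` stays in the right half plane, where the logarithm is holomorphic
  set r₁ := min r (√r') with hr1
  have hr1' : 1 < r₁ := lt_min hr (by rw [Real.lt_sqrt (by norm_num)]; simpa using h1)
  have hslit : ∀ t : ℂ, ‖t‖ < r₁ → 1 - x * t ^ 2 ∈ Complex.slitPlane := by
    intro t ht
    refine one_sub_mem_slitPlane ?_
    have h4 : ‖t‖ ^ 2 ≤ r' := by
      have h5 : ‖t‖ < √r' := ht.trans_le (min_le_right _ _)
      rw [← Real.sq_sqrt (by linarith : 0 ≤ r')]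
      gcongr
    rw [hx, norm_mul, norm_mul, norm_pow]
    calc ‖p.2‖ * ‖q.2‖ * ‖t‖ ^ 2 ≤ ‖p.2‖ * 1 * r' := by gcongr
      _ < 1 := by linarith
  set N : ℂ → ℂ := fun t => 2 * t * (q.1 * p.1) + t ^ 2 * (p.1 ^ 2 * q.2 + q.1 ^ 2 * p.2) with hN
  have hL : ∀ t : ℂ, ‖t‖ < r₁ → HasDerivAt
      (fun t => (1 / 2) * Complex.log (1 - x * t ^ 2) - N t / (2 * (1 - x * t ^ 2)))
      ((1 / 2) * (-(x * (2 * t)) / (1 - x * t ^ 2))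
        - ((2 * (q.1 * p.1) + 2 * t * (p.1 ^ 2 * q.2 + q.1 ^ 2 * p.2)) * (2 * (1 - x * t ^ 2))
          - N t * (2 * (-(x * (2 * t))))) / (2 * (1 - x * t ^ 2)) ^ 2) t := by
    intro t ht
    have hne := Complex.slitPlane_ne_zero (hslit t ht)
    have hsq : HasDerivAt (fun t : ℂ => t ^ 2) (2 * t) t := by simpa using hasDerivAt_pow 2 t
    have hh : HasDerivAt (fun t => 1 - x * t ^ 2) (-(x * (2 * t))) t := by
      exact (hsq.const_mul x).const_sub 1
    have hNd : HasDerivAt N (2 * (q.1 * p.1) + 2 * t * (p.1 ^ 2 * q.2 + q.1 ^ 2 * p.2)) t := by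
      refine ((((hasDerivAt_id t).const_mul 2).mul_const (q.1 * p.1)).add
        (hsq.mul_const (p.1 ^ 2 * q.2 + q.1 ^ 2 * p.2))).congr_deriv ?_
      simp
    exact ((hh.clog (hslit t ht)).const_mul _).sub (hNd.div (hh.const_mul 2) (by simpa using hne))
  have hS : ∀ t : ℂ, ‖t‖ < r₁ → HasDerivAt (psum c) (psum (derivCoeff c) t) t := fun t ht =>
    hasDerivAt_psum hr0 hrr hcs' (ht.trans_le (min_le_left _ _))
  have key := eq_exp_neg_of_hasDerivAt hS hL ?_ ?_ (t := 1) (by simpa using hr1')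
  · have e1 : psum c 1 = ∑' n, c n := by simp [psum]
    have hx1 := hslit 1 (by simpa using hr1')
    rw [one_pow, mul_one] at hx1
    rw [e1] at key
    rw [key, Complex.cpow_def_of_ne_zero (Complex.slitPlane_ne_zero hx1), ← Complex.exp_add]
    congr 1
    simp only [hN, one_pow, mul_one, one_mul]
    ring
  · intro t ht
    have ht' : ‖t‖ ≤ r := (ht.trans_le (min_le_left _ _)).le
    have hne := Complex.slitPlane_ne_zero (hslit t ht)
    have e1 := hU t ht'
    have e2 := hV t ht'
    have e3 := hD t ht'
    set S := psum c t
    set U := psum (mehlerShift p q) t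
    set V := psum (mehlerShift q p) t
    set D := psum (derivCoeff c) t
    have e4 : V = (q.1 + q.2 * t * p.1) * S / (1 - x * t ^ 2) := by
      rw [eq_div_iff hne, hx]
      linear_combination e2 + q.2 * t * e1
    have e5 : D = ((p.1 + p.2 * t * q.1) * V + x * t * S) / (1 - x * t ^ 2) := by
      rw [eq_div_iff hne, hx]
      linear_combination e3
    rw [e5, e4]
    obtain ⟨y, hy⟩ : ∃ y, y = 1 - x * t ^ 2 := ⟨_, rfl⟩
    rw [← hy] at hne ⊢
    field_simp
    simp only [hN, hy, hx]
    ring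
  · rw [psum_zero]
    simp [hc, hN, mehlerCoeff, P_zero]

/-- The binomial series with exponent `-2k'`. -/
lemma tsum_binomial {k : ℝ} (hk : 1 ≤ k) {x : ℂ} (hx : ‖x‖ < 1) :
    ∑' m : ℕ, (((raisedNorm k m / m.factorial) ^ 2 : ℝ) : ℂ) * x ^ m
      = (1 - x) ^ (-(2 * kPrime k : ℝ) : ℂ) := by
  set g : ℕ → ℂ := fun m => (((raisedNorm k m / m.factorial) ^ 2 : ℝ) : ℂ) with hg
  have hrec : ∀ m, derivCoeff g m = (2 * kPrime k : ℝ) * g m + shiftCoeff (derivCoeff g) m := by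
    intro m
    have h1 : derivCoeff g m = (((m : ℝ) + 2 * kPrime k : ℝ) : ℂ) * g m := by
      have hs := two_kPrime_pos hk
      have h2 : (raisedNorm k (m + 1) / (m + 1).factorial) ^ 2
          = (raisedNorm k m / m.factorial) ^ 2 * ((m + 2 * kPrime k) / (m + 1)) := by
        rw [raisedNorm_succ hk, div_pow, mul_pow, Real.sq_sqrt (by positivity), Nat.factorial_succ]
        push_cast
        field_simp
      rw [derivCoeff, hg]
      dsimp only
      rw [h2]
      have h3 : ((m : ℂ) + 1) ≠ 0 := by exact_mod_cast m.succ_ne_zero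
      push_cast
      field_simp
    cases m with
    | zero => simp [h1, shiftCoeff]
    | succ m =>
      rw [h1, shiftCoeff, derivCoeff]
      push_cast
      ring
  have hsum : ∀ r : ℝ, 0 ≤ r → r < 1 → SummableAt g r := by
    intro r hr0 hr1
    have hd : ((0, ((√r : ℝ) : ℂ)) : ℂ × ℂ) ∈ domain := by
      rw [domain, Set.mem_ofPred_eq, Complex.norm_real, Real.norm_of_nonneg (Real.sqrt_nonneg _)]
      rw [Real.sqrt_lt' one_pos]
      simpa using hr1
    have h := (hasSum_kernel hk hd hd).summable.comp_injective
      (i := fun m : ℕ => (0, m)) (fun a b hab => by simpa using hab)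
    refine h.norm.congr fun m => ?_
    have hs : ((√r : ℝ) : ℂ) ^ m * ((√r : ℝ) : ℂ) ^ m = (r : ℂ) ^ m := by
      rw [← mul_pow]
      congr 1
      exact_mod_cast Real.mul_self_sqrt hr0
    simp only [Function.comp, basisFun, P_zero, diskMonomial_eq]
    rw [show ∀ a b : ℂ, a * b * (1 / ((√((0 : ℕ).factorial : ℝ) : ℝ) : ℂ)) * (a * b
      * (1 / ((√((0 : ℕ).factorial : ℝ) : ℝ) : ℂ))) = a ^ 2 * (b * b) by intro a b; simp; ring, hs,
      norm_mul]
    simp [hg, abs_of_nonneg hr0]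
  obtain ⟨r', hr1, hr2⟩ := exists_between hx
  obtain ⟨r, hr3, hr4⟩ := exists_between hr1
  have hr0 : 0 < r := (norm_nonneg x).trans_lt hr3
  have hcs' := hsum r' (by linarith) hr2
  have hcs := hsum r hr0.le (by linarith)
  have hds := hcs'.deriv hr0 hr4
  have hslit : ∀ t : ℂ, ‖t‖ < r → 1 - t ∈ Complex.slitPlane := fun t ht =>
    one_sub_mem_slitPlane (by linarith)
  have key := eq_exp_neg_of_hasDerivAt (S := psum g) (S' := psum (derivCoeff g))
    (L := fun t => (2 * kPrime k : ℝ) * Complex.log (1 - t))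
    (L' := fun t => (2 * kPrime k : ℝ) * (-1 / (1 - t)))
    (fun t ht => hasDerivAt_psum hr0 hr4 hcs' ht)
    (fun t ht => ((((hasDerivAt_id t).const_sub 1).clog (hslit t ht)).const_mul _)) ?_ ?_ hr3
  · rw [psum] at key
    rw [key, Complex.cpow_def_of_ne_zero (Complex.slitPlane_ne_zero (hslit x hr3))]
    congr 1
    push_cast
    ring
  · intro t ht
    have hne := Complex.slitPlane_ne_zero (hslit t ht)
    have e : psum (derivCoeff g) t = (2 * kPrime k : ℝ) * psum g t + t * psum (derivCoeff g) t := by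
      rw [← psum_shift hds ht.le, ← psum_const_mul, ← psum_add (hcs.const_mul _) hds.shift ht.le]
      exact congrArg (psum · t) (funext hrec)
    have e' : psum (derivCoeff g) t = (2 * kPrime k : ℝ) * psum g t / (1 - t) := by
      rw [eq_div_iff hne]
      linear_combination e
    rw [e']
    ring
  · rw [psum_zero]
    simp [hg, raisedNorm_zero hk]

/-- The kernel as a function holomorphic in both arguments. -/
lemma kernel_eq_aux {k : ℝ} (hk : 1 ≤ k) {p q : ℂ × ℂ} (hp : p ∈ domain) (hq : q ∈ domain) :
    kernel k p (conj q.1, conj q.2) = (1 - p.2 * q.2) ^ ((-(2 * k) : ℝ) : ℂ) *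
      Complex.exp ((2 * q.1 * p.1 + p.1 ^ 2 * q.2 + q.1 ^ 2 * p.2) / (2 * (1 - p.2 * q.2))) := by
  have hx : ‖p.2 * q.2‖ < 1 := by
    rw [norm_mul]
    have h1 : ‖p.2‖ < 1 := hp
    have h2 : ‖q.2‖ < 1 := hq
    nlinarith [norm_nonneg p.2, norm_nonneg q.2]
  have hK := hasSum_kernel hk hp hq
  have e : ∀ i : ℕ × ℕ, basisFun k i.1 i.2 p * basisFun k i.1 i.2 q
      = mehlerCoeff p q i.1
        * ((((raisedNorm k i.2 / i.2.factorial) ^ 2 : ℝ) : ℂ) * (p.2 * q.2) ^ i.2) := by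
    intro i
    rw [basisFun, basisFun, diskMonomial_eq, diskMonomial_eq, mehlerCoeff,
      ← sqrt_factorial_mul_self, mul_pow]
    push_cast
    ring
  have h1 : Summable fun i : ℕ × ℕ => mehlerCoeff p q i.1
        * ((((raisedNorm k i.2 / i.2.factorial) ^ 2 : ℝ) : ℂ) * (p.2 * q.2) ^ i.2) :=
    hK.summable.congr e
  have h2 : Summable fun m : ℕ =>
      (((raisedNorm k m / m.factorial) ^ 2 : ℝ) : ℂ) * (p.2 * q.2) ^ m := by
    refine (h1.comp_injective (i := fun m : ℕ => (0, m)) (fun a b hab => by simpa using hab)).congr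
      fun m => ?_
    simp [Function.comp, mehlerCoeff, P_zero]
  have h3 := (summable_mehlerCoeff hp hq).hasSum.mul h2.hasSum h1
  rw [(hK.congr_fun fun i => (e i).symm).unique h3, tsum_mehlerCoeff hp hq, tsum_binomial hk hx,
    mul_right_comm, ← Complex.cpow_add _ _ (Complex.slitPlane_ne_zero (one_sub_mem_slitPlane hx))]
  congr 2
  rw [kPrime]
  push_cast
  ring

lemma kernel_eq {k : ℝ} (hk : 1 ≤ k) {p q : ℂ × ℂ} (hp : p ∈ domain) (hq : q ∈ domain) :
    kernel k p q = (1 - p.2 * conj q.2) ^ ((-(2 * k) : ℝ) : ℂ) *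
      Complex.exp ((2 * conj q.1 * p.1 + p.1 ^ 2 * conj q.2 + conj q.1 ^ 2 * p.2) /
        (2 * (1 - p.2 * conj q.2))) := by
  have h := kernel_eq_aux hk hp (conj_mem_domain hq)
  simpa using h

/-! ### The Kähler potential -/

lemma mul_conj_eq (z : ℂ) : z * conj z = ((‖z‖ ^ 2 : ℝ) : ℂ) := by
  rw [Complex.mul_conj, Complex.normSq_eq_norm_sq]

lemma one_sub_mul_conj (p : ℂ × ℂ) : 1 - p.2 * conj p.2 = ((1 - ‖p.2‖ ^ 2 : ℝ) : ℂ) := by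
  rw [mul_conj_eq]
  push_cast
  rfl

lemma one_sub_mul_conj_ne_zero {p : ℂ × ℂ} (hp : p ∈ domain) : 1 - p.2 * conj p.2 ≠ 0 := by
  rw [one_sub_mul_conj]
  exact_mod_cast (sub_pos.2 (normSq_lt_one hp)).ne'

lemma sq_mul_conj_add_eq (p : ℂ × ℂ) : p.1 ^ 2 * conj p.2 + conj p.1 ^ 2 * p.2
    = ((2 * (p.1 ^ 2 * conj p.2).re : ℝ) : ℂ) := by
  have h := Complex.add_conj (p.1 ^ 2 * conj p.2)
  rw [map_mul, map_pow, Complex.conj_conj] at h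
  exact h

lemma numerator_eq (p : ℂ × ℂ) : 2 * p.1 * conj p.1 + p.1 ^ 2 * conj p.2 + conj p.1 ^ 2 * p.2
    = ((2 * ‖p.1‖ ^ 2 + 2 * (p.1 ^ 2 * conj p.2).re : ℝ) : ℂ) := by
  rw [add_assoc, sq_mul_conj_add_eq, mul_assoc, mul_conj_eq]
  push_cast
  rfl

lemma ofReal_explicit (k : ℝ) {p : ℂ × ℂ} (hp : p ∈ domain) :
    (((2 * ‖p.1‖ ^ 2 + 2 * (p.1 ^ 2 * conj p.2).re) / (2 * (1 - ‖p.2‖ ^ 2))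
        - 2 * k * Real.log (1 - ‖p.2‖ ^ 2) : ℝ) : ℂ)
      = (2 * p.1 * conj p.1 + p.1 ^ 2 * conj p.2 + conj p.1 ^ 2 * p.2) / (2 * (1 - p.2 * conj p.2))
        - 2 * k * Complex.log (1 - p.2 * conj p.2) := by
  rw [numerator_eq, one_sub_mul_conj, ← Complex.ofReal_log (sub_pos.2 (normSq_lt_one hp)).le]
  push_cast
  rfl

lemma kernel_self {k : ℝ} (hk : 1 ≤ k) {p : ℂ × ℂ} (hp : p ∈ domain) :
    kernel k p p = (Real.exp ((2 * ‖p.1‖ ^ 2 + 2 * (p.1 ^ 2 * conj p.2).re) / (2 * (1 - ‖p.2‖ ^ 2))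
        - 2 * k * Real.log (1 - ‖p.2‖ ^ 2)) : ℂ) := by
  rw [Complex.ofReal_exp, ofReal_explicit k hp, kernel_eq hk hp hp,
    Complex.cpow_def_of_ne_zero (one_sub_mul_conj_ne_zero hp), ← Complex.exp_add]
  congr 1
  rw [show 2 * conj p.1 * p.1 = 2 * p.1 * conj p.1 by ring]
  push_cast
  ring

lemma potential_eq {k : ℝ} (hk : 1 ≤ k) {p : ℂ × ℂ} (hp : p ∈ domain) :
    potential k p = (2 * ‖p.1‖ ^ 2 + 2 * (p.1 ^ 2 * conj p.2).re) / (2 * (1 - ‖p.2‖ ^ 2))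
        - 2 * k * Real.log (1 - ‖p.2‖ ^ 2) := by
  rw [potential, kernel_self hk hp, Complex.ofReal_re, Real.log_exp]

lemma ofReal_potential {k : ℝ} (hk : 1 ≤ k) {p : ℂ × ℂ} (hp : p ∈ domain) : (potential k p : ℂ)
    = (2 * p.1 * conj p.1 + p.1 ^ 2 * conj p.2 + conj p.1 ^ 2 * p.2) / (2 * (1 - p.2 * conj p.2))
        - 2 * k * Complex.log (1 - p.2 * conj p.2) := by
  rw [potential_eq hk hp, ofReal_explicit k hp]

lemma kernel_self_eq_exp_potential {k : ℝ} (hk : 1 ≤ k) {p : ℂ × ℂ} (hp : p ∈ domain) :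
    kernel k p p = (Real.exp (potential k p) : ℂ) := by
  rw [kernel_self hk hp, potential_eq hk hp]

lemma contDiffOn_potential {k : ℝ} (hk : 1 ≤ k) : ContDiffOn ℝ (⊤ : ℕ∞) (potential k) domain := by
  refine ContDiffOn.congr ?_ fun p hp => potential_eq hk hp
  have h1 : ContDiff ℝ (⊤ : ℕ∞) fun p : ℂ × ℂ => ‖p.1‖ ^ 2 := contDiff_fst.norm_sq ℝ
  have h2 : ContDiff ℝ (⊤ : ℕ∞) fun p : ℂ × ℂ => ‖p.2‖ ^ 2 := contDiff_snd.norm_sq ℝ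
  have h3 : ContDiff ℝ (⊤ : ℕ∞) fun p : ℂ × ℂ => (p.1 ^ 2 * conj p.2).re :=
    Complex.reCLM.contDiff.comp
      ((contDiff_fst.pow 2).mul (Complex.conjCLE.contDiff.comp contDiff_snd))
  have h4 : ContDiff ℝ (⊤ : ℕ∞) fun p : ℂ × ℂ => 1 - ‖p.2‖ ^ 2 := contDiff_const.sub h2
  have h0 : ∀ p ∈ domain, 1 - ‖p.2‖ ^ 2 ≠ 0 := fun p hp => (sub_pos.2 (normSq_lt_one hp)).ne'
  refine ContDiffOn.sub (ContDiffOn.div ?_ ?_ ?_) ?_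
  · exact ((contDiff_const.mul h1).add (contDiff_const.mul h3)).contDiffOn
  · exact (contDiff_const.mul h4).contDiffOn
  · exact fun p hp => mul_ne_zero two_ne_zero (h0 p hp)
  · exact contDiffOn_const.mul (h4.contDiffOn.log h0)

/-! ### Wirtinger calculus -/

/-- The one-form `a₀ dz + a₁ dw + b₀ d(conj z) + b₁ d(conj w)`. -/
def wirtForm (a₀ a₁ b₀ b₁ : ℂ) : ℂ × ℂ →L[ℝ] ℂ :=
  a₀ • dcoord 0 + a₁ • dcoord 1 + b₀ • conjForm (dcoord 0) + b₁ • conjForm (dcoord 1)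

lemma wirtForm_apply (a₀ a₁ b₀ b₁ : ℂ) (v : ℂ × ℂ) :
    wirtForm a₀ a₁ b₀ b₁ v = a₀ * v.1 + a₁ * v.2 + b₀ * conj v.1 + b₁ * conj v.2 := by
  simp [wirtForm, dcoord, conjForm]

lemma dHol_eq {F : ℂ × ℂ → ℂ} {p : ℂ × ℂ} {a₀ a₁ b₀ b₁ : ℂ}
    (h : HasFDerivAt F (wirtForm a₀ a₁ b₀ b₁) p) (i : Fin 2) : dHol i F p = ![a₀, a₁] i := by
  rw [dHol, h.fderiv, wirtForm_apply, wirtForm_apply]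
  fin_cases i <;> simp [coordVec] <;> ring_nf <;> rw [Complex.I_sq] <;> ring

lemma dAntiHol_eq {F : ℂ × ℂ → ℂ} {p : ℂ × ℂ} {a₀ a₁ b₀ b₁ : ℂ}
    (h : HasFDerivAt F (wirtForm a₀ a₁ b₀ b₁) p) (i : Fin 2) : dAntiHol i F p = ![b₀, b₁] i := by
  rw [dAntiHol, h.fderiv, wirtForm_apply, wirtForm_apply]
  fin_cases i <;> simp [coordVec] <;> ring_nf <;> rw [Complex.I_sq] <;> ring

lemma dHol_congr {F G : ℂ × ℂ → ℂ} {p : ℂ × ℂ} (h : F =ᶠ[nhds p] G) (i : Fin 2) :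
    dHol i F p = dHol i G p := by
  rw [dHol, dHol, h.fderiv_eq]

lemma hasFDerivAt_z (p : ℂ × ℂ) : HasFDerivAt (fun q : ℂ × ℂ => q.1) (dcoord 0) p :=
  (ContinuousLinearMap.fst ℝ ℂ ℂ).hasFDerivAt

lemma hasFDerivAt_w (p : ℂ × ℂ) : HasFDerivAt (fun q : ℂ × ℂ => q.2) (dcoord 1) p :=
  (ContinuousLinearMap.snd ℝ ℂ ℂ).hasFDerivAt

lemma hasFDerivAt_conj_z (p : ℂ × ℂ) :
    HasFDerivAt (fun q : ℂ × ℂ => conj q.1) (conjForm (dcoord 0)) p :=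
  (conjForm (dcoord 0)).hasFDerivAt

lemma hasFDerivAt_conj_w (p : ℂ × ℂ) :
    HasFDerivAt (fun q : ℂ × ℂ => conj q.2) (conjForm (dcoord 1)) p :=
  (conjForm (dcoord 1)).hasFDerivAt

lemma hasFDerivAt_conj {F : ℂ × ℂ → ℂ} {p : ℂ × ℂ} {a₀ a₁ b₀ b₁ : ℂ}
    (h : HasFDerivAt F (wirtForm a₀ a₁ b₀ b₁) p) :
    HasFDerivAt (fun q => conj (F q)) (wirtForm (conj b₀) (conj b₁) (conj a₀) (conj a₁)) p := by
  have h1 := (Complex.conjCLE.toContinuousLinearMap.hasFDerivAt (x := F p)).comp p h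
  refine h1.congr_fderiv (ContinuousLinearMap.ext fun v => ?_)
  simp [wirtForm_apply]
  ring

/-- The function `1 - |w|²`. -/
def defect (p : ℂ × ℂ) : ℂ := 1 - p.2 * conj p.2

lemma conj_defect (p : ℂ × ℂ) : conj (defect p) = defect p := by
  simp [defect, mul_comm]

lemma defect_ne_zero {p : ℂ × ℂ} (hp : p ∈ domain) : defect p ≠ 0 := one_sub_mul_conj_ne_zero hp

lemma hasFDerivAt_defect (p : ℂ × ℂ) :
    HasFDerivAt defect (wirtForm 0 (-conj p.2) 0 (-p.2)) p := by
  refine (((hasFDerivAt_w p).mul (hasFDerivAt_conj_w p)).const_sub 1).congr_fderiv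
    (ContinuousLinearMap.ext fun v => ?_)
  simp [wirtForm_apply, dcoord, conjForm]

lemma hasFDerivAt_inv_defect {p : ℂ × ℂ} (hp : p ∈ domain) :
    HasFDerivAt (fun q => (defect q)⁻¹)
      (wirtForm 0 (conj p.2 / defect p ^ 2) 0 (p.2 / defect p ^ 2)) p := by
  refine ((hasDerivAt_inv (defect_ne_zero hp)).comp_hasFDerivAt p
    (hasFDerivAt_defect p)).congr_fderiv (ContinuousLinearMap.ext fun v => ?_)
  simp [wirtForm_apply]
  ring

lemma α₀_eq (p : ℂ × ℂ) : α₀ p = (p.1 + conj p.1 * p.2) * (defect p)⁻¹ := div_eq_mul_inv _ _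

lemma conj_α₀ (p : ℂ × ℂ) : conj (α₀ p) = (conj p.1 + p.1 * conj p.2) * (defect p)⁻¹ := by
  rw [α₀_eq, map_mul, map_inv₀, conj_defect]
  simp

lemma hasFDerivAt_α₀ {p : ℂ × ℂ} (hp : p ∈ domain) : HasFDerivAt α₀
    (wirtForm (defect p)⁻¹ (conj (α₀ p) * (defect p)⁻¹) (p.2 * (defect p)⁻¹)
      (α₀ p * p.2 * (defect p)⁻¹)) p := by
  have hd := defect_ne_zero hp
  have h := ((hasFDerivAt_z p).add ((hasFDerivAt_conj_z p).mul (hasFDerivAt_w p))).mul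
    (hasFDerivAt_inv_defect hp)
  refine (h.congr_fderiv (ContinuousLinearMap.ext fun v => ?_)).congr_of_eventuallyEq
    (Filter.Eventually.of_forall α₀_eq)
  rw [conj_α₀, α₀_eq]
  simp [wirtForm_apply, dcoord, conjForm]
  field_simp
  simp only [defect]
  ring

lemma hasFDerivAt_potential {k : ℝ} (hk : 1 ≤ k) {p : ℂ × ℂ} (hp : p ∈ domain) :
    HasFDerivAt (fun q => (potential k q : ℂ))
      (wirtForm (conj (α₀ p)) (conj (α₀ p) ^ 2 / 2 + 2 * k * (conj p.2 * (defect p)⁻¹))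
        (α₀ p) (α₀ p ^ 2 / 2 + 2 * k * (p.2 * (defect p)⁻¹))) p := by
  have hd := defect_ne_zero hp
  have hslit : defect p ∈ Complex.slitPlane := by
    rw [defect, one_sub_mul_conj]
    exact Complex.ofReal_mem_slitPlane.2 (sub_pos.2 (normSq_lt_one hp))
  have hz := hasFDerivAt_z p
  have hzc := hasFDerivAt_conj_z p
  have hN := ((hz.const_mul 2).mul hzc).add
    (((hz.mul hz).mul (hasFDerivAt_conj_w p)).add ((hzc.mul hzc).mul (hasFDerivAt_w p)))
  have h := ((hN.mul (hasFDerivAt_inv_defect hp)).const_mul (1 / 2)).sub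
    (((Complex.hasDerivAt_log hslit).comp_hasFDerivAt p (hasFDerivAt_defect p)).const_mul (2 * k : ℂ))
  refine (h.congr_fderiv (ContinuousLinearMap.ext fun v => ?_)).congr_of_eventuallyEq ?_
  · rw [conj_α₀, α₀_eq]
    simp [wirtForm_apply, dcoord, conjForm]
    field_simp
    simp only [defect]
    ring
  · filter_upwards [isOpen_domain.mem_nhds hp] with q hq
    have hq' := defect_ne_zero hq
    rw [ofReal_potential hk hq]
    change _ / (2 * defect q) - 2 * k * Complex.log (defect q) = _
    simp only [Pi.mul_apply, Pi.add_apply, Pi.sub_apply, Function.comp]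
    field_simp
    ring

lemma dAntiHol_potential {k : ℝ} (hk : 1 ≤ k) {p : ℂ × ℂ} (hp : p ∈ domain) (j : Fin 2) :
    (dAntiHol j fun q => (potential k q : ℂ)) =ᶠ[nhds p]
      ![α₀, fun q => α₀ q ^ 2 / 2 + 2 * k * (q.2 * (defect q)⁻¹)] j := by
  filter_upwards [isOpen_domain.mem_nhds hp] with q hq
  rw [dAntiHol_eq (hasFDerivAt_potential hk hq)]
  fin_cases j <;> rfl

lemma metric_eq {k : ℝ} (hk : 1 ≤ k) {p : ℂ × ℂ} (hp : p ∈ domain) :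
    metric k p = !![(defect p)⁻¹, α₀ p * (defect p)⁻¹; conj (α₀ p) * (defect p)⁻¹,
      α₀ p * conj (α₀ p) * (defect p)⁻¹ + 2 * k * ((defect p)⁻¹ * (defect p)⁻¹)] := by
  have hd := defect_ne_zero hp
  have h0 := hasFDerivAt_α₀ hp
  have h1 : HasFDerivAt (fun q => α₀ q ^ 2 / 2 + 2 * k * (q.2 * (defect q)⁻¹))
      (wirtForm (α₀ p * (defect p)⁻¹)
        (α₀ p * conj (α₀ p) * (defect p)⁻¹ + 2 * k * ((defect p)⁻¹ * (defect p)⁻¹))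
        (α₀ p * (p.2 * (defect p)⁻¹))
        (α₀ p * (α₀ p * p.2 * (defect p)⁻¹) + 2 * k * (p.2 * (p.2 / defect p ^ 2)))) p := by
    have h2 := ((h0.mul h0).const_mul (1 / 2)).add
      (((hasFDerivAt_w p).mul (hasFDerivAt_inv_defect hp)).const_mul (2 * k : ℂ))
    refine (h2.congr_fderiv (ContinuousLinearMap.ext fun v => ?_)).congr_of_eventuallyEq
      (Filter.Eventually.of_forall fun q => ?_)
    · simp [wirtForm_apply, dcoord]
      generalize α₀ p = α
      field_simp
      simp only [defect]
      ring
    · simp only [Pi.mul_apply, Pi.add_apply]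
      ring
  ext i j
  rw [metric, Matrix.of_apply, dHol_congr (dAntiHol_potential hk hp j)]
  fin_cases j
  · exact (dHol_eq h0 i).trans (by fin_cases i <;> rfl)
  · exact (dHol_eq h1 i).trans (by fin_cases i <;> rfl)

lemma metric_posDef {k : ℝ} (hk : 1 ≤ k) {p : ℂ × ℂ} (hp : p ∈ domain) : (metric k p).PosDef := by
  have hP : 0 < 1 - ‖p.2‖ ^ 2 := sub_pos.2 (normSq_lt_one hp)
  have hd : defect p = ((1 - ‖p.2‖ ^ 2 : ℝ) : ℂ) := one_sub_mul_conj p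
  rw [metric_eq hk hp]
  refine Matrix.PosDef.of_dotProduct_mulVec_pos ?_ fun x hx => ?_
  · ext i j
    fin_cases i <;> fin_cases j <;> simp [Matrix.conjTranspose_apply, conj_defect, mul_comm]
  -- The quadratic form is a sum of squares because `A` occurs as a square in the Kähler form.
  · have e : star x ⬝ᵥ (!![(defect p)⁻¹, α₀ p * (defect p)⁻¹; conj (α₀ p) * (defect p)⁻¹,
      α₀ p * conj (α₀ p) * (defect p)⁻¹ + 2 * k * ((defect p)⁻¹ * (defect p)⁻¹)].mulVec x)
      = (((1 - ‖p.2‖ ^ 2)⁻¹ * ‖x 0 + α₀ p * x 1‖ ^ 2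
        + 2 * k * ((1 - ‖p.2‖ ^ 2)⁻¹ * (1 - ‖p.2‖ ^ 2)⁻¹) * ‖x 1‖ ^ 2 : ℝ) : ℂ) := by
      simp only [dotProduct, Matrix.mulVec, Fin.sum_univ_two, Complex.ofReal_add,
        Complex.ofReal_mul, ← mul_conj_eq, hd]
      simp
      ring
    rw [e]
    refine Complex.zero_lt_real.2 ?_
    by_cases h1 : x 1 = 0
    · have h0 : x 0 ≠ 0 := by
        intro h0
        apply hx
        ext i
        fin_cases i <;> simp [h0, h1]
      have : 0 < ‖x 0 + α₀ p * x 1‖ := by simpa [h1] using h0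
      positivity
    · have : 0 < ‖x 1‖ := norm_pos_iff.2 h1
      positivity

/-! ### The Kähler form -/

lemma wedge_apply (η ζ : ℂ × ℂ →L[ℝ] ℂ) (v : Fin 2 → ℂ × ℂ) :
    wedge η ζ v = η (v 0) * ζ (v 1) - η (v 1) * ζ (v 0) := rfl

lemma kahlerForm_eq {k : ℝ} (hk : 1 ≤ k) {p : ℂ × ℂ} (hp : p ∈ domain) :
    kahlerForm k p = Complex.I • ((2 * k / (1 - p.2 * conj p.2) ^ 2 : ℂ) •
        wedge (dcoord 1) (conjForm (dcoord 1)) +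
        (1 / (1 - p.2 * conj p.2) : ℂ) • wedge (formA p) (conjForm (formA p))) := by
  have hd := defect_ne_zero hp
  rw [kahlerForm]
  congr 1
  simp only [Fin.sum_univ_two, metric_eq hk hp]
  change _ = (2 * k / defect p ^ 2 : ℂ) • wedge (dcoord 1) (conjForm (dcoord 1))
    + (1 / defect p : ℂ) • wedge (formA p) (conjForm (formA p))
  ext v
  simp [wedge_apply, dcoord, conjForm, formA]
  field_simp
  ring

lemma neg_I_smul_kahlerForm {k : ℝ} (hk : 1 ≤ k) {p : ℂ × ℂ} (hp : p ∈ domain) :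
    -Complex.I • kahlerForm k p = (2 * k / (1 - p.2 * conj p.2) ^ 2 : ℂ) •
        wedge (dcoord 1) (conjForm (dcoord 1)) +
        (1 / (1 - p.2 * conj p.2) : ℂ) • wedge (formA p) (conjForm (formA p)) := by
  rw [kahlerForm_eq hk hp, smul_smul, neg_mul, Complex.I_mul_I, neg_neg, one_smul]

/-- The form `A` transforms with the automorphy factor. -/
lemma formA_map (h : JacobiGroup) {p : ℂ × ℂ} (hp : p ∈ domain) (u : ℂ × ℂ) :
    formA (h.map p) (h.mapDeriv p u) = formA p u / h.den p := by
  have hd := h.den_ne_zero hp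
  have hd' : conj (h.den p) ≠ 0 := by simpa using hd
  have hP := defect_ne_zero hp
  have e1 : defect (h.map p) = defect p / (h.den p * conj (h.den p)) := by
    rw [defect, defect, one_sub_mul_conj, one_sub_mul_conj, h.one_sub_norm_map hp, mul_conj_eq,
      Complex.ofReal_div]
  have e2 : conj (α₀ (h.map p)) = (h.den p * (conj h.α - h.α * conj p.2 + conj p.1)
      + (h.α - conj h.α * p.2 + p.1) * (conj h.g.a * conj p.2 + conj h.g.b)) / defect p := by
    rw [conj_α₀, e1]
    have e3 : (h.map p).1 = (h.α - conj h.α * p.2 + p.1) / h.den p := rfl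
    have e4 : conj (h.map p).2 = (conj h.g.a * conj p.2 + conj h.g.b) / conj (h.den p) := by
      have : (h.map p).2 = (h.g.a * p.2 + h.g.b) / h.den p := rfl
      rw [this]
      simp
    rw [e4, e3]
    simp only [map_div₀, map_add, map_sub, map_mul, Complex.conj_conj]
    field_simp
  rw [formA, formA, e2, conj_α₀]
  simp [dcoord, JacobiGroup.mapDeriv]
  field_simp
  simp only [defect, JacobiGroup.den]
  ring

/-- Both terms of the Kähler form in `dw` and `A` are invariant: `dw` is divided by the square of the
automorphy factor, `A` by the factor itself, and `1 - |w|²` by its squared modulus. -/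
lemma kahlerForm_invariant {k : ℝ} (hk : 1 ≤ k) (h : JacobiGroup) {p : ℂ × ℂ} (hp : p ∈ domain) :
    (kahlerForm k (h.map p)).compContinuousLinearMap (fderiv ℝ h.map p) = kahlerForm k p := by
  have hd := h.den_ne_zero hp
  have hd' : conj (h.den p) ≠ 0 := by simpa using hd
  have hP : 1 - p.2 * conj p.2 ≠ 0 := defect_ne_zero hp
  have e1 : 1 - (h.map p).2 * conj (h.map p).2
      = (1 - p.2 * conj p.2) / (h.den p * conj (h.den p)) := by
    rw [one_sub_mul_conj, one_sub_mul_conj, h.one_sub_norm_map hp, mul_conj_eq, Complex.ofReal_div]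
  have e2 : ∀ u, fderiv ℝ h.map p u = h.mapDeriv p u := fun u => by
    rw [((h.hasFDerivAt_map hp).restrictScalars ℝ).fderiv]
    rfl
  have e3 : ∀ u, dcoord 1 (h.mapDeriv p u) = u.2 / h.den p ^ 2 := fun u => by
    simp [dcoord, JacobiGroup.mapDeriv]
    ring
  have e4 : ∀ u : ℂ × ℂ, dcoord 1 u = u.2 := fun u => rfl
  have e5 : ∀ (η : ℂ × ℂ →L[ℝ] ℂ) (u : ℂ × ℂ), conjForm η u = conj (η u) := fun _ _ => rfl
  rw [kahlerForm_eq hk hp, kahlerForm_eq hk (h.map_mem hp), e1]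
  ext v
  simp only [ContinuousAlternatingMap.compContinuousLinearMap_apply,
    ContinuousAlternatingMap.smul_apply, ContinuousAlternatingMap.add_apply, wedge_apply,
    Function.comp, e5, e2, e3, e4, formA_map h hp, map_div₀, map_pow, smul_eq_mul]
  congr 1
  field_simp

/-- The Kähler form with its coefficients as functions on the domain. -/
lemma kahlerForm_eventuallyEq {k : ℝ} (hk : 1 ≤ k) {p : ℂ × ℂ} (hp : p ∈ domain) :
    kahlerForm k =ᶠ[nhds p] fun q => Complex.I •
      ((defect q)⁻¹ • wedge (dcoord 0) (conjForm (dcoord 0))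
        + (α₀ q * (defect q)⁻¹) • wedge (dcoord 0) (conjForm (dcoord 1))
        + (conj (α₀ q) * (defect q)⁻¹) • wedge (dcoord 1) (conjForm (dcoord 0))
        + (α₀ q * conj (α₀ q) * (defect q)⁻¹ + 2 * k * ((defect q)⁻¹ * (defect q)⁻¹)) •
          wedge (dcoord 1) (conjForm (dcoord 1))) := by
  filter_upwards [isOpen_domain.mem_nhds hp] with q hq
  rw [kahlerForm]
  simp only [Fin.sum_univ_two, metric_eq hk hq]
  congr 1
  simp
  abel

/-- The exterior derivative is evaluated on three vectors; it is a polynomial identity in their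
coordinates once the derivatives of the coefficients are inserted. -/
lemma extDeriv_kahlerForm {k : ℝ} (hk : 1 ≤ k) {p : ℂ × ℂ} (hp : p ∈ domain) :
    extDeriv (kahlerForm k) p = 0 := by
  have hd := defect_ne_zero hp
  have hi := hasFDerivAt_inv_defect hp
  have ha := hasFDerivAt_α₀ hp
  have hac := hasFDerivAt_conj ha
  have h1 := (ha.mul hi : HasFDerivAt (fun q => α₀ q * (defect q)⁻¹) _ p)
  have h2 := (hac.mul hi : HasFDerivAt (fun q => conj (α₀ q) * (defect q)⁻¹) _ p)
  have h3 := (((ha.mul hac).mul hi).add ((hi.mul hi).const_mul (2 * k : ℂ)) :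
    HasFDerivAt (fun q => α₀ q * conj (α₀ q) * (defect q)⁻¹
      + 2 * k * ((defect q)⁻¹ * (defect q)⁻¹)) _ p)
  rw [(kahlerForm_eventuallyEq hk hp).extDeriv_eq]
  have hdiff : DifferentiableAt ℝ (fun q => Complex.I •
      ((defect q)⁻¹ • wedge (dcoord 0) (conjForm (dcoord 0))
        + (α₀ q * (defect q)⁻¹) • wedge (dcoord 0) (conjForm (dcoord 1))
        + (conj (α₀ q) * (defect q)⁻¹) • wedge (dcoord 1) (conjForm (dcoord 0))
        + (α₀ q * conj (α₀ q) * (defect q)⁻¹ + 2 * k * ((defect q)⁻¹ * (defect q)⁻¹)) •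
          wedge (dcoord 1) (conjForm (dcoord 1)))) p :=
    .fun_const_smul (.fun_add (.fun_add (.fun_add (hi.differentiableAt.smul_const _)
      (h1.differentiableAt.smul_const _)) (h2.differentiableAt.smul_const _))
      (h3.differentiableAt.smul_const _)) _
  ext v
  rw [extDeriv_apply hdiff]
  have key : ∀ u : Fin 2 → ℂ × ℂ, HasFDerivAt (fun q => (Complex.I •
      ((defect q)⁻¹ • wedge (dcoord 0) (conjForm (dcoord 0))
        + (α₀ q * (defect q)⁻¹) • wedge (dcoord 0) (conjForm (dcoord 1))
        + (conj (α₀ q) * (defect q)⁻¹) • wedge (dcoord 1) (conjForm (dcoord 0))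
        + (α₀ q * conj (α₀ q) * (defect q)⁻¹ + 2 * k * ((defect q)⁻¹ * (defect q)⁻¹)) •
          wedge (dcoord 1) (conjForm (dcoord 1)))) u) _ p := fun u =>
    ((((hi.mul_const (wedge (dcoord 0) (conjForm (dcoord 0)) u)).add
      (h1.mul_const (wedge (dcoord 0) (conjForm (dcoord 1)) u))).add
      (h2.mul_const (wedge (dcoord 1) (conjForm (dcoord 0)) u))).add
      (h3.mul_const (wedge (dcoord 1) (conjForm (dcoord 1)) u))).const_mul Complex.I
  simp only [(key _).fderiv]
  refine (Fin.sum_univ_three _).trans ?_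
  have r0 : Fin.removeNth (0 : Fin (2 + 1)) v = ![v 1, v 2] := by
    ext i <;> fin_cases i <;> rfl
  have r1 : Fin.removeNth (1 : Fin (2 + 1)) v = ![v 0, v 2] := by
    ext i <;> fin_cases i <;> rfl
  have r2 : Fin.removeNth (2 : Fin (2 + 1)) v = ![v 0, v 1] := by
    ext i <;> fin_cases i <;> rfl
  rw [r0, r1, r2]
  simp [wedge_apply, wirtForm_apply, dcoord, conjForm, conj_defect]
  generalize α₀ p = α
  field_simp
  ring

/-! ### Covariance of the kernel -/

/-- The fraction in the exponential function in the kernel. -/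
def kernelExponent (p q : ℂ × ℂ) : ℂ :=
  (2 * conj q.1 * p.1 + p.1 ^ 2 * conj q.2 + conj q.1 ^ 2 * p.2) / (2 * (1 - p.2 * conj q.2))

lemma weight_eq_exp {k : ℝ} (hk : 1 ≤ k) {p : ℂ × ℂ} (hp : p ∈ domain) :
    weight k p = Real.exp (-potential k p) := by
  have hP : 0 < 1 - ‖p.2‖ ^ 2 := sub_pos.2 (normSq_lt_one hp)
  have h : (p.1 ^ 2 * conj p.2 + conj p.1 ^ 2 * p.2).re = 2 * (p.1 ^ 2 * conj p.2).re := by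
    rw [sq_mul_conj_add_eq, Complex.ofReal_re]
  rw [weight, potential_eq hk hp, h, Real.rpow_def_of_pos hP, ← Real.exp_add, ← Real.exp_add]
  congr 1
  field_simp
  ring

lemma re_kernelExponent_self {k : ℝ} (hk : 1 ≤ k) {p : ℂ × ℂ} (hp : p ∈ domain) :
    (kernelExponent p p).re = potential k p + 2 * k * Real.log (1 - ‖p.2‖ ^ 2) := by
  have h := numerator_eq p
  rw [kernelExponent, show 2 * conj p.1 * p.1 = 2 * p.1 * conj p.1 by ring, h, one_sub_mul_conj,
    potential_eq hk hp, sub_add_cancel]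
  norm_cast

lemma norm_kernel {k : ℝ} (hk : 1 ≤ k) {p q : ℂ × ℂ} (hp : p ∈ domain) (hq : q ∈ domain) :
    ‖kernel k p q‖ = ‖1 - p.2 * conj q.2‖ ^ (-(2 * k)) * Real.exp (kernelExponent p q).re := by
  rw [kernel_eq hk hp hq, norm_mul, Complex.norm_cpow_real, Complex.norm_exp]
  rfl

/-- The cocycle identity for the exponent of the kernel: it is invariant under the group up to
the real part of a holomorphic function. -/
lemma kernelExponent_map (h : JacobiGroup) {q : ℂ × ℂ} (hq : q ∈ domain) :
    kernelExponent (h.map q) (h.map q) + kernelExponent (h.map 0) (h.map 0)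
      = kernelExponent (h.map q) (h.map 0) + conj (kernelExponent (h.map q) (h.map 0))
        + kernelExponent q q := by
  have hD := h.den_ne_zero hq
  have hD0 : h.den 0 ≠ 0 := h.den_ne_zero (by simp [domain])
  have hP := one_sub_mul_conj_ne_zero hq
  have hdet := h.g.det_eq
  have hP' : 1 - (h.map q).2 * conj (h.map q).2
      = (1 - q.2 * conj q.2) / (h.den q * conj (h.den q)) := by
    rw [one_sub_mul_conj, one_sub_mul_conj, h.one_sub_norm_map hq, mul_conj_eq, Complex.ofReal_div]
  have ha : h.g.a ≠ 0 := by simpa [JacobiGroup.den] using hD0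
  have ha' : conj h.g.a ≠ 0 := by simpa using ha
  have hD' : conj (h.den q) ≠ 0 := by simpa using hD
  have e0 : h.map 0 = (h.α / conj h.g.a, h.g.b / conj h.g.a) := by simp [JacobiGroup.map]
  have eq : h.map q = ((h.α - conj h.α * q.2 + q.1) / h.den q, (h.g.a * q.2 + h.g.b) / h.den q) :=
    rfl
  have hP0 : 1 - (h.map 0).2 * conj (h.map 0).2 = 1 / (h.g.a * conj h.g.a) := by
    rw [e0, map_div₀, Complex.conj_conj]
    field_simp
    linear_combination hdet
  have hP1 : 1 - (h.map q).2 * conj (h.map 0).2 = 1 / (h.g.a * h.den q) := by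
    rw [e0, eq, map_div₀, Complex.conj_conj]
    field_simp
    rw [JacobiGroup.den]
    linear_combination hdet
  have t1 : kernelExponent (h.map q) (h.map q) = (2 * ((h.α - conj h.α * q.2 + q.1)
      * (conj h.α - h.α * conj q.2 + conj q.1))
      + (h.α - conj h.α * q.2 + q.1) ^ 2 * (conj h.g.a * conj q.2 + conj h.g.b) / h.den q
      + (conj h.α - h.α * conj q.2 + conj q.1) ^ 2 * (h.g.a * q.2 + h.g.b) / conj (h.den q))
      / (2 * (1 - q.2 * conj q.2)) := by
    rw [kernelExponent, hP', eq]
    simp only [map_div₀, map_add, map_sub, map_mul, Complex.conj_conj]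
    field_simp
  have t2 : kernelExponent (h.map 0) (h.map 0) = (2 * (h.α * conj h.α)
      + h.α ^ 2 * conj h.g.b / conj h.g.a + conj h.α ^ 2 * h.g.b / h.g.a) / 2 := by
    rw [kernelExponent, hP0, e0]
    simp only [map_div₀, Complex.conj_conj]
    field_simp
  have t3 : kernelExponent (h.map q) (h.map 0) = (2 * (conj h.α * (h.α - conj h.α * q.2 + q.1))
      + (h.α - conj h.α * q.2 + q.1) ^ 2 * conj h.g.b / h.den q
      + conj h.α ^ 2 * (h.g.a * q.2 + h.g.b) / h.g.a) / 2 := by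
    rw [kernelExponent, hP1, e0, eq]
    simp only [map_div₀, Complex.conj_conj]
    field_simp
  -- With `n = α - conj α w + z`, the terms with denominator `D` combine to `n² conj w / (1 - |w|²)`.
  have c1 : (conj h.g.a * conj q.2 + conj h.g.b) / h.den q / (1 - q.2 * conj q.2)
      = conj h.g.b / h.den q + conj q.2 / (1 - q.2 * conj q.2) := by
    rw [div_div, div_add_div _ _ hD hP, div_left_inj' (mul_ne_zero hD hP), JacobiGroup.den]
    ring
  have c2 := congrArg conj c1
  simp only [map_div₀, map_add, map_sub, map_mul, map_one, Complex.conj_conj,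
    mul_comm (conj q.2) q.2] at c2
  have c3 : (h.g.a * q.2 + h.g.b) / h.g.a = q.2 + h.g.b / h.g.a := by
    field_simp
  have c4 := congrArg conj c3
  simp only [map_div₀, map_add, map_mul] at c4
  have c5 : (1 - q.2 * conj q.2) / (1 - q.2 * conj q.2) = 1 := div_self hP
  rw [t1, t2, t3, kernelExponent]
  simp only [map_div₀, map_add, map_sub, map_mul, map_pow, Complex.conj_conj, map_ofNat,
    div_mul_eq_div_div]
  linear_combination (h.α - conj h.α * q.2 + q.1) ^ 2 / 2 * c1
    + (conj h.α - h.α * conj q.2 + conj q.1) ^ 2 / 2 * c2 - conj h.α ^ 2 / 2 * c3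
    - h.α ^ 2 / 2 * c4
    + (2 * h.α * conj h.α - conj h.α ^ 2 * q.2 - h.α ^ 2 * conj q.2
      - 2 * conj h.α * (h.α - conj h.α * q.2 + q.1)
      - 2 * h.α * (conj h.α - h.α * conj q.2 + conj q.1)) / (-2) * c5

/-- The weight is multiplied under the group action by the squared modulus of the holomorphic
function `kernel k (h · q) (h · 0)`, up to a constant. -/
lemma weight_map {k : ℝ} (hk : 1 ≤ k) (h : JacobiGroup) {q : ℂ × ℂ} (hq : q ∈ domain) :
    weight k q * Real.exp (potential k (h.map 0))
      = ‖kernel k (h.map q) (h.map 0)‖ ^ 2 * weight k (h.map q) := by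
  have h0 : (0 : ℂ × ℂ) ∈ domain := by simp [domain]
  have hq' := h.map_mem hq
  have h0' := h.map_mem h0
  have hc := congrArg Complex.re (kernelExponent_map h hq)
  simp only [Complex.add_re, Complex.conj_re, re_kernelExponent_self hk hq',
    re_kernelExponent_self hk h0', re_kernelExponent_self hk hq, h.one_sub_norm_map hq,
    h.one_sub_norm_map h0] at hc
  have hP : 0 < 1 - ‖q.2‖ ^ 2 := sub_pos.2 (normSq_lt_one hq)
  have hD : 0 < ‖h.den q‖ := norm_pos_iff.2 (h.den_ne_zero hq)
  have hD0 : 0 < ‖h.den 0‖ := norm_pos_iff.2 (h.den_ne_zero h0)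
  have hP1 : ‖1 - (h.map q).2 * conj (h.map 0).2‖ = 1 / (‖h.den 0‖ * ‖h.den q‖) := by
    have hd := h.den_ne_zero hq
    have hd0 := h.den_ne_zero h0
    have ha : h.g.a ≠ 0 := by simpa [JacobiGroup.den] using hd0
    have e : 1 - (h.map q).2 * conj (h.map 0).2 = 1 / (h.g.a * h.den q) := by
      simp only [JacobiGroup.map, Prod.snd_zero, mul_zero, zero_add, map_div₀, Complex.conj_conj]
      change 1 - _ / h.den q * _ = _
      field_simp
      rw [JacobiGroup.den]
      linear_combination h.g.det_eq
    rw [e, norm_div, norm_mul, norm_one]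
    simp [JacobiGroup.den]
  rw [weight_eq_exp hk hq, weight_eq_exp hk hq', norm_kernel hk hq' h0', hP1,
    Real.rpow_def_of_pos (by positivity), ← Real.exp_add, ← Real.exp_add, ← Real.exp_nat_mul,
    ← Real.exp_add]
  congr 1
  rw [Real.log_div hP.ne' (by positivity), Real.log_div (by simp) (by positivity),
    Real.log_pow, Real.log_pow] at hc
  rw [Real.log_div one_ne_zero (by positivity), Real.log_mul hD0.ne' hD.ne']
  simp only [Prod.snd_zero, norm_zero, Real.log_one] at hc ⊢
  norm_num at hc ⊢
  linarith

/-! ### The total mass of the weight -/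

/-- The Gaussian in the variable `z` which occurs in the weight, for fixed `w`. -/
def fibreGaussian (w z : ℂ) : ℝ :=
  Real.exp (-((‖z‖ ^ 2 + (z ^ 2 * conj w).re) / (1 - ‖w‖ ^ 2)))

lemma integrable_and_integral_fibreGaussian_ofReal {r : ℝ} (h0 : 0 ≤ r) (h1 : r < 1) :
    Integrable (fibreGaussian r) ∧ ∫ z, fibreGaussian r z = Real.pi * √(1 - r ^ 2) := by
  have hm : 0 < 1 - r := by linarith
  have hp : 0 < 1 + r := by linarith
  have hP : 1 - r ^ 2 ≠ 0 := by nlinarith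
  have e : ∀ x : ℝ × ℝ, fibreGaussian r (Complex.measurableEquivRealProd.symm x)
      = Real.exp (-(1 - r)⁻¹ * x.1 ^ 2) * Real.exp (-(1 + r)⁻¹ * x.2 ^ 2) := by
    rintro ⟨x, y⟩
    have hre : (Complex.measurableEquivRealProd.symm (x, y)).re = x := rfl
    have him : (Complex.measurableEquivRealProd.symm (x, y)).im = y := rfl
    rw [fibreGaussian, ← Real.exp_add, ← Complex.normSq_eq_norm_sq, Complex.normSq_apply,
      Complex.norm_real, Real.norm_eq_abs, sq_abs, Complex.conj_ofReal, Complex.re_mul_ofReal, sq,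
      Complex.mul_re, hre, him]
    congr 1
    rw [show 1 - r ^ 2 = (1 - r) * (1 + r) by ring]
    field_simp
    ring
  have hmp := Complex.volume_preserving_equiv_real_prod.symm
  have i1 := integrable_exp_neg_mul_sq (inv_pos.2 hm)
  have i2 := integrable_exp_neg_mul_sq (inv_pos.2 hp)
  constructor
  · rw [← hmp.integrable_comp_emb (MeasurableEquiv.measurableEmbedding _)]
    exact (i1.mul_prod i2).congr (Filter.Eventually.of_forall fun x => (e x).symm)
  · rw [← hmp.integral_comp', integral_congr_ae (Filter.Eventually.of_forall e),
      Measure.volume_eq_prod, integral_prod_mul (fun x : ℝ => Real.exp (-(1 - r)⁻¹ * x ^ 2))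
        (fun x : ℝ => Real.exp (-(1 + r)⁻¹ * x ^ 2)), integral_gaussian, integral_gaussian,
      div_inv_eq_mul, div_inv_eq_mul, Real.sqrt_mul Real.pi_pos.le, Real.sqrt_mul Real.pi_pos.le,
      show 1 - r ^ 2 = (1 - r) * (1 + r) by ring, Real.sqrt_mul hm.le]
    linear_combination (√(1 - r) * √(1 + r)) * Real.mul_self_sqrt Real.pi_pos.le

lemma exists_sq_mul_norm_eq (w : ℂ) : ∃ c : Circle, (c : ℂ) ^ 2 * ‖w‖ = w := by
  refine ⟨Circle.exp (w.arg / 2), ?_⟩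
  rw [Circle.coe_exp, ← Complex.exp_nat_mul, mul_comm]
  convert Complex.norm_mul_exp_arg_mul_I w using 3
  push_cast
  ring

/-- By a rotation of `z` the parameter `w` may be taken to be real. -/
lemma integrable_and_integral_fibreGaussian {w : ℂ} (hw : ‖w‖ < 1) :
    Integrable (fibreGaussian w) ∧ ∫ z, fibreGaussian w z = Real.pi * √(1 - ‖w‖ ^ 2) := by
  obtain ⟨c, hc⟩ := exists_sq_mul_norm_eq w
  obtain ⟨h1, h2⟩ := integrable_and_integral_fibreGaussian_ofReal (norm_nonneg w) hw
  have hmp := (rotation c).measurePreserving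
  have hme : MeasurableEmbedding (rotation c) :=
    (rotation c).toHomeomorph.measurableEmbedding
  have e : ∀ z, fibreGaussian w (rotation c z) = fibreGaussian (‖w‖ : ℝ) z := fun z => by
    have hc1 : (c : ℂ) * conj (c : ℂ) = 1 := by
      rw [mul_conj_eq, Circle.norm_coe]
      simp
    have e1 : ((c : ℂ) * z) ^ 2 * conj w = z ^ 2 * ‖w‖ := by
      have h3 := congrArg conj hc
      simp only [map_mul, map_pow, Complex.conj_ofReal] at h3
      rw [← h3]
      linear_combination (z ^ 2 * ‖w‖) * ((c : ℂ) * conj (c : ℂ) + 1) * hc1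
    rw [fibreGaussian, fibreGaussian, rotation_apply, e1, norm_mul, Circle.norm_coe, one_mul,
      Complex.conj_ofReal, Complex.norm_real, norm_norm]
  constructor
  · rw [← hmp.integrable_comp_emb hme]
    exact h1.congr (Filter.Eventually.of_forall fun x => (e x).symm)
  · rw [← hmp.integral_comp hme, integral_congr_ae (Filter.Eventually.of_forall e), h2]

lemma weight_eq_mul_fibreGaussian (k : ℝ) {p : ℂ × ℂ} (hp : p ∈ domain) :
    weight k p = (1 - ‖p.2‖ ^ 2) ^ (2 * k) * fibreGaussian p.2 p.1 := by
  have h : (p.1 ^ 2 * conj p.2 + conj p.1 ^ 2 * p.2).re = 2 * (p.1 ^ 2 * conj p.2).re := by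
    rw [sq_mul_conj_add_eq, Complex.ofReal_re]
  have hP : 0 < 1 - ‖p.2‖ ^ 2 := sub_pos.2 (normSq_lt_one hp)
  rw [weight, h, fibreGaussian, mul_assoc, ← Real.exp_add]
  congr 2
  field_simp
  ring

/-- The radial integral over the disk. For `s < 0` the integrand is unbounded at the boundary. -/
lemma integrable_and_integral_disk {s : ℝ} (hs : -1 < s) :
    IntegrableOn (fun w : ℂ => (1 - ‖w‖ ^ 2) ^ s) (Metric.ball 0 1) ∧
      ∫ w in Metric.ball (0 : ℂ) 1, (1 - ‖w‖ ^ 2) ^ s = Real.pi / (s + 1) := by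
  have hs' : s + 1 ≠ 0 := by linarith
  let g : ℝ → ℝ := fun y => -(1 - y ^ 2) ^ (s + 1) / (2 * (s + 1))
  have hg : ContinuousOn g (Set.Icc 0 1) := by
    refine ContinuousOn.div_const (ContinuousOn.neg ?_) _
    exact (ContinuousOn.rpow_const (by fun_prop) fun x _ => Or.inr (by linarith))
  have hg' : ∀ y ∈ Set.Ioo (0 : ℝ) 1, HasDerivAt g (y * (1 - y ^ 2) ^ s) y := fun y hy => by
    have hy1 : 0 < 1 - y ^ 2 := by nlinarith [hy.1, hy.2]
    have h1 : HasDerivAt (fun y : ℝ => 1 - y ^ 2) (-(2 * y)) y := by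
      simpa using (hasDerivAt_pow 2 y).const_sub 1
    refine ((h1.rpow_const (p := s + 1) (Or.inl hy1.ne')).neg.div_const (2 * (s + 1))).congr_deriv ?_
    rw [add_sub_cancel_right]
    field_simp
  have hnn : ∀ y ∈ Set.Ioo (0 : ℝ) 1, 0 ≤ y * (1 - y ^ 2) ^ s := fun y hy =>
    mul_nonneg hy.1.le (Real.rpow_nonneg (by nlinarith [hy.1, hy.2]) _)
  have hint := intervalIntegral.integrableOn_deriv_of_nonneg hg hg' hnn
  have hval : ∫ y in Set.Ioc (0 : ℝ) 1, y * (1 - y ^ 2) ^ s = 1 / (2 * (s + 1)) := by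
    rw [← intervalIntegral.integral_of_le zero_le_one,
      intervalIntegral.integral_eq_sub_of_hasDerivAt_of_le zero_le_one hg hg'
        ((intervalIntegrable_iff_integrableOn_Ioc_of_le zero_le_one).2 hint)]
    simp [g, Real.zero_rpow hs']
    field_simp
  let f : ℝ → ℝ := (Set.Iio 1).indicator fun y => (1 - y ^ 2) ^ s
  have hf : (fun w : ℂ => f ‖w‖) = (Metric.ball 0 1).indicator fun w => (1 - ‖w‖ ^ 2) ^ s := by
    funext w
    by_cases hw : ‖w‖ < 1 <;> simp [f, Set.indicator, hw]
  have hf' : (fun y : ℝ => y ^ (Module.finrank ℝ ℂ - 1) • f y)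
      = (Set.Iio 1).indicator fun y => y * (1 - y ^ 2) ^ s := by
    funext y
    by_cases hy : y < 1 <;> simp [f, Set.indicator, hy]
  have hset : Set.Iio (1 : ℝ) ∩ Set.Ioi 0 = Set.Ioo 0 1 := by
    ext x
    simp [and_comm]
  constructor
  · rw [← integrable_indicator_iff measurableSet_ball, ← hf, integrable_fun_norm_addHaar, hf',
      integrableOn_indicator_iff measurableSet_Iio, hset]
    exact hint.mono_set Set.Ioo_subset_Ioc_self
  · rw [← integral_indicator measurableSet_ball, ← hf, integral_fun_norm_addHaar, hf',
      setIntegral_indicator measurableSet_Iio, Set.inter_comm, hset, ← integral_Ioc_eq_integral_Ioo,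
      hval]
    simp [Measure.real, Complex.volume_ball]
    field_simp

lemma lintegral_weight {k : ℝ} (hk : 1 ≤ k) :
    ∫⁻ x : domain, ENNReal.ofReal (weight k x) ∂invariantMeasure
      = ENNReal.ofReal (2 * Real.pi ^ 2 / (4 * k - 3)) := by
  have hm1 : Measurable fun p : ℂ × ℂ => ENNReal.ofReal (((1 - ‖p.2‖ ^ 2) ^ 3)⁻¹) := by fun_prop
  have hm2 : Measurable fun p : ℂ × ℂ => ENNReal.ofReal (weight k p) := by
    unfold weight
    fun_prop
  have hdom : domain = Set.univ ×ˢ Metric.ball (0 : ℂ) 1 := by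
    ext p
    simp [domain]
  have hs : -1 < 2 * k - 5 / 2 := by linarith
  obtain ⟨hi, hv⟩ := integrable_and_integral_disk hs
  refine (lintegral_withDensity_eq_lintegral_mul _
    (hm1.comp measurable_subtype_coe) (hm2.comp measurable_subtype_coe)).trans ?_
  refine (lintegral_subtype_comap measurableSet_domain (fun p : ℂ × ℂ =>
    ENNReal.ofReal (((1 - ‖p.2‖ ^ 2) ^ 3)⁻¹) * ENNReal.ofReal (weight k p))).trans ?_
  rw [hdom, Measure.volume_eq_prod, ← Measure.prod_restrict, Measure.restrict_univ]
  refine (lintegral_prod_symm _ (hm1.mul hm2).aemeasurable).trans ?_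
  simp only [Pi.mul_apply]
  have inner_eq : ∀ w ∈ Metric.ball (0 : ℂ) 1, ∫⁻ z : ℂ, ENNReal.ofReal (((1 - ‖w‖ ^ 2) ^ 3)⁻¹)
      * ENNReal.ofReal (weight k (z, w))
        = ENNReal.ofReal (Real.pi * (1 - ‖w‖ ^ 2) ^ (2 * k - 5 / 2)) := fun w hw => by
    have hw' : ‖w‖ < 1 := by simpa using hw
    have hP : 0 < 1 - ‖w‖ ^ 2 := by nlinarith [norm_nonneg w]
    obtain ⟨gi, gv⟩ := integrable_and_integral_fibreGaussian hw'
    have e : ∀ z, ENNReal.ofReal (((1 - ‖w‖ ^ 2) ^ 3)⁻¹) * ENNReal.ofReal (weight k (z, w))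
        = ENNReal.ofReal (((1 - ‖w‖ ^ 2) ^ 3)⁻¹ * (1 - ‖w‖ ^ 2) ^ (2 * k))
          * ENNReal.ofReal (fibreGaussian w z) := fun z => by
      rw [weight_eq_mul_fibreGaussian k (p := (z, w)) hw', ← ENNReal.ofReal_mul (by positivity),
        ← ENNReal.ofReal_mul (by positivity), mul_assoc]
    simp only [e]
    rw [lintegral_const_mul' _ _ ENNReal.ofReal_ne_top, ← ofReal_integral_eq_lintegral_ofReal gi
      (Filter.Eventually.of_forall fun z => (Real.exp_pos _).le), gv,
      ← ENNReal.ofReal_mul (by positivity)]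
    congr 1
    rw [Real.sqrt_eq_rpow, ← Real.rpow_natCast, ← Real.rpow_neg hP.le, ← Real.rpow_add hP,
      mul_left_comm, ← Real.rpow_add hP]
    congr 2
    norm_num
    ring
  rw [setLIntegral_congr_fun measurableSet_ball inner_eq,
    ← ofReal_integral_eq_lintegral_ofReal (hi.const_mul _), integral_const_mul, hv]
  · congr 1
    rw [show 2 * k - 5 / 2 + 1 = (4 * k - 3) / 2 by ring]
    field_simp
  · refine (ae_restrict_iff' measurableSet_ball).2 (Filter.Eventually.of_forall fun w hw => ?_)
    have hw' : ‖w‖ < 1 := by simpa using hw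
    have hP : 0 < 1 - ‖w‖ ^ 2 := by nlinarith [norm_nonneg w]
    change 0 ≤ Real.pi * (1 - ‖w‖ ^ 2) ^ (2 * k - 5 / 2)
    positivity

/-! ### The reproducing property -/

/-- The probability measure `Λ ρ dν` on the domain. -/
def bergmanMeasure (k : ℝ) : Measure domain :=
  invariantMeasure.withDensity fun x => ENNReal.ofReal (normalization k * weight k x)

lemma normalization_pos {k : ℝ} (hk : 1 ≤ k) : 0 < normalization k :=
  div_pos (by linarith) (by positivity)

lemma weight_pos {k : ℝ} (hk : 1 ≤ k) {p : ℂ × ℂ} (hp : p ∈ domain) : 0 < weight k p := by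
  rw [weight_eq_exp hk hp]
  exact Real.exp_pos _

lemma measurable_weight (k : ℝ) : Measurable (weight k) := by
  unfold weight
  fun_prop

lemma isProbabilityMeasure_bergmanMeasure {k : ℝ} (hk : 1 ≤ k) :
    IsProbabilityMeasure (bergmanMeasure k) := by
  refine ⟨?_⟩
  rw [bergmanMeasure, withDensity_apply _ MeasurableSet.univ, Measure.restrict_univ]
  simp only [ENNReal.ofReal_mul (normalization_pos hk).le]
  rw [lintegral_const_mul' _ _ ENNReal.ofReal_ne_top, lintegral_weight hk,
    ← ENNReal.ofReal_mul (normalization_pos hk).le, normalization, ← ENNReal.ofReal_one]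
  congr 1
  have : 4 * k - 3 ≠ 0 := by linarith
  field_simp

lemma toReal_density {k : ℝ} (hk : 1 ≤ k) (x : domain) :
    (ENNReal.ofReal (normalization k * weight k x)).toReal = normalization k * weight k x :=
  ENNReal.toReal_ofReal (mul_nonneg (normalization_pos hk).le (weight_pos hk x.2).le)

lemma measurable_density (k : ℝ) :
    Measurable fun x : domain => ENNReal.ofReal (normalization k * weight k x) :=
  (((measurable_weight k).comp measurable_subtype_coe).const_mul _).ennreal_ofReal

lemma integrable_bergmanMeasure_iff {E : Type*} [NormedAddCommGroup E] [NormedSpace ℝ E] {k : ℝ}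
    (hk : 1 ≤ k) (f : domain → E) : Integrable f (bergmanMeasure k) ↔
      Integrable (fun x : domain => weight k x • f x) invariantMeasure := by
  rw [bergmanMeasure, integrable_withDensity_iff_integrable_smul' (measurable_density k)
    (Filter.Eventually.of_forall fun _ => ENNReal.ofReal_lt_top)]
  simp only [toReal_density hk, mul_smul]
  exact integrable_smul_iff (normalization_pos hk).ne' _

lemma integral_bergmanMeasure {E : Type*} [NormedAddCommGroup E] [NormedSpace ℝ E] {k : ℝ}
    (hk : 1 ≤ k) (f : domain → E) : ∫ x, f x ∂bergmanMeasure k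
      = normalization k • ∫ x : domain, weight k x • f x ∂invariantMeasure := by
  rw [bergmanMeasure, integral_withDensity_eq_integral_toReal_smul (measurable_density k)
    (Filter.Eventually.of_forall fun _ => ENNReal.ofReal_lt_top)]
  simp only [toReal_density hk, mul_smul]
  rw [integral_smul]

lemma JacobiGroup.measurableEmbedding_smul (h : JacobiGroup) :
    MeasurableEmbedding fun x : domain => h • x :=
  (MeasurableEquiv.mk (MulAction.toPerm h) h.measurable_smul
    h⁻¹.measurable_smul).measurableEmbedding

lemma integrable_smul_invariantMeasure_iff {E : Type*} [NormedAddCommGroup E] (h : JacobiGroup)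
    (f : domain → E) :
    Integrable (fun x => f (h • x)) invariantMeasure ↔ Integrable f invariantMeasure :=
  (measurePreserving_smul h).integrable_comp_emb h.measurableEmbedding_smul

lemma integral_smul_invariantMeasure {E : Type*} [NormedAddCommGroup E] [NormedSpace ℝ E]
    (h : JacobiGroup) (f : domain → E) :
    ∫ x, f (h • x) ∂invariantMeasure = ∫ x, f x ∂invariantMeasure :=
  (measurePreserving_smul h).integral_comp h.measurableEmbedding_smul _

/-- The element of the Jacobi group which acts by `(z, w) ↦ (c z, c² w)`. -/
def circleElement (c : Circle) : JacobiGroup :=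
  ⟨⟨⟨!![(c : ℂ), 0; 0, conj (c : ℂ)], by
    rw [Matrix.det_fin_two_of, mul_conj_eq, Circle.norm_coe]
    simp⟩, by simp, by simp⟩, 0, 0⟩

lemma circleElement_map (c : Circle) (p : ℂ × ℂ) :
    (circleElement c).map p = ((c : ℂ) * p.1, (c : ℂ) ^ 2 * p.2) := by
  have hc : (c : ℂ) * conj (c : ℂ) = 1 := by
    rw [mul_conj_eq, Circle.norm_coe]
    simp
  have hc0 : conj (c : ℂ) ≠ 0 := right_ne_zero_of_mul_eq_one hc
  have ha : (circleElement c).g.a = c := rfl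
  have hb : (circleElement c).g.b = 0 := rfl
  have hα : (circleElement c).α = 0 := rfl
  simp only [JacobiGroup.map, ha, hb, hα, map_zero, zero_mul, zero_add, sub_zero, add_zero]
  ext1
  · rw [div_eq_iff hc0]
    linear_combination (-p.1) * hc
  · rw [div_eq_iff hc0]
    linear_combination (-(c * p.2)) * hc

lemma weight_circleElement (k : ℝ) (c : Circle) (p : ℂ × ℂ) :
    weight k ((circleElement c).map p) = weight k p := by
  have hc : (c : ℂ) * conj (c : ℂ) = 1 := by
    rw [mul_conj_eq, Circle.norm_coe]
    simp
  have e : (c * p.1) ^ 2 * conj ((c : ℂ) ^ 2 * p.2) + conj (c * p.1) ^ 2 * ((c : ℂ) ^ 2 * p.2)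
      = p.1 ^ 2 * conj p.2 + conj p.1 ^ 2 * p.2 := by
    simp only [map_mul, map_pow]
    linear_combination ((p.1 ^ 2 * conj p.2 + conj p.1 ^ 2 * p.2) * (c * conj (c : ℂ) + 1)) * hc
  rw [circleElement_map, weight, weight]
  simp only [e, norm_mul, norm_pow, Circle.norm_coe, one_pow, one_mul]

/-- The mean value property on the orbits of the circle group. -/
lemma integral_circle_orbit {F : ℂ × ℂ → ℂ} (hF : DifferentiableOn ℂ F domain) (x : domain) :
    ∫ θ in Set.Ioc 0 (2 * Real.pi), F (circleElement (Circle.exp θ) • x : domain)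
      = (2 * Real.pi : ℝ) • F 0 := by
  let s : Set ℂ := {c | ‖c ^ 2 * x.1.2‖ < 1}
  have hs : IsOpen s := isOpen_lt (by fun_prop) continuous_const
  have hd : DifferentiableOn ℂ (fun c : ℂ => F (c * x.1.1, c ^ 2 * x.1.2)) s :=
    hF.comp (f := fun c : ℂ => (c * x.1.1, c ^ 2 * x.1.2)) (by fun_prop) fun c hc => hc
  have hb : closure (Metric.ball (0 : ℂ) |1|) ⊆ s := by
    rw [abs_one, closure_ball _ one_ne_zero]
    intro c hc
    have hc' : ‖c‖ ≤ 1 := by simpa using hc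
    have hx : ‖x.1.2‖ < 1 := x.2
    change ‖c ^ 2 * x.1.2‖ < 1
    rw [norm_mul, norm_pow]
    exact (mul_le_of_le_one_left (norm_nonneg _) (pow_le_one₀ (norm_nonneg _) hc')).trans_lt hx
  have h := (hd.mono hb).diffContOnCl.circleAverage
  rw [Real.circleAverage, intervalIntegral.integral_of_le Real.two_pi_pos.le,
    inv_smul_eq_iff₀ Real.two_pi_pos.ne'] at h
  rw [show F 0 = F (0 * x.1.1, 0 ^ 2 * x.1.2) by congr 1; ext <;> simp, ← h]
  refine integral_congr_ae (Filter.Eventually.of_forall fun θ => ?_)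
  simp only [smul_coe, circleElement_map, Circle.coe_exp, circleMap_zero, Complex.ofReal_one,
    one_mul]

lemma continuous_circle_orbit :
    Continuous fun y : ℝ × domain => circleElement (Circle.exp y.1) • y.2 := by
  refine Continuous.subtype_mk ?_ _
  simp only [circleElement_map, Circle.coe_exp]
  fun_prop

/-- The mean value property: by rotation invariance of the measure, integrating a holomorphic
function is the same as integrating its means over circle orbits, which are constant. -/
lemma integral_eq_apply_zero {k : ℝ} (hk : 1 ≤ k) {F : ℂ × ℂ → ℂ}
    (hF : DifferentiableOn ℂ F domain)
    (hi : Integrable (fun x : domain => F x) (bergmanMeasure k)) :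
    ∫ x : domain, F x ∂bergmanMeasure k = F 0 := by
  have := isProbabilityMeasure_bergmanMeasure hk
  have hrot : ∀ (c : Circle) (E : Type) [NormedAddCommGroup E] [NormedSpace ℝ E] (G : domain → E),
      (Integrable (fun x => G (circleElement c • x)) (bergmanMeasure k) ↔
        Integrable G (bergmanMeasure k)) ∧
      ∫ x, G (circleElement c • x) ∂bergmanMeasure k = ∫ x, G x ∂bergmanMeasure k := by
    intro c E _ _ G
    rw [integrable_bergmanMeasure_iff hk, integrable_bergmanMeasure_iff hk,
      integral_bergmanMeasure hk, integral_bergmanMeasure hk,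
      ← integrable_smul_invariantMeasure_iff (circleElement c) fun x : domain => weight k x • G x,
      ← integral_smul_invariantMeasure (circleElement c) fun x : domain => weight k x • G x]
    simp only [smul_coe, weight_circleElement, and_self]
  have hcont : Continuous fun y : ℝ × domain => F (circleElement (Circle.exp y.1) • y.2 : domain) :=
    hF.continuousOn.comp_continuous (continuous_subtype_val.comp continuous_circle_orbit)
      fun y => Subtype.prop _
  have hint : Integrable (Function.uncurry fun (θ : ℝ) (x : domain) =>
      F (circleElement (Circle.exp θ) • x : domain))
      ((volume.restrict (Set.Ioc 0 (2 * Real.pi))).prod (bergmanMeasure k)) := by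
    refine (integrable_prod_iff hcont.aestronglyMeasurable).2 ⟨?_, ?_⟩
    · exact Filter.Eventually.of_forall fun θ => (hrot (Circle.exp θ) ℂ fun x => F x).1.2 hi
    · have e : ∀ θ : ℝ, ∫ x : domain, ‖F (circleElement (Circle.exp θ) • x : domain)‖
          ∂bergmanMeasure k = ∫ x : domain, ‖F x‖ ∂bergmanMeasure k := fun θ =>
        (hrot (Circle.exp θ) ℝ fun x => ‖F x‖).2
      exact (integrable_congr (Filter.Eventually.of_forall e)).2 (integrable_const _)
  have h := integral_integral_swap hint
  simp only [(hrot _ ℂ fun x : domain => F x).2, integral_circle_orbit hF, integral_const] at h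
  simpa [Real.pi_ne_zero, Measure.real, Real.pi_pos.le] using h

lemma kernel_ne_zero {k : ℝ} (hk : 1 ≤ k) {p q : ℂ × ℂ} (hp : p ∈ domain) (hq : q ∈ domain) :
    kernel k p q ≠ 0 := by
  have h1 : ‖p.2 * conj q.2‖ < 1 := by
    rw [norm_mul, Complex.norm_conj]
    exact mul_lt_one_of_nonneg_of_lt_one_left (norm_nonneg _) hp (le_of_lt hq)
  have h := Complex.slitPlane_ne_zero (one_sub_mem_slitPlane h1)
  rw [← norm_pos_iff, norm_kernel hk hp hq]
  have := norm_pos_iff.2 h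
  positivity

lemma differentiableOn_kernel {k : ℝ} (hk : 1 ≤ k) (p : ℂ × ℂ) :
    DifferentiableOn ℂ (fun q => kernel k q p) domain :=
  differentiableOn_symbol hk (coherent k (conj p.1, conj p.2))

lemma aestronglyMeasurable_of_differentiableOn {F : ℂ × ℂ → ℂ} (hF : DifferentiableOn ℂ F domain)
    (μ : Measure domain) : AEStronglyMeasurable (fun x : domain => F x) μ :=
  (hF.continuousOn.comp_continuous continuous_subtype_val fun x => x.2).aestronglyMeasurable

lemma exists_map_zero_eq {p : ℂ × ℂ} (hp : p ∈ domain) : ∃ h : JacobiGroup, h.map 0 = p := by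
  have h0 : (0 : ℂ × ℂ) ∈ domain := by simp [domain]
  obtain ⟨h, hh⟩ := isPretransitive.exists_smul_eq (⟨0, h0⟩ : domain) ⟨p, hp⟩
  exact ⟨h, congrArg Subtype.val hh⟩

lemma memLp_kernel {k : ℝ} (hk : 1 ≤ k) {p : ℂ × ℂ} (hp : p ∈ domain) :
    MemLp (fun x : domain => kernel k x p) 2 (bergmanMeasure k) := by
  have := isProbabilityMeasure_bergmanMeasure hk
  obtain ⟨h, rfl⟩ := exists_map_zero_eq hp
  rw [memLp_two_iff_integrable_sq_norm
      (aestronglyMeasurable_of_differentiableOn (differentiableOn_kernel hk _) _),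
    integrable_bergmanMeasure_iff hk, ← integrable_smul_invariantMeasure_iff h]
  have e : ∀ x : domain, weight k (h • x : domain)
      • ‖kernel k (h • x : domain) (h.map 0)‖ ^ 2
        = weight k x • Real.exp (potential k (h.map 0)) := fun x => by
    rw [smul_coe, smul_eq_mul, smul_eq_mul, weight_map hk h x.2, mul_comm]
  simp only [e]
  rw [← integrable_bergmanMeasure_iff hk fun _ => Real.exp (potential k (h.map 0))]
  exact integrable_const _

/-- The reproducing property, obtained from the mean value property at the origin by transporting
with an element of the group which maps the origin to `p`. -/
lemma integral_conj_kernel_mul {k : ℝ} (hk : 1 ≤ k) {f : ℂ × ℂ → ℂ}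
    (hf : DifferentiableOn ℂ f domain)
    (hi : MemLp (fun x : domain => f x) 2 (bergmanMeasure k)) {p : ℂ × ℂ} (hp : p ∈ domain) :
    ∫ x : domain, conj (kernel k x p) * f x ∂bergmanMeasure k = f p := by
  obtain ⟨h, rfl⟩ := exists_map_zero_eq hp
  have h0 : (0 : ℂ × ℂ) ∈ domain := by simp [domain]
  have hF : DifferentiableOn ℂ (fun q => f (h.map q) / kernel k (h.map q) (h.map 0)) domain := by
    simp only [div_eq_mul_inv]
    refine (hf.comp h.differentiableOn_map fun q hq => h.map_mem hq).fun_mul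
      (((differentiableOn_kernel hk (h.map 0)).comp (f := h.map) h.differentiableOn_map
        fun q hq => h.map_mem hq).fun_inv fun q hq => kernel_ne_zero hk (h.map_mem hq) hp)
  have hG : Integrable (fun x : domain => conj (kernel k x (h.map 0)) * f x) (bergmanMeasure k) :=
    (memLp_kernel hk hp).star.integrable_mul hi
  have hne : (Real.exp (potential k (h.map 0)) : ℂ) ≠ 0 := by exact_mod_cast (Real.exp_pos _).ne'
  have e : ∀ x : domain, weight k x • (f (h.map x) / kernel k (h.map x) (h.map 0))
      = (Real.exp (potential k (h.map 0)) : ℂ)⁻¹ * (weight k (h • x : domain) •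
        (conj (kernel k (h • x : domain) (h.map 0)) * f (h • x : domain))) := fun x => by
    have hK := kernel_ne_zero hk (h.map_mem x.2) hp
    have hw := congrArg (fun r : ℝ => (r : ℂ)) (weight_map hk h x.2)
    rw [smul_coe, Complex.real_smul, Complex.real_smul]
    push_cast at hw hne ⊢
    rw [← Complex.ofReal_pow, ← mul_conj_eq] at hw
    field_simp
    linear_combination f (h.map x) * hw
  have hFi : Integrable (fun x : domain => f (h.map x) / kernel k (h.map x) (h.map 0))
      (bergmanMeasure k) := by
    rw [integrable_bergmanMeasure_iff hk]
    simp only [e]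
    refine Integrable.const_mul ((integrable_smul_invariantMeasure_iff h fun x : domain =>
      weight k x • (conj (kernel k x (h.map 0)) * f x)).2 ?_) _
    exact (integrable_bergmanMeasure_iff hk _).1 hG
  have hmean := integral_eq_apply_zero hk hF hFi
  rw [integral_bergmanMeasure hk] at hmean
  simp only [e] at hmean
  rw [integral_const_mul, integral_smul_invariantMeasure h fun x : domain => weight k x •
    (conj (kernel k x (h.map 0)) * f x), ← mul_smul_comm, ← integral_bergmanMeasure hk,
    kernel_self_eq_exp_potential hk hp, inv_mul_eq_iff_eq_mul₀ hne, mul_div_cancel₀ _ hne] at hmean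
  exact hmean

/-! ### Completeness of the coherent state vectors -/

lemma P_one_zero (n : ℕ) : P n (1, 0) = 1 := by
  have hn : (n.factorial : ℂ) ≠ 0 := by exact_mod_cast n.factorial_ne_zero
  rw [P, Finset.sum_eq_single 0]
  · simp [hn]
  · intro j _ hj
    simp [hj]
  · simp

lemma basisFun_scale (k : ℝ) (n m : ℕ) (s w : ℂ) :
    basisFun k n m (s, s ^ 2 * w) = s ^ (n + 2 * m) * basisFun k n m (1, w) := by
  have h := P_scale n s (1, w)
  rw [mul_one] at h
  rw [basisFun, basisFun, h, diskMonomial, diskMonomial]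
  ring

instance finite_weightFibre (j : ℕ) : Finite {i : ℕ × ℕ // i.1 + 2 * i.2 = j} :=
  ((Set.finite_Iic (j, j)).subset fun i (hi : i.1 + 2 * i.2 = j) =>
    Prod.mk_le_mk.2 ⟨by omega, by omega⟩).to_subtype

instance (j : ℕ) : Fintype {i : ℕ × ℕ // i.1 + 2 * i.2 = j} := Fintype.ofFinite _

/-- If `f_ψ` vanishes then so do its components which are homogeneous for the action
`(z, w) ↦ (s z, s² w)`, because these are the coefficients of a power series in `s`. -/
lemma sum_weightFibre_eq_zero {k : ℝ} (hk : 1 ≤ k) {ψ : FockSpace}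
    (h : ∀ p ∈ domain, symbol k ψ p = 0) {w : ℂ} (hw : ‖w‖ < 1) (j : ℕ) :
    ∑ i : {i : ℕ × ℕ // i.1 + 2 * i.2 = j}, basisFun k i.1.1 i.1.2 (1, w) * ψ i.1 = 0 := by
  let A : ℕ → ℂ := fun j =>
    ∑ i : {i : ℕ × ℕ // i.1 + 2 * i.2 = j}, basisFun k i.1.1 i.1.2 (1, w) * ψ i.1
  have hA : HasFPowerSeriesAt 0 (FormalMultilinearSeries.ofScalars ℂ A) (0 : ℂ) := by
    refine hasFPowerSeriesAt_iff.2 ?_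
    filter_upwards [Metric.ball_mem_nhds (0 : ℂ) one_pos] with s hs
    have hs' : ‖s‖ ≤ 1 := by
      have : ‖s‖ < 1 := by simpa using hs
      exact this.le
    have hp : ((s, s ^ 2 * w) : ℂ × ℂ) ∈ domain := by
      change ‖s ^ 2 * w‖ < 1
      rw [norm_mul, norm_pow]
      exact (mul_le_of_le_one_left (norm_nonneg _) (pow_le_one₀ (norm_nonneg _) hs')).trans_lt hw
    have h1 := hasSum_symbol hk ψ hp
    rw [h _ hp, ← (Equiv.sigmaFiberEquiv fun i : ℕ × ℕ => i.1 + 2 * i.2).hasSum_iff] at h1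
    have h2 := h1.sigma fun j => hasSum_fintype _
    refine h2.congr_fun fun j => ?_
    rw [FormalMultilinearSeries.coeff_ofScalars, smul_eq_mul, Finset.mul_sum]
    refine Finset.sum_congr rfl fun i _ => ?_
    simp only [Function.comp, Equiv.sigmaFiberEquiv, Equiv.coe_fn_mk]
    rw [basisFun_scale, i.2, mul_assoc]
  have h0 : (FormalMultilinearSeries.ofScalars ℂ A).coeff j = 0 := by
    rw [hA.eq_zero]
    rfl
  rwa [FormalMultilinearSeries.coeff_ofScalars] at h0

/-- The vector `ψ` is determined by the function `f_ψ`. In each homogeneous component the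
coefficients vanish one after the other, since `basisFun k n m (1, w)` has order `m` at `w = 0`. -/
lemma eq_zero_of_symbol_eq_zero {k : ℝ} (hk : 1 ≤ k) {ψ : FockSpace}
    (h : ∀ p ∈ domain, symbol k ψ p = 0) : ψ = 0 := by
  have key : ∀ m n : ℕ, ψ (n, m) = 0 := by
    intro m
    induction m using Nat.strong_induction_on with
    | _ m ih =>
      intro n
      let c : ℕ × ℕ → ℂ := fun i =>
        ((raisedNorm k i.2 / i.2.factorial : ℝ) : ℂ) / (√(i.1.factorial : ℝ) : ℝ) * ψ i
      let g : ℂ → ℂ := fun w => ∑ i : {i : ℕ × ℕ // i.1 + 2 * i.2 = n + 2 * m},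
        c i.1 * w ^ (i.1.2 - m) * P i.1.1 (1, w)
      have hg : Continuous g := by
        unfold g P
        fun_prop
      have hg0 : ∀ w ∈ Metric.ball (0 : ℂ) 1 ∩ {0}ᶜ, g w = 0 := fun w hw => by
        have hw0 : w ≠ 0 := hw.2
        have h1 := sum_weightFibre_eq_zero hk h (w := w) (by simpa using hw.1) (n + 2 * m)
        refine (mul_eq_zero.1 (?_ : w ^ m * g w = 0)).resolve_left (pow_ne_zero _ hw0)
        rw [← h1, Finset.mul_sum]
        refine Finset.sum_congr rfl fun i _ => ?_
        rcases lt_or_ge i.1.2 m with him | him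
        · have := ih i.1.2 him i.1.1
          simp only [c, Prod.mk.eta] at this ⊢
          simp [this]
        · rw [basisFun, diskMonomial_eq, show w ^ i.1.2 = w ^ m * w ^ (i.1.2 - m) by
            rw [← pow_add, Nat.add_sub_cancel' him]]
          simp only [c]
          ring
      have hg00 : g 0 = 0 := by
        have h1 : Filter.Tendsto g (nhdsWithin 0 {0}ᶜ) (nhds (g 0)) :=
          hg.continuousAt.tendsto.mono_left nhdsWithin_le_nhds
        refine tendsto_nhds_unique h1 (tendsto_const_nhds.congr' ?_)
        filter_upwards [inter_mem_nhdsWithin {0}ᶜ (Metric.ball_mem_nhds (0 : ℂ) one_pos)] with w hw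
        exact (hg0 w hw.symm).symm
      have hg1 : g 0 = c (n, m) := by
        simp only [g]
        rw [Finset.sum_eq_single ⟨(n, m), rfl⟩]
        · simp [P_one_zero]
        · rintro ⟨⟨a, b⟩, hab⟩ _ hne
          dsimp only at hab ⊢
          rcases lt_trichotomy b m with hb | hb | hb
          · have := ih b hb a
            simp [c, this]
          · refine absurd ?_ hne
            simp only [Subtype.mk.injEq, Prod.mk.injEq]
            omega
          · rw [zero_pow (by omega)]
            simp
        · simp
      rw [hg1] at hg00
      refine (mul_eq_zero.1 hg00).resolve_left (div_ne_zero ?_ ?_)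
      · exact_mod_cast (div_pos (raisedNorm_pos hk m) (by positivity)).ne'
      · exact_mod_cast (Real.sqrt_pos.2 (by positivity)).ne'
  ext i
  exact key i.2 i.1

/-! ### The unitary map onto the reproducing kernel Hilbert space -/

lemma inner_linearCombination_congr {ι E F : Type*} [NormedAddCommGroup E] [InnerProductSpace ℂ E]
    [NormedAddCommGroup F] [InnerProductSpace ℂ F] {u : ι → E} {v : ι → F}
    (h : ∀ i j, ⟪u i, u j⟫_ℂ = ⟪v i, v j⟫_ℂ) (a b : ι →₀ ℂ) :
    ⟪Finsupp.linearCombination ℂ u a, Finsupp.linearCombination ℂ u b⟫_ℂ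
      = ⟪Finsupp.linearCombination ℂ v a, Finsupp.linearCombination ℂ v b⟫_ℂ := by
  simp only [Finsupp.linearCombination_apply, Finsupp.sum, sum_inner, inner_sum, inner_smul_left,
    inner_smul_right, h]

lemma norm_linearCombination_congr {ι E F : Type*} [NormedAddCommGroup E] [InnerProductSpace ℂ E]
    [NormedAddCommGroup F] [InnerProductSpace ℂ F] {u : ι → E} {v : ι → F}
    (h : ∀ i j, ⟪u i, u j⟫_ℂ = ⟪v i, v j⟫_ℂ) (a : ι →₀ ℂ) :
    ‖Finsupp.linearCombination ℂ u a‖ = ‖Finsupp.linearCombination ℂ v a‖ := by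
  rw [@norm_eq_sqrt_re_inner ℂ, @norm_eq_sqrt_re_inner ℂ, inner_linearCombination_congr h]

/-- The vector `e_{conj z, conj w}`. -/
def conjCoherent (k : ℝ) (x : domain) : FockSpace := coherent k (conj x.1.1, conj x.1.2)

/-- The kernel function `K(·, x)` as an element of the reproducing kernel Hilbert space. -/
def kernelVector (k : ℝ) (x : domain) : FK k := RKHS.kerFun (FK k) x 1

lemma inner_kernelVector (k : ℝ) (x : domain) (F : FK k) : ⟪kernelVector k x, F⟫_ℂ = F x := by
  rw [kernelVector, RKHS.kerFun_inner]
  simp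

lemma kernelVector_apply (k : ℝ) (x y : domain) : kernelVector k x y = kernel k y x := by
  rw [kernelVector, RKHS.kerFun_apply, RKHS.OfKernel.kernel_ofKernel]
  simp [kernelMatrix]

lemma inner_conjCoherent (k : ℝ) (x y : domain) :
    ⟪conjCoherent k x, conjCoherent k y⟫_ℂ = ⟪kernelVector k x, kernelVector k y⟫_ℂ := by
  rw [inner_kernelVector, kernelVector_apply]
  rfl

lemma denseRange_conjCoherent {k : ℝ} (hk : 1 ≤ k) :
    DenseRange (Finsupp.linearCombination ℂ (conjCoherent k)) := by
  rw [DenseRange, ← LinearMap.coe_range, Finsupp.range_linearCombination,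
    Submodule.dense_iff_topologicalClosure_eq_top, Submodule.topologicalClosure_eq_top_iff,
    Submodule.eq_bot_iff]
  intro ψ hψ
  exact eq_zero_of_symbol_eq_zero hk fun p hp =>
    hψ _ (Submodule.subset_span ⟨⟨p, hp⟩, rfl⟩)

lemma denseRange_kernelVector (k : ℝ) :
    DenseRange (Finsupp.linearCombination ℂ (kernelVector k)) := by
  rw [DenseRange, ← LinearMap.coe_range, Finsupp.range_linearCombination,
    Submodule.dense_iff_topologicalClosure_eq_top, Submodule.topologicalClosure_eq_top_iff,
    Submodule.eq_bot_iff]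
  intro F hF
  refine RKHS.ext (𝕜 := ℂ) fun x => ?_
  rw [← inner_kernelVector, hF _ (Submodule.subset_span ⟨x, rfl⟩)]
  simp

/-- The unitary map `ψ ↦ f_ψ`, which sends `e_{conj z, conj w}` to the kernel function at
`(z, w)`. -/
def symbolEquiv {k : ℝ} (hk : 1 ≤ k) : FockSpace ≃ₗᵢ[ℂ] FK k :=
  (LinearEquiv.refl ℂ (domain →₀ ℂ)).extendOfIsometry
    (Finsupp.linearCombination ℂ (conjCoherent k)) (Finsupp.linearCombination ℂ (kernelVector k))
    (denseRange_conjCoherent hk) (denseRange_kernelVector k)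
    fun a => (norm_linearCombination_congr (inner_conjCoherent k) a).symm

lemma symbolEquiv_conjCoherent {k : ℝ} (hk : 1 ≤ k) (x : domain) :
    symbolEquiv hk (conjCoherent k x) = kernelVector k x := by
  have h := (LinearEquiv.refl ℂ (domain →₀ ℂ)).extendOfIsometry_eq
    (Finsupp.linearCombination ℂ (conjCoherent k)) (Finsupp.linearCombination ℂ (kernelVector k))
    (denseRange_conjCoherent hk) (denseRange_kernelVector k)
    (fun a => (norm_linearCombination_congr (inner_conjCoherent k) a).symm) (Finsupp.single x 1)
  simp only [Finsupp.linearCombination_single, one_smul, LinearEquiv.refl_apply] at h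
  exact h

lemma symbolEquiv_apply {k : ℝ} (hk : 1 ≤ k) (ψ : FockSpace) (x : domain) :
    symbolEquiv hk ψ x = symbol k ψ x := by
  rw [← inner_kernelVector, ← symbolEquiv_conjCoherent hk, LinearIsometryEquiv.inner_map_map]
  rfl

/-! ### Square integrable holomorphic functions -/

/-- The kernel function `K(·, x)` as an element of the space of square integrable functions. -/
def kernelLp {k : ℝ} (hk : 1 ≤ k) (x : domain) : Lp ℂ 2 (bergmanMeasure k) :=
  (memLp_kernel hk x.2).toLp

lemma inner_kernelLp {k : ℝ} (hk : 1 ≤ k) {f : ℂ × ℂ → ℂ} (hf : DifferentiableOn ℂ f domain)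
    (hi : MemLp (fun x : domain => f x) 2 (bergmanMeasure k)) (x : domain) :
    ⟪kernelLp hk x, hi.toLp⟫_ℂ = f x := by
  rw [L2.inner_def, ← integral_conj_kernel_mul hk hf hi x.2]
  refine integral_congr_ae ?_
  filter_upwards [hi.coeFn_toLp, (memLp_kernel hk x.2).coeFn_toLp] with y h1 h2
  rw [kernelLp, h1, h2, RCLike.inner_apply, mul_comm]

lemma inner_kernelVector_eq_inner_kernelLp {k : ℝ} (hk : 1 ≤ k) (x y : domain) :
    ⟪kernelVector k x, kernelVector k y⟫_ℂ = ⟪kernelLp hk x, kernelLp hk y⟫_ℂ := by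
  rw [inner_kernelVector, kernelVector_apply, kernelLp, kernelLp]
  exact (inner_kernelLp hk (differentiableOn_kernel hk y) (memLp_kernel hk y.2) x).symm

/-- The isometric embedding of the reproducing kernel Hilbert space into the space of square
integrable functions, defined by its values on the kernel functions. -/
def toLp {k : ℝ} (hk : 1 ≤ k) : FK k →L[ℂ] Lp ℂ 2 (bergmanMeasure k) :=
  (Finsupp.linearCombination ℂ (kernelLp hk)).extendOfNorm
    (Finsupp.linearCombination ℂ (kernelVector k))

lemma toLp_linearCombination {k : ℝ} (hk : 1 ≤ k) (a : domain →₀ ℂ) :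
    toLp hk (Finsupp.linearCombination ℂ (kernelVector k) a)
      = Finsupp.linearCombination ℂ (kernelLp hk) a := by
  refine LinearMap.extendOfNorm_eq (denseRange_kernelVector k) ⟨1, fun b => ?_⟩ a
  rw [one_mul, norm_linearCombination_congr (inner_kernelVector_eq_inner_kernelLp hk)]

lemma toLp_kernelVector {k : ℝ} (hk : 1 ≤ k) (x : domain) :
    toLp hk (kernelVector k x) = kernelLp hk x := by
  simpa using toLp_linearCombination hk (Finsupp.single x 1)

lemma inner_toLp {k : ℝ} (hk : 1 ≤ k) (F G : FK k) : ⟪toLp hk F, toLp hk G⟫_ℂ = ⟪F, G⟫_ℂ := by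
  refine (denseRange_kernelVector k).induction_on₂ (p := fun F G => ⟪toLp hk F, toLp hk G⟫_ℂ
    = ⟪F, G⟫_ℂ) (isClosed_eq (by fun_prop) (by fun_prop)) (fun a b => ?_) F G
  rw [toLp_linearCombination, toLp_linearCombination,
    inner_linearCombination_congr (inner_kernelVector_eq_inner_kernelLp hk)]

lemma coeFn_linearCombination_kernelLp {k : ℝ} (hk : 1 ≤ k) (a : domain →₀ ℂ) :
    Finsupp.linearCombination ℂ (kernelLp hk) a
      =ᵐ[bergmanMeasure k] Finsupp.linearCombination ℂ (kernelVector k) a := by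
  induction a using Finsupp.induction_linear with
  | zero =>
    simp only [map_zero, RKHS.coe_zero (𝕜 := ℂ)]
    exact Lp.coeFn_zero _ _ _
  | add a b ha hb =>
    rw [map_add, map_add, RKHS.coe_add (𝕜 := ℂ)]
    filter_upwards [Lp.coeFn_add (Finsupp.linearCombination ℂ (kernelLp hk) a)
      (Finsupp.linearCombination ℂ (kernelLp hk) b), ha, hb] with x h1 h2 h3
    rw [h1, Pi.add_apply, Pi.add_apply, h2, h3]
  | single x c =>
    rw [Finsupp.linearCombination_single, Finsupp.linearCombination_single,
      RKHS.coe_smul (𝕜 := ℂ)]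
    filter_upwards [Lp.coeFn_smul c (kernelLp hk x), (memLp_kernel hk x.2).coeFn_toLp] with y h1 h2
    rw [h1, Pi.smul_apply, Pi.smul_apply, kernelLp, h2, kernelVector_apply]

/-- The embedding does not change functions: convergence in the reproducing kernel Hilbert space
implies pointwise convergence, convergence in `L²` implies convergence almost everywhere along a
subsequence. -/
lemma coeFn_toLp {k : ℝ} (hk : 1 ≤ k) (F : FK k) : toLp hk F =ᵐ[bergmanMeasure k] F := by
  obtain ⟨u, hu, hF⟩ := mem_closure_iff_seq_limit.1 (denseRange_kernelVector k F)
  choose a ha using hu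
  have h1 := tendstoInMeasure_of_tendsto_Lp (((toLp hk).continuous.tendsto F).comp hF)
  obtain ⟨ns, hns, h2⟩ := h1.exists_seq_tendsto_ae
  have h3 : ∀ n, toLp hk (u n) =ᵐ[bergmanMeasure k] u n := fun n => by
    rw [← ha, toLp_linearCombination]
    exact coeFn_linearCombination_kernelLp hk _
  filter_upwards [h2, ae_all_iff.2 h3] with x hx h3x
  refine tendsto_nhds_unique hx ?_
  have h4 := ((RKHS.continuous_eval (𝕜 := ℂ) (H := FK k) x).tendsto F).comp
    (hF.comp hns.tendsto_atTop)
  refine h4.congr fun i => ?_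
  simp only [Function.comp]
  rw [h3x]

lemma memLp_FK {k : ℝ} (hk : 1 ≤ k) (F : FK k) : MemLp F 2 (bergmanMeasure k) :=
  (memLp_congr_ae (coeFn_toLp hk F)).1 (Lp.memLp _)

lemma inner_FK_eq {k : ℝ} (hk : 1 ≤ k) (F G : FK k) :
    Integrable (fun x => conj (F x) * G x * (weight k x : ℂ)) invariantMeasure ∧
      ⟪F, G⟫_ℂ = (normalization k : ℂ) *
        ∫ x, conj (F x) * G x * (weight k x : ℂ) ∂invariantMeasure := by
  have e : ∀ x : domain, weight k x • (conj (F x) * G x) = conj (F x) * G x * (weight k x : ℂ) :=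
    fun x => by rw [Complex.real_smul, mul_comm]
  constructor
  · have h : Integrable (fun x => conj (F x) * G x) (bergmanMeasure k) :=
      (memLp_FK hk F).star.integrable_mul (memLp_FK hk G)
    rw [integrable_bergmanMeasure_iff hk] at h
    simpa only [e] using h
  · have h : ⟪F, G⟫_ℂ = ∫ x, conj (F x) * G x ∂bergmanMeasure k := by
      rw [← inner_toLp hk, L2.inner_def]
      refine integral_congr_ae ?_
      filter_upwards [coeFn_toLp hk F, coeFn_toLp hk G] with x h1 h2
      rw [h1, h2, RCLike.inner_apply, mul_comm]
    rw [h, integral_bergmanMeasure hk, Complex.real_smul]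
    simp only [e]

/-- A square integrable holomorphic function is its own orthogonal projection to the reproducing
kernel Hilbert space, by the reproducing property. -/
lemma exists_FK_iff {k : ℝ} (hk : 1 ≤ k) (f : domain → ℂ) : (∃ F : FK k, ∀ x, F x = f x) ↔
    IsHolomorphic f ∧ Integrable (fun x => ‖f x‖ ^ 2 * weight k x) invariantMeasure := by
  have e : ∀ x : domain, weight k x • ‖f x‖ ^ 2 = ‖f x‖ ^ 2 * weight k x := fun x => by
    rw [smul_eq_mul, mul_comm]
  constructor
  · rintro ⟨F, hF⟩
    obtain rfl : ⇑F = f := funext hF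
    refine ⟨⟨symbol k ((symbolEquiv hk).symm F), differentiableOn_symbol hk _, fun x => ?_⟩, ?_⟩
    · rw [← symbolEquiv_apply hk, LinearIsometryEquiv.apply_symm_apply]
    · have h := (memLp_two_iff_integrable_sq_norm (memLp_FK hk F).1).1 (memLp_FK hk F)
      rw [integrable_bergmanMeasure_iff hk] at h
      simpa only [e] using h
  · rintro ⟨⟨f', hf, hff'⟩, hi⟩
    obtain rfl : (fun x : domain => f' x) = f := funext hff'
    have hL : MemLp (fun x : domain => f' x) 2 (bergmanMeasure k) := by
      rw [memLp_two_iff_integrable_sq_norm (aestronglyMeasurable_of_differentiableOn hf _),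
        integrable_bergmanMeasure_iff hk]
      simpa only [e] using hi
    refine ⟨(toLp hk).adjoint hL.toLp, fun x => ?_⟩
    rw [← inner_kernelVector, ContinuousLinearMap.adjoint_inner_right, toLp_kernelVector,
      inner_kernelLp hk hf hL]

end Jacobi

end

theorem mainTheorem6 (k : ℝ) (hk : ∃ N : ℕ, 2 ≤ N ∧ 2 * k = N) :
    -- the Jacobi group acts holomorphically and transitively, with isotropy group `U(1) × ℝ`
    (∀ h : JacobiGroup, DifferentiableOn ℂ h.map domain) ∧
    MulAction.IsPretransitive JacobiGroup domain ∧
    (∀ (h : JacobiGroup) (o : domain), (o : ℂ × ℂ) = (0, 0) →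
      (h ∈ MulAction.stabilizer JacobiGroup o ↔ h.α = 0 ∧ h.g.b = 0)) ∧
    -- the coherent state vectors are well defined
    (∀ p ∈ domain, Summable (coherentTerm k p)) ∧
    -- the kernel
    (∀ p ∈ domain, ∀ q ∈ domain,
      kernel k p q = (1 - p.2 * conj q.2) ^ ((-(2 * k) : ℝ) : ℂ) *
        Complex.exp ((2 * conj q.1 * p.1 + p.1 ^ 2 * conj q.2 + conj q.1 ^ 2 * p.2) /
          (2 * (1 - p.2 * conj q.2)))) ∧
    -- the Kähler potential `f = log K`
    (∀ p ∈ domain, kernel k p p = (Real.exp (potential k p) : ℂ)) ∧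
    (∀ p ∈ domain, (potential k p : ℂ) =
      (2 * p.1 * conj p.1 + p.1 ^ 2 * conj p.2 + conj p.1 ^ 2 * p.2) / (2 * (1 - p.2 * conj p.2))
        - 2 * k * Complex.log (1 - p.2 * conj p.2)) ∧
    ContDiffOn ℝ (⊤ : ℕ∞) (potential k) domain ∧
    -- the Kähler form
    (∀ p ∈ domain, (metric k p).PosDef) ∧
    (∀ p ∈ domain, extDeriv (kahlerForm k) p = 0) ∧
    (∀ p ∈ domain, -Complex.I • kahlerForm k p =
      (2 * k / (1 - p.2 * conj p.2) ^ 2 : ℂ) • wedge (dcoord 1) (conjForm (dcoord 1)) +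
        (1 / (1 - p.2 * conj p.2) : ℂ) • wedge (formA p) (conjForm (formA p))) ∧
    (∀ (h : JacobiGroup), ∀ p ∈ domain,
      (kahlerForm k (h.map p)).compContinuousLinearMap (fderiv ℝ h.map p) = kahlerForm k p) ∧
    -- the holomorphic polynomials attached to the coherent state vectors
    (∀ (n m : ℕ), ∀ p ∈ domain, symbol k (basisVector k n m) p =
      diskMonomial k m p.2 * (P n p / (√(n.factorial : ℝ) : ℝ))) ∧
    -- they form an orthonormal basis of the reproducing kernel Hilbert space
    (∃ B : HilbertBasis (ℕ × ℕ) ℂ (FK k), ∀ (n m : ℕ) (x : domain),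
      B (n, m) x = diskMonomial k m x.1.2 * (P n x / (√(n.factorial : ℝ) : ℝ))) ∧
    -- `ψ ↦ f_ψ` is a unitary map onto the reproducing kernel Hilbert space
    (∃ U : FockSpace ≃ₗᵢ[ℂ] FK k, ∀ (ψ : FockSpace) (x : domain), U ψ x = symbol k ψ x) ∧
    -- `FK` consists of the square integrable holomorphic functions
    (∀ f : domain → ℂ, (∃ F : FK k, ∀ x, F x = f x) ↔
      IsHolomorphic f ∧ Integrable (fun x => ‖f x‖ ^ 2 * weight k x) invariantMeasure) ∧
    -- the scalar product
    (∀ F G : FK k, Integrable (fun x => conj (F x) * G x * (weight k x : ℂ)) invariantMeasure ∧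
      ⟪F, G⟫_ℂ = (normalization k : ℂ) *
        ∫ x, conj (F x) * G x * (weight k x : ℂ) ∂invariantMeasure) ∧
    -- invariance of the measure
    (∀ h : JacobiGroup,
      MeasurePreserving (fun x : domain => h • x) invariantMeasure invariantMeasure) := by
  have hk : 1 ≤ k := by
    obtain ⟨N, hN, h⟩ := hk
    have : (2 : ℝ) ≤ N := by exact_mod_cast hN
    linarith
  have hbasis : ∀ (n m : ℕ), ∀ p ∈ domain, symbol k (basisVector k n m) p =
      diskMonomial k m p.2 * (P n p / (√(n.factorial : ℝ) : ℝ)) :=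
    fun n m p hp => symbol_basisVector hk n m hp
  refine ⟨JacobiGroup.differentiableOn_map, isPretransitive, mem_stabilizer_iff,
    fun p hp => summable_coherentTerm hk hp, fun p hp q hq => kernel_eq hk hp hq,
    fun p hp => kernel_self_eq_exp_potential hk hp, fun p hp => ofReal_potential hk hp,
    contDiffOn_potential hk, fun p hp => metric_posDef hk hp, fun p hp => extDeriv_kahlerForm hk hp,
    fun p hp => neg_I_smul_kahlerForm hk hp, fun h p hp => kahlerForm_invariant hk h hp, hbasis,
    ⟨HilbertBasis.ofRepr (symbolEquiv hk).symm, fun n m x => ?_⟩,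
    ⟨symbolEquiv hk, symbolEquiv_apply hk⟩, exists_FK_iff hk, inner_FK_eq hk,
    measurePreserving_smul⟩
  rw [← hbasis n m x x.2, ← symbolEquiv_apply hk, basisVector_eq hk,
    ← HilbertBasis.repr_symm_single]
  rfl
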